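/- **Setting.** Let $\Lambda>0$, $\lambda=\Lambda/3$ and $q\in\{0,1,2\}$. Let $M$ be a smooth four-dimensional manifold with boundary $\Sigma=\partial M$, let $g_{ab}$ be a smooth (up to the boundary) Lorentzian metric on $M$ of signature $(-,+,+,+)$, let $T_{ab}$ be a smooth (up to the boundary) symmetric tensor field on $M$, and let $\Omega\ge 0$ be a smooth function on $M$ with $\Omega^{-1}(0)=\Sigma$ and $d\Omega\neq0$ along $\Sigma$. On $\widetilde M=M\setminus\Sigma$ put $\widetilde g_{ab}=\Omega^{-2}g_{ab}$ and $\widetilde T_{ab}=\Omega^{q}T_{ab}$, and assume the Einstein equations $\widetilde R_{ab}-\frac12\widetilde R\,\widetilde g_{ab}+\Lambda\widetilde g_{ab}=\widetilde T_{ab}$ there. (So $(\widetilde M,\widetilde g_{ab})$ is asymptotically de Sitter with conformal extension $(M,g_{ab})$; the case $q=0$, in which $\widetilde T_{ab}$ need not vanish on $\Sigma$, is included.) **Notation.** Indices are moved with $g$; $[\nabla_a,\nabla_b]v^c=R_{ab}{}^c{}_dv^d$; $P_{ab}=\frac12(R_{ab}-\frac16Rg_{ab})$ is the Schouten tensor,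 $J=P_a{}^a$, $A_{abc}=\nabla_bP_{ca}-\nabla_cP_{ba}$ is the Cotton tensor and $C_{abcd}$ the Weyl tensor. Put $n_a=\lambda^{-1/2}\nabla_a\Omega$ and $T=g^{ab}T_{ab}$; an index $n$ denotes contraction with $n^a$, and $\nabla_n=n^a\nabla_a$. $\top$ is the orthogonal projection to $\Sigma$, $\mathring\top$ the trace-free symmetric part of the projection with respect to the induced metric $\overline g_{ab}$, $\overline\nabla$ the Levi-Civita connection of $\overline g_{ab}$, $K_{ab}=(\nabla_an_b)^\top$, and $H=\overline g^{ab}K_{ab}$ is the mean curvature. Round brackets denote symmetrization, and $(ab)_0$ the trace-free symmetric part. Let $\rho=-\frac14(\Delta\Omega+J\Omega)$ and $$E_{ab}=\nabla_a\nabla_b\Omega+\Omega P_{ab}+\rho\, g_{ab}.$$ On trace-free symmetric tensors $t_{ab}$ of conformal weight $w$ let $$\delta_Rt_{ab}=\mathring\top\Big[\nabla_nt_{ab}-\tfrac{w-2}{3}Ht_{ab}+\tfrac{2}{w-3}\overline\nabla_{(a}t^\top_{b)n}\Big]$$ along $\Sigma$ (weight $w-1$), and $$\begin{aligned}\mathrm{ID}\,t_{ab}=\;&2(w-1)\sqrt\lambda\Big(\nabla_nt_{ab}+\tfrac{w-2}{\sqrt\lambda}\rho\,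 t_{ab}-\tfrac{2(w-2)}{(w-3)(w+2)}n_{(a}\nabla^ct_{b)_0c}+\tfrac{2}{w-3}\big[n^c\nabla_{(a}t_{b)_0c}+t_{(a}{}^c\nabla_{b)_0}n_c\big]\Big)\\&-\Omega\Big(\Delta t_{ab}+(w-2)Jt_{ab}+\tfrac{8}{(w-3)(w+2)}\nabla_{(a}\nabla^ct_{b)_0c}-4P_{(a}{}^ct_{b)_0c}\Big)\end{aligned}$$ (weight $w-1$). The conformal fundamental forms of $\Sigma$ used here are $\mathring{\mathcal K}^{(3)}_{ab}=\delta_RE_{ab}$ and $\mathring{\mathcal K}^{(5)}_{ab}=\delta_R\,\mathrm{ID}\,\mathrm{ID}\,E_{ab}$, with $E_{ab}$ of weight $1$, and $$\mathring{\mathcal K}^{(4)}_{ab}=\lambda\big(\overline\nabla{}^cC^\top_{n(ab)c}-A^\top_{(a|n|b)}-\tfrac13HC_{nanb}\big).$$ **Theorem.** 1. On $\Sigma$: $(q-2)n^bT_{ab}+n_aT=0$ and $\nabla_n\big[(q-2)T_{ab}n^b+n_aT\big]-\nabla_bT_a{}^b=0$. Moreover, near $\Sigma$, $n_an^a=-1+\frac{2H}{\sqrt{3\Lambda}}\Omega+O(\Omega^2)$,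 for every smooth extension of $H$ off $\Sigma$. 2. For $q=0$ and $q=2$, $\mathring{\mathcal K}^{(q+3)}_{ab}=C(q,\Lambda)\,\mathring\top(T_{ab})$ on $\Sigma$, with $C(0,\Lambda)=-\frac12(\Lambda/3)^{1/2}$ and $C(2,\Lambda)=-18(\Lambda/3)^{5/2}$. 3. On $\Sigma$, $$\overline\nabla{}^b\mathring{\mathcal K}^{(4)}_{ab}=\begin{cases}\left(\frac\Lambda3\right)^{3/2}\left(\frac13\overline\nabla_aT-\sqrt{\frac\Lambda3}\,j_a\right)&\text{for }q=1,\\[2pt]-\frac{\Lambda^2}{9}\,\top(n^bT_{ab})&\text{for }q=2,\end{cases}$$ where, for $q=1$, the covector $j_a$ is defined near $\Sigma$ by the expansion $(n^bT_{ab})^\top=\Omega j_a+O(\Omega^2)$, with $(n^bT_{ab})^\top=n^bT_{ab}-n_a\frac{n^bn^cT_{bc}}{n_dn^d}$; locally near each point of $\Sigma$ a smooth such $j_a$ exists. 4. For $q=1$, $T_{ab}=-n_an_bT$ on $\Sigma$. 5. For $q\ge1$, $\mathring{\mathcal K}^{(4)}_{ab}$ is not otherwise determined by local data on $\Sigma$: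 for all $\Lambda>0$ and $q\in\{1,2\}$ there are two spacetimes as above on the same $M$ (the closed half-space of $\mathbb R^4$), with the same $\Omega$ and the same $T_{ab}$, whose metrics $g_{ab}$ differ by $O(\Omega^3)$ at $\Sigma$ (so that they have the same induced metric and the same second fundamental form on $\Sigma$), but whose forms $\mathring{\mathcal K}^{(4)}_{ab}$ are different. -/

import Mathlib

open Set Filter Topology Asymptotics
open scoped Manifold ContDiff

noncomputable section

namespace ConformalInfinity

/-! ## Tensor calculus in coordinates

A tensor field in coordinates is given by its component functions on `ℝⁿ`. All derivatives are
taken within a set `s` of coordinates with unique derivatives: `s` is a half-space for a chart of a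
manifold with boundary, and everything for a chart of a manifold without boundary. -/

/-- The space of coordinates. -/
abbrev Coord (n : ℕ) := EuclideanSpace ℝ (Fin n)

/-- Components `t_a` of a covector field. -/
abbrev Tensor1 (n : ℕ) := Coord n → Fin n → ℝ

/-- Components `t_{ab}` of a covariant 2-tensor field. -/
abbrev Tensor2 (n : ℕ) := Coord n → Fin n → Fin n → ℝ

/-- Components `t_{abc}` of a covariant 3-tensor field. -/
abbrev Tensor3 (n : ℕ) := Coord n → Fin n → Fin n → Fin n → ℝ

/-- Components of a 4-tensor field. -/
abbrev Tensor4 (n : ℕ) := Coord n → Fin n → Fin n → Fin n → Fin n → ℝ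

section Calculus

variable {n : ℕ} (s : Set (Coord n)) (g : Tensor2 n)

/-- The partial derivative `∂_i f`. -/
def pderiv (f : Coord n → ℝ) (y : Coord n) (i : Fin n) : ℝ :=
  fderivWithin ℝ f s y (EuclideanSpace.single i 1)

/-- The inverse metric `g^{ij}`. -/
def invMetric (y : Coord n) (i j : Fin n) : ℝ := (Matrix.of (g y))⁻¹ i j

/-- The Christoffel symbols `Γ^k_{ij}` of the Levi-Civita connection of `g`. -/
def christoffel (y : Coord n) (k i j : Fin n) : ℝ :=
  (1 / 2) * ∑ l, invMetric g y k l *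
    (pderiv s (fun x => g x j l) y i + pderiv s (fun x => g x i l) y j
      - pderiv s (fun x => g x i j) y l)

/-- `∇_c t_a`, with the derivative index first. -/
def cov1 (t : Tensor1 n) : Tensor2 n := fun y c a =>
  pderiv s (fun x => t x a) y c - ∑ d, christoffel s g y d c a * t y d

/-- `∇_c t_{ab}`, with the derivative index first. -/
def cov2 (t : Tensor2 n) : Tensor3 n := fun y c a b =>
  pderiv s (fun x => t x a b) y c
    - ∑ d, christoffel s g y d c a * t y d b
    - ∑ d, christoffel s g y d c b * t y a d

/-- `∇_e t_{abc}`, with the derivative index first. -/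
def cov3 (t : Tensor3 n) : Tensor4 n := fun y e a b c =>
  pderiv s (fun x => t x a b c) y e
    - ∑ d, christoffel s g y d e a * t y d b c
    - ∑ d, christoffel s g y d e b * t y a d c
    - ∑ d, christoffel s g y d e c * t y a b d

/-- The trace `g^{ab} t_{ab}`. -/
def trace2 (t : Tensor2 n) (y : Coord n) : ℝ := ∑ a, ∑ b, invMetric g y a b * t y a b

/-- The trace-free symmetric part `t_{(ab)_0}`. -/
def symTraceFree (t : Tensor2 n) : Tensor2 n := fun y a b =>
  (1 / 2) * (t y a b + t y b a) - (1 / (n : ℝ)) * g y a b * trace2 g t y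

/-- The divergence `∇^c t_{ac}`. -/
def div2 (t : Tensor2 n) : Tensor1 n := fun y a =>
  ∑ b, ∑ c, invMetric g y b c * cov2 s g t y b a c

/-- The rough Laplacian `∇^c ∇_c t_{ab}`. -/
def laplacian2 (t : Tensor2 n) : Tensor2 n := fun y a b =>
  ∑ c, ∑ d, invMetric g y c d * cov3 s g (cov2 s g t) y c d a b

/-- `R_{ab}{}^c{}_d` with `[∇_a, ∇_b] v^c = R_{ab}{}^c{}_d v^d`. -/
def riemannUp (y : Coord n) (a b c d : Fin n) : ℝ :=
  pderiv s (fun x => christoffel s g x c b d) y a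
    - pderiv s (fun x => christoffel s g x c a d) y b
    + ∑ e, (christoffel s g y c a e * christoffel s g y e b d
      - christoffel s g y c b e * christoffel s g y e a d)

/-- `R_{abcd} = g_{ce} R_{ab}{}^e{}_d`. -/
def riemann : Tensor4 n := fun y a b c d => ∑ e, g y c e * riemannUp s g y a b e d

/-- The Ricci tensor `R_{bd} = R_{ab}{}^a{}_d`. -/
def ricci : Tensor2 n := fun y b d => ∑ a, riemannUp s g y a b a d

/-- The scalar curvature. -/
def scalarCurv (y : Coord n) : ℝ := trace2 g (ricci s g) y

/-- The Schouten tensor `P_{ab} = (R_{ab} - R g_{ab} / (2 (n - 1))) / (n - 2)`. -/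
def schouten : Tensor2 n := fun y a b =>
  (1 / ((n : ℝ) - 2)) * (ricci s g y a b - scalarCurv s g y / (2 * ((n : ℝ) - 1)) * g y a b)

/-- The trace `J` of the Schouten tensor. -/
def schoutenTrace (y : Coord n) : ℝ := trace2 g (schouten s g) y

/-- The Weyl tensor:
`C_{abcd} = R_{abcd} - (g_{ca} P_{bd} - g_{cb} P_{ad} + g_{db} P_{ac} - g_{da} P_{bc})`. -/
def weyl : Tensor4 n := fun y a b c d =>
  riemann s g y a b c d
    - (g y c a * schouten s g y b d - g y c b * schouten s g y a d
      + g y d b * schouten s g y a c - g y d a * schouten s g y b c)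

/-- The Cotton tensor `A_{abc} = ∇_b P_{ca} - ∇_c P_{ba}`. -/
def cotton : Tensor3 n := fun y a b c =>
  cov2 s g (schouten s g) y b c a - cov2 s g (schouten s g) y c b a

/-- The Einstein field equations `R_{ab} - (1/2) R g_{ab} + Λ g_{ab} = T_{ab}` at a point. -/
def EinsteinEquationAt (Λ : ℝ) (T : Tensor2 n) (y : Coord n) : Prop :=
  ∀ a b, ricci s g y a b - (1 / 2) * scalarCurv s g y * g y a b + Λ * g y a b = T y a b

end Calculus

/-! ## The conformal boundary in a boundary chart -/

/-- The components, in one boundary chart of the conformal extension, of the unphysical metric `g`,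
of the defining function `Ω` and of the unphysical stress-energy tensor `T`, together with the
cosmological constant. The boundary is `x⁰ = 0`. -/
structure LocalData where
  /-- cosmological constant -/
  Λ : ℝ
  /-- unphysical metric -/
  g : Tensor2 4
  /-- defining function -/
  Ω : Coord 4 → ℝ
  /-- unphysical stress-energy tensor -/
  T : Tensor2 4

/-- The half-space `x⁰ ≥ 0`, within which derivatives in a boundary chart are taken. -/
abbrev halfSpace : Set (Coord 4) := range (𝓡∂ 4)

/-- The inclusion `(x¹, x², x³) ↦ (0, x¹, x², x³)` of the boundary. -/
def incl (z : Coord 3) : Coord 4 := WithLp.toLp 2 (Fin.cons 0 fun i => z i)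

/-- Pull-back of a covector field to the boundary. This is the orthogonal projection `⊤`, the
cotangent space of the boundary being the annihilator of the normal. -/
def pull1 (t : Tensor1 4) : Tensor1 3 := fun z i => t (incl z) i.succ

/-- Pull-back of a 2-tensor field to the boundary. -/
def pull2 (t : Tensor2 4) : Tensor2 3 := fun z i j => t (incl z) i.succ j.succ

/-- Pull-back of a 3-tensor field to the boundary. -/
def pull3 (t : Tensor3 4) : Tensor3 3 := fun z i j k => t (incl z) i.succ j.succ k.succ

namespace LocalData

variable (L : LocalData)

/-- `λ = Λ / 3`. -/
def lam : ℝ := L.Λ / 3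

/-- The normal covector field `n_a = λ^{-1/2} ∇_a Ω`. -/
def normal : Tensor1 4 := fun y a => (√L.lam)⁻¹ * pderiv halfSpace L.Ω y a

/-- The normal vector field `n^a`. -/
def normalUp (y : Coord 4) (a : Fin 4) : ℝ := ∑ b, invMetric L.g y a b * L.normal y b

/-- `n_a n^a`. -/
def normalSq (y : Coord 4) : ℝ := ∑ a, L.normal y a * L.normalUp y a

/-- `∇_a ∇_b Ω`. -/
def hessΩ : Tensor2 4 := cov1 halfSpace L.g (pderiv halfSpace L.Ω)

/-- `P_{ab}` -/
def P : Tensor2 4 := schouten halfSpace L.g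

/-- `J` -/
def J (y : Coord 4) : ℝ := schoutenTrace halfSpace L.g y

/-- `ρ = -(1/4) (Δ Ω + J Ω)`. -/
def rho (y : Coord 4) : ℝ := -(1 / 4) * (trace2 L.g L.hessΩ y + L.J y * L.Ω y)

/-- `E_{ab} = ∇_a ∇_b Ω + Ω P_{ab} - (1/4) g_{ab} (Δ Ω + J Ω)`, of conformal weight `1`. -/
def E : Tensor2 4 := fun y a b => L.hessΩ y a b + L.Ω y * L.P y a b
  - (1 / 4) * L.g y a b * (trace2 L.g L.hessΩ y + L.J y * L.Ω y)

/-- The trace `T = g^{cd} T_{cd}`. -/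
def trT (y : Coord 4) : ℝ := trace2 L.g L.T y

/-- `n^b T_{ab}`. -/
def Tn : Tensor1 4 := fun y a => ∑ b, L.T y a b * L.normalUp y b

/-- `n^a n^b T_{ab}`. -/
def Tnn (y : Coord 4) : ℝ := ∑ a, L.Tn y a * L.normalUp y a

/-- The projection of `n^b T_{ab}` orthogonally to `n`, also away from the boundary. -/
def TnProj : Tensor1 4 := fun y a => L.Tn y a - L.normal y a * L.Tnn y / L.normalSq y

/-- `(q - 2) n^b T_{ab} + n_a T`. -/
def constraint (q : ℕ) : Tensor1 4 := fun y a =>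
  ((q : ℝ) - 2) * L.Tn y a + L.normal y a * L.trT y

/-- `∇_n t_a`. -/
def normalCov1 (t : Tensor1 4) : Tensor1 4 := fun y a =>
  ∑ c, L.normalUp y c * cov1 halfSpace L.g t y c a

/-- `∇_n t_{ab}`. -/
def normalCov2 (t : Tensor2 4) : Tensor2 4 := fun y a b =>
  ∑ c, L.normalUp y c * cov2 halfSpace L.g t y c a b

/-- The canonical degenerate Laplacian on trace-free symmetric tensors `t_{ab}` of conformal weight
`w`, in the scale `g`:
`2 (w-1) λ^{1/2} ( ∇_n t_{ab} + (w-2) λ^{-1/2} ρ t_{ab}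
    - 2 (w-2) / ((w-3)(w+2)) n_{(a} ∇^c t_{b)_0 c}
    + 2 / (w-3) (n^c ∇_{(a} t_{b)_0 c} + t_{(a}{}^c ∇_{b)_0} n_c) )
  - Ω ( Δ t_{ab} + (w-2) J t_{ab} + 8 / ((w-3)(w+2)) ∇_{(a} ∇^c t_{b)_0 c}
    - 4 P_{(a}{}^c t_{b)_0 c} )`. -/
def degLaplacian (w : ℝ) (t : Tensor2 4) : Tensor2 4 := fun y a b =>
  2 * (w - 1) * √L.lam *
      (L.normalCov2 t y a b + (w - 2) * (L.rho y / √L.lam) * t y a b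
        - 2 * (w - 2) / ((w - 3) * (w + 2)) *
            symTraceFree L.g (fun x i j => L.normal x i * div2 halfSpace L.g t x j) y a b
        + 2 / (w - 3) *
          (symTraceFree L.g
              (fun x i j => ∑ c, L.normalUp x c * cov2 halfSpace L.g t x i j c) y a b
            + symTraceFree L.g
              (fun x i j => ∑ c, ∑ d, invMetric L.g x c d * t x i c *
                cov1 halfSpace L.g L.normal x j d) y a b))
    - L.Ω y *
      (laplacian2 halfSpace L.g t y a b + (w - 2) * L.J y * t y a b
        + 8 / ((w - 3) * (w + 2)) *
            symTraceFree L.g (cov1 halfSpace L.g (div2 halfSpace L.g t)) y a b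
        - 4 * symTraceFree L.g
            (fun x i j => ∑ c, ∑ d, invMetric L.g x c d * L.P x i c * t x j d) y a b)

/-- `ID^k E_{ab}`, of conformal weight `1 - k`. -/
def degLaplacianPowE : ℕ → Tensor2 4
  | 0 => L.E
  | k + 1 => L.degLaplacian (1 - (k : ℝ)) (degLaplacianPowE k)

/-! ### Objects on the boundary -/

/-- The induced metric of the boundary. -/
def bg : Tensor2 3 := pull2 L.g

/-- The second fundamental form `K_{ab} = (∇_a n_b)^⊤` of the boundary. -/
def K : Tensor2 3 := pull2 (cov1 halfSpace L.g L.normal)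

/-- The mean curvature `H`, the trace of the second fundamental form. -/
def H (z : Coord 3) : ℝ := trace2 L.bg L.K z

/-- The trace-free (symmetrized) projection of a 2-tensor field to the boundary. -/
def tfProj (t : Tensor2 4) : Tensor2 3 := symTraceFree L.bg (pull2 t)

/-- The conformal Robin operator on trace-free symmetric tensors `t_{ab}` of conformal weight `w`:
the trace-free projection of `∇_n t_{ab} - (w-2)/3 H t_{ab} + 2/(w-3) ∇̄_{(a} t^⊤_{b)n}`. -/
def robin (w : ℝ) (t : Tensor2 4) : Tensor2 3 :=
  symTraceFree L.bg fun z i j =>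
    pull2 (L.normalCov2 t) z i j - (w - 2) / 3 * L.H z * pull2 t z i j
      + 2 / (w - 3) *
        cov1 univ L.bg (pull1 fun y a => ∑ c, t y a c * L.normalUp y c) z i j

/-- `C^⊤_{nabc}`. -/
def weylMagnetic : Tensor3 3 :=
  pull3 fun y a b c => ∑ d, L.normalUp y d * weyl halfSpace L.g y d a b c

/-- `C_{nanb}`. -/
def weylElectric : Tensor2 3 :=
  pull2 fun y a b => ∑ c, ∑ d, L.normalUp y c * L.normalUp y d * weyl halfSpace L.g y c a d b

/-- `A^⊤_{anb}`. -/
def cottonNormal : Tensor2 3 :=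
  pull2 fun y a b => ∑ c, L.normalUp y c * cotton halfSpace L.g y a c b

/-- The fourth conformal fundamental form
`λ (∇̄^c C^⊤_{n(ab)c} - A^⊤_{(a|n|b)} - (1/3) H C_{nanb})`. -/
def fourthForm : Tensor2 3 := fun z i j =>
  L.lam *
    ((∑ k, ∑ l, invMetric L.bg z k l *
        ((1 / 2) * (cov3 univ L.bg L.weylMagnetic z l i j k
          + cov3 univ L.bg L.weylMagnetic z l j i k)))
      - (1 / 2) * (L.cottonNormal z i j + L.cottonNormal z j i)
      - (1 / 3) * L.H z * L.weylElectric z i j)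

/-- The `d`-th conformal fundamental form of the boundary, for `2 ≤ d ≤ 5`: the trace-free second
fundamental form for `d = 2`, the form `fourthForm` for `d = 4`, and `δ_R ∘ ID^{d-3} E_{ab}`
otherwise, where `ID^{d-3} E_{ab}` has conformal weight `4 - d`. -/
def fundForm (d : ℕ) : Tensor2 3 :=
  if d = 2 then symTraceFree L.bg L.K
  else if d = 4 then L.fourthForm
  else L.robin (4 - (d : ℝ)) (L.degLaplacianPowE (d - 3))

/-- `j_a` is smooth near the boundary point `incl z`, and
`(n^b T_{ab})^⊤ = Ω j_a + O(Ω²)` there. -/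
def IsCurrentAt (z : Coord 3) (j : Tensor1 4) : Prop :=
  (∀ a, ContDiffWithinAt ℝ ∞ (fun y => j y a) halfSpace (incl z)) ∧
  ∀ a, (fun y => L.TnProj y a - L.Ω y * j y a) =O[𝓝[halfSpace] (incl z)] fun y => L.Ω y ^ 2

end LocalData

/-! ## Asymptotically de Sitter spacetimes -/

/-- A bilinear form is Lorentzian (of signature `-+++` in dimension four). -/
def IsLorentzian {V : Type*} [AddCommGroup V] [Module ℝ V] (B : LinearMap.BilinForm ℝ V) : Prop :=
  (∀ v w, B v w = B w v) ∧
  ∃ v, B v v < 0 ∧ ∀ w, B v w = 0 → w ≠ 0 → 0 < B w w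

section Manifold

variable {M : Type*} [TopologicalSpace M] [ChartedSpace (EuclideanHalfSpace 4) M]

variable (M) in
/-- A covariant 2-tensor field on a manifold with boundary of dimension four. -/
abbrev TensorField := ∀ p : M, LinearMap.BilinForm ℝ (TangentSpace (𝓡∂ 4) p)

/-- The coordinate vector field `∂_i` of a chart, at the point with coordinates `y`. -/
def coordVec (e : OpenPartialHomeomorph M (EuclideanHalfSpace 4)) (y : Coord 4) (i : Fin 4) :
    TangentSpace (𝓡∂ 4) ((e.extend (𝓡∂ 4)).symm y) :=
  mfderivWithin 𝓘(ℝ, Coord 4) (𝓡∂ 4) (e.extend (𝓡∂ 4)).symm halfSpace y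
    (EuclideanSpace.single i 1)

/-- The components of a tensor field in a chart. -/
def components (e : OpenPartialHomeomorph M (EuclideanHalfSpace 4)) (t : TensorField M) :
    Tensor2 4 := fun y i j =>
  t ((e.extend (𝓡∂ 4)).symm y) (coordVec e y i) (coordVec e y j)

/-- A tensor field is smooth up to the boundary: its components in each chart of the atlas are. -/
def IsSmoothTensor (t : TensorField M) : Prop :=
  ∀ e ∈ atlas (EuclideanHalfSpace 4) M, ∀ i j,
    ContDiffOn ℝ ∞ (fun y => components e t y i j) (e.extend (𝓡∂ 4)).target

variable (M) in
/-- A four-dimensional asymptotically de Sitter spacetime with cosmological constant `Λ`, whose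
stress-energy tensor has decay rate `q`, with its conformal extension `M`. The spacetime is
identified with the complement in `M` of the conformal boundary `Σ = ∂M`, so that the values of the
physical fields on the boundary are irrelevant. -/
structure AsymptoticallyDeSitter (Λ : ℝ) (q : ℕ) where
  /-- The physical metric. -/
  physMetric : TensorField M
  /-- The physical stress-energy tensor. -/
  physStress : TensorField M
  /-- The unphysical metric. -/
  metric : TensorField M
  /-- The unphysical stress-energy tensor. -/
  stress : TensorField M
  /-- The defining function of the boundary. -/
  Ω : M → ℝ
  metric_lorentzian : ∀ p, IsLorentzian (metric p)
  metric_smooth : IsSmoothTensor metric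
  stress_symm : ∀ p v w, stress p v w = stress p w v
  stress_smooth : IsSmoothTensor stress
  Ω_smooth : ContMDiff (𝓡∂ 4) 𝓘(ℝ, ℝ) ∞ Ω
  Ω_nonneg : ∀ p, 0 ≤ Ω p
  Ω_eq_zero_iff : ∀ p, Ω p = 0 ↔ p ∈ (𝓡∂ 4).boundary M
  mfderiv_Ω_ne_zero : ∀ p ∈ (𝓡∂ 4).boundary M, mfderiv (𝓡∂ 4) 𝓘(ℝ, ℝ) Ω p ≠ 0
  physMetric_eq : ∀ p, p ∉ (𝓡∂ 4).boundary M → physMetric p = (Ω p ^ 2)⁻¹ • metric p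
  physStress_eq : ∀ p, p ∉ (𝓡∂ 4).boundary M → physStress p = Ω p ^ q • stress p
  einstein : ∀ e ∈ atlas (EuclideanHalfSpace 4) M, ∀ y ∈ (e.extend (𝓡∂ 4)).target,
    (e.extend (𝓡∂ 4)).symm y ∉ (𝓡∂ 4).boundary M →
      EinsteinEquationAt halfSpace (components e physMetric) Λ (components e physStress) y

/-- The components of the unphysical fields in a chart. -/
def AsymptoticallyDeSitter.inChart {Λ : ℝ} {q : ℕ} (S : AsymptoticallyDeSitter M Λ q)
    (e : OpenPartialHomeomorph M (EuclideanHalfSpace 4)) : LocalData where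
  Λ := Λ
  g := components e S.metric
  Ω := fun y => S.Ω ((e.extend (𝓡∂ 4)).symm y)
  T := components e S.stress

end Manifold

/-- The constant `C(q, Λ)` relating the `(q+3)`-rd conformal fundamental form to the stress-energy
tensor, for `q = 0` and `q = 2`. -/
def fundFormConst (q : ℕ) (Λ : ℝ) : ℝ :=
  if q = 0 then -(1 / 2) * √(Λ / 3) else -18 * (Λ / 3) ^ (5 / 2 : ℝ)

end ConformalInfinity

end

open ConformalInfinity

noncomputable section

/-! ### Levi-Civita calculus over a ring with commuting derivations -/

namespace ConformalInfinity

/-! Where Ω > 0, the Einstein equations for Ω⁻²g with source Ω^q T become two equations for Ω on the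
unphysical side: E = Ω^{q+1} σ, where σ is half the trace-free part of T, and 12(|dΩ|² + λ + 2Ωρ) =
Ω^{q+2} tr T (`MetricRing.hess_and_norm_of_einstein`). Their terms are smooth up to Σ, so they hold
there too, by density of the interior (`LocalSpacetime.conformalEinstein`). Everything local follows
from them by differentiating, commuting derivatives and cancelling powers of Ω. This is done in the
ring of smooth functions of a chart: tensor identities become ring identities there, Ω is not a zero
divisor, and evaluation at a point of Σ is an algebra homomorphism killing Ω.

On Σ the equations say |dΩ|² = -λ and ∇∇Ω = -ρ g. Hence Σ is umbilic with H = -3ρ/√λ, and the second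
equation gives the expansion of n_a n^a. Computing div E once from its definition and once from E =
Ω^{q+1} σ gives the conservation law (q-2) T(∇Ω) + (tr T) dΩ = -Ω div T
(`ConformalEinstein.constraint`). Its value and its normal derivative on Σ are the constraints.

For the third and fifth forms, E vanishes to order q+1. The degenerate Laplacian lowers the order of
vanishing by one and multiplies the tangential trace-free part of the leading coefficient by a
number (`degLap_hasLeading`). On a tensor Ω s, the Robin operator gives -√λ times the trace-free
projection of s. For q = 2 the two Laplacians contribute 6λ each, so the constant is -√λ · 36λ²/2.

For the fourth form, commuting derivatives of dΩ expresses C(·,·,∇Ω,·) through ∇E and Ω times the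
Cotton tensor A (`weyl_cotton`). For q ≥ 1 this is Ω times a smooth tensor (`three_V`), so the Weyl
terms drop out on Σ and the form reduces to -√λ B, where B_ab = A_acb ∇^cΩ. On Σ, B is symmetric and
tangential, and its ambient divergence vanishes (`ev_B_symm`, `ev_div_B`). Its intrinsic divergence
is therefore λ⁻¹ times ∇B contracted with ∇Ω in the derivative slot and the first slot, which the
matter determines (`ev_normal_cov_B_of_one`, `ev_normal_cov_B_of_two`). For q = 1 the divergence of
`three_V` also forces T to be a multiple of dΩ ⊗ dΩ on Σ (`ev_T_of_one`).

Non-uniqueness is shown by the metrics -F⁻¹du² + F dx² + dy² + dz² with F = λ + μu³ and Ω = u, which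
are conformal to vacuum solutions. The parameter μ enters the metric at order Ω³ only, but the
fourth form has the component √λ λ² μ. -/

/-- A commutative ring with four commuting derivations and a metric with its Levi-Civita
connection. The main instance is the ring of smooth functions on a coordinate domain. -/
structure MetricRing (A : Type*) [CommRing A] [Algebra ℝ A] where
  /-- partial derivatives -/
  D : Fin 4 → Derivation ℝ A A
  D_comm : ∀ i j f, D i (D j f) = D j (D i f)
  /-- metric -/
  g : Fin 4 → Fin 4 → A
  /-- inverse metric -/
  G : Fin 4 → Fin 4 → A
  /-- Christoffel symbols -/
  Γ : Fin 4 → Fin 4 → Fin 4 → A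
  g_symm : ∀ a b, g a b = g b a
  G_symm : ∀ a b, G a b = G b a
  G_g : ∀ a b, ∑ c, G a c * g c b = if a = b then 1 else 0
  Γ_symm : ∀ c a b, Γ c a b = Γ c b a
  compat : ∀ c a b, D c (g a b) = ∑ d, Γ d c a * g d b + ∑ d, Γ d c b * g a d

namespace MetricRing

variable {A : Type*} [CommRing A] [Algebra ℝ A] (m : MetricRing A)

/-- `∇_c t_a` -/
def cov1 (t : Fin 4 → A) (c a : Fin 4) : A := m.D c (t a) - ∑ d, m.Γ d c a * t d

/-- `∇_c t_{ab}` -/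
def cov2 (t : Fin 4 → Fin 4 → A) (c a b : Fin 4) : A :=
  m.D c (t a b) - ∑ d, m.Γ d c a * t d b - ∑ d, m.Γ d c b * t a d

/-- `∇_e t_{abc}` -/
def cov3 (t : Fin 4 → Fin 4 → Fin 4 → A) (e a b c : Fin 4) : A :=
  m.D e (t a b c) - ∑ d, m.Γ d e a * t d b c - ∑ d, m.Γ d e b * t a d c
    - ∑ d, m.Γ d e c * t a b d

/-- `∇_c v^a` -/
def covV (v : Fin 4 → A) (c a : Fin 4) : A := m.D c (v a) + ∑ d, m.Γ a c d * v d

/-- `g^{ab} t_{ab}` -/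
def tr (t : Fin 4 → Fin 4 → A) : A := ∑ a, ∑ b, m.G a b * t a b

/-- `g^{ab} t_b` -/
def up (t : Fin 4 → A) (a : Fin 4) : A := ∑ b, m.G a b * t b

/-- `∇^c t_{ac}` -/
def div2 (t : Fin 4 → Fin 4 → A) (a : Fin 4) : A :=
  ∑ b, ∑ c, m.G b c * m.cov2 t b a c

/-- `R_{ab}{}^c{}_d` -/
def riemUp (a b c d : Fin 4) : A :=
  m.D a (m.Γ c b d) - m.D b (m.Γ c a d)
    + ∑ e, (m.Γ c a e * m.Γ e b d - m.Γ c b e * m.Γ e a d)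

/-- `R_{abcd}` -/
def riem (a b c d : Fin 4) : A := ∑ e, m.g c e * m.riemUp a b e d

/-- `R_{bd} = R_{ab}{}^a{}_d` -/
def ric (b d : Fin 4) : A := ∑ a, m.riemUp a b a d

/-- scalar curvature -/
def scal : A := m.tr m.ric

lemma g_G (a b : Fin 4) : ∑ c, m.g a c * m.G c b = if a = b then 1 else 0 := by
  simpa only [m.g_symm a, m.G_symm _ b, mul_comm, eq_comm] using m.G_g b a

/-- Differentiate G g = 1 and insert metric compatibility. In matrix form the index manipulation
becomes a noncommutative ring identity. -/
lemma D_G (c a b : Fin 4) : m.D c (m.G a b)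
    = - ∑ d, m.Γ a c d * m.G d b - ∑ d, m.Γ b c d * m.G a d := by
  let N : Matrix (Fin 4) (Fin 4) A := Matrix.of m.G
  let M : Matrix (Fin 4) (Fin 4) A := Matrix.of m.g
  let K : Matrix (Fin 4) (Fin 4) A := Matrix.of fun i j => m.Γ i c j
  have h1 : N * M = 1 := by
    ext i j; simp [N, M, Matrix.mul_apply, m.G_g, Matrix.one_apply]
  have h2 : M * N = 1 := by
    ext i j; simp [N, M, Matrix.mul_apply, m.g_G, Matrix.one_apply]
  have hM : M.map (m.D c) = K.transpose * M + M * K := by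
    ext i j
    simp only [M, K, Matrix.map_apply, Matrix.of_apply, m.compat, Matrix.add_apply,
      Matrix.mul_apply, Matrix.transpose_apply]
    congr 1; simp only [mul_comm]
  have hD : N.map (m.D c) * M + N * M.map (m.D c) = 0 := by
    ext i j
    have := congrArg (m.D c) (m.G_g i j)
    rw [map_sum] at this
    simp only [Derivation.leibniz, smul_eq_mul, Finset.sum_add_distrib] at this
    simp only [Matrix.add_apply, Matrix.mul_apply, Matrix.map_apply, N, M, Matrix.of_apply,
      Matrix.zero_apply]
    rw [add_comm]
    have h0 : m.D c (if i = j then 1 else 0) = 0 := by split_ifs <;> simp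
    rw [h0] at this
    simpa only [mul_comm] using this
  have h3 : N.map (m.D c) = - (N * K.transpose) - K * N := by
    have : N.map (m.D c) = (N.map (m.D c) * M) * N := by rw [mul_assoc, h2, mul_one]
    rw [this, eq_neg_of_add_eq_zero_left hD, hM]
    calc -(N * (K.transpose * M + M * K)) * N
        = - (N * K.transpose * (M * N)) - (N * M) * K * N := by noncomm_ring
      _ = _ := by rw [h1, h2]; noncomm_ring
  have := congrFun (congrFun h3 a) b
  simp only [Matrix.map_apply, N, K, Matrix.of_apply, Matrix.sub_apply, Matrix.neg_apply,
    Matrix.mul_apply, Matrix.transpose_apply] at this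
  rw [this]
  simp only [mul_comm (m.Γ b c _)]
  ring

/-- By `D_G`, contraction with the inverse metric commutes with ∇. -/
lemma D_trace (t : Fin 4 → Fin 4 → A) (c : Fin 4) : m.D c (m.tr t) = m.tr (m.cov2 t c) := by
  simp only [tr, cov2, map_add, Derivation.leibniz, smul_eq_mul, D_G, Fin.sum_univ_four]
  ring

lemma cov_trace3 (t : Fin 4 → Fin 4 → Fin 4 → A) (b c : Fin 4) :
    m.cov1 (fun c => ∑ e, ∑ a, m.G e a * t e c a) b c
      = ∑ e, ∑ a, m.G e a * m.cov3 t b e c a := by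
  simp only [cov1, cov3, map_add, Derivation.leibniz, smul_eq_mul, D_G, Fin.sum_univ_four]
  ring

lemma covV_up (w : Fin 4 → A) (c a : Fin 4) :
    m.covV (m.up w) c a = ∑ b, m.G a b * m.cov1 w c b := by
  simp only [covV, up, cov1, map_add, Derivation.leibniz, smul_eq_mul, D_G, Fin.sum_univ_four]
  ring

lemma cov1_contract (t : Fin 4 → Fin 4 → A) (u : Fin 4 → A) (c a : Fin 4) :
    m.cov1 (fun a => ∑ b, t a b * u b) c a
      = ∑ b, (m.cov2 t c a b * u b + t a b * m.covV u c b) := by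
  simp only [covV, cov2, cov1, map_add, Derivation.leibniz, smul_eq_mul, Fin.sum_univ_four]
  ring

lemma cov2_contract (t : Fin 4 → Fin 4 → Fin 4 → A) (u : Fin 4 → A) (e a b : Fin 4) :
    m.cov2 (fun a b => ∑ c, t a c b * u c) e a b
      = ∑ c, (m.cov3 t e a c b * u c + t a c b * m.covV u e c) := by
  simp only [covV, cov2, cov3, map_add, Derivation.leibniz, smul_eq_mul, Fin.sum_univ_four]
  ring

lemma D_contract (t : Fin 4 → A) (u : Fin 4 → A) (c : Fin 4) :
    m.D c (∑ b, t b * u b) = ∑ b, (m.cov1 t c b * u b + t b * m.covV u c b) := by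
  simp only [covV, cov1, map_add, Derivation.leibniz, smul_eq_mul, Fin.sum_univ_four]
  ring

lemma cov2_symm {t : Fin 4 → Fin 4 → A} (ht : ∀ a b, t a b = t b a) (c a b : Fin 4) :
    m.cov2 t c a b = m.cov2 t c b a := by
  simp only [cov2, ht b a]
  simp only [ht b, ht _ a]
  ring

/-! ### Curvature -/

lemma riemUp_antisymm (a b c d : Fin 4) : m.riemUp a b c d = - m.riemUp b a c d := by
  simp only [riemUp, Fin.sum_univ_four]; ring

lemma riemUp_cyclic (a b c d : Fin 4) :
    m.riemUp a b c d + m.riemUp b d c a + m.riemUp d a c b = 0 := by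
  simp only [riemUp, Fin.sum_univ_four, m.Γ_symm _ d a, m.Γ_symm _ d b, m.Γ_symm _ b a]
  ring

lemma riem_antisymm (a b c d : Fin 4) : m.riem a b c d = - m.riem b a c d := by
  simp only [riem, m.riemUp_antisymm a b, mul_neg, Finset.sum_neg_distrib]

lemma riem_cyclic (a b c d : Fin 4) :
    m.riem a b c d + m.riem b d c a + m.riem d a c b = 0 := by
  simp only [riem, ← Finset.sum_add_distrib, ← mul_add, riemUp_cyclic, mul_zero,
    Finset.sum_const_zero]

/-- This is the Ricci identity for g itself: second derivatives of g_cd commute and ∇g = 0. -/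
lemma riem_antisymm' (a b c d : Fin 4) : m.riem a b c d = - m.riem a b d c := by
  have h := m.D_comm a b (m.g c d)
  simp only [compat, map_add, Derivation.leibniz, smul_eq_mul, Fin.sum_univ_four] at h
  simp only [riem, riemUp, Fin.sum_univ_four, m.g_symm d]
  linear_combination h

/-- A signed sum of cyclic identities yields twice the symmetry. The hypothesis `h2` stands for
division by 2, which the real algebra structure supplies in `riem_symm_pair`. -/
lemma riem_pair (a b c d : Fin 4) (h2 : ∀ x y : A, 2 * x = 2 * y → x = y) :
    m.riem a b c d = m.riem c d a b := by
  apply h2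
  linear_combination m.riem_cyclic a b c d - m.riem_cyclic a b d c + m.riem_cyclic a c b d
    - m.riem_cyclic b c a d - m.riem_antisymm' b d c a - m.riem_antisymm d a c b
    + m.riem_antisymm' a d c b + m.riem_antisymm' a b d c + m.riem_antisymm' b c d a
    + m.riem_antisymm c a d b - m.riem_antisymm' a c d b - m.riem_antisymm' c d b a
    - m.riem_antisymm d a b c + m.riem_antisymm d b a c

end MetricRing
end ConformalInfinity

/-! ### Bianchi and Ricci identities -/

namespace ConformalInfinity

/-- Ring identities in `A` are proved with integer denominators cleared; this lemma removes the
integer factor afterwards. -/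
lemma natCast_mul_cancel {A : Type*} [CommRing A] [Algebra ℝ A] (k : ℕ) [NeZero k] {x y : A}
    (h : (k : A) * x = k * y) : x = y := by
  have hk : algebraMap ℝ A ((k : ℝ)⁻¹) * (k : A) = 1 := by
    rw [← map_natCast (algebraMap ℝ A) k, ← map_mul, inv_mul_cancel₀ (NeZero.ne _), map_one]
  calc x = algebraMap ℝ A ((k : ℝ)⁻¹) * (k : A) * x := by rw [hk, one_mul]
    _ = algebraMap ℝ A ((k : ℝ)⁻¹) * (k * y) := by rw [mul_assoc, h]
    _ = y := by rw [← mul_assoc, hk, one_mul]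

namespace MetricRing

variable {A : Type*} [CommRing A] [Algebra ℝ A] (m : MetricRing A)

lemma riem_symm_pair (a b c d : Fin 4) : m.riem a b c d = m.riem c d a b :=
  m.riem_pair a b c d fun x y h => natCast_mul_cancel 2 (by exact_mod_cast h)

lemma sum_g_up (t : Fin 4 → A) (a : Fin 4) : ∑ b, m.g a b * m.up t b = t a := by
  simp only [up, Finset.mul_sum]
  rw [Finset.sum_comm]
  simp only [← mul_assoc, ← Finset.sum_mul, m.g_G, ite_mul, one_mul, zero_mul,
    Finset.sum_ite_eq, Finset.mem_univ, if_true]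

lemma sum_G_low (t : Fin 4 → A) (a : Fin 4) : ∑ b, m.G a b * ∑ c, m.g b c * t c = t a := by
  simp only [Finset.mul_sum]
  rw [Finset.sum_comm]
  simp only [← mul_assoc, ← Finset.sum_mul, m.G_g, ite_mul, one_mul, zero_mul,
    Finset.sum_ite_eq, Finset.mem_univ, if_true]

lemma tr_g : m.tr m.g = 4 := by
  simp only [tr]
  have : ∀ a, ∑ b, m.G a b * m.g a b = 1 := fun a => by
    simp only [m.g_symm a, m.G_g]; simp
  simp [this]

lemma riemUp_eq (a b c d : Fin 4) : m.riemUp a b c d = ∑ e, m.G c e * m.riem a b e d := by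
  simp only [riem]
  exact (m.sum_G_low (fun e => m.riemUp a b e d) c).symm

lemma ric_eq (b d : Fin 4) : m.ric b d = ∑ a, ∑ c, m.G a c * m.riem a b c d := by
  simp only [ric, riemUp_eq]

lemma ric_symm (b d : Fin 4) : m.ric b d = m.ric d b := by
  simp only [ric_eq]
  rw [Finset.sum_comm]
  refine Finset.sum_congr rfl fun a _ => Finset.sum_congr rfl fun c _ => ?_
  rw [m.riem_symm_pair, m.G_symm]

/-- `∇_e R_{ab}{}^c{}_d` -/
def covRiem (e a b c d : Fin 4) : A :=
  m.D e (m.riemUp a b c d) + ∑ f, (m.Γ c e f * m.riemUp a b f d - m.Γ f e a * m.riemUp f b c d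
    - m.Γ f e b * m.riemUp a f c d - m.Γ f e d * m.riemUp a b c f)

lemma bianchi (e a b c d : Fin 4) :
    m.covRiem e a b c d + m.covRiem a b e c d + m.covRiem b e a c d = 0 := by
  -- The connection terms on the two form indices are separated off. As Γ is symmetric, they cancel
  -- in pairs in the cyclic sum, and only `cyc` remains to be proved.
  have aux : ∀ e a b, m.covRiem e a b c d
      = (m.D e (m.riemUp a b c d) + ∑ f, (m.Γ c e f * m.riemUp a b f d
        - m.Γ f e d * m.riemUp a b c f))
        - (∑ f, (m.Γ f e a * m.riemUp f b c d - m.Γ f b e * m.riemUp f a c d)) := by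
    intro e a b
    rw [covRiem, add_sub_assoc, ← Finset.sum_sub_distrib]
    congr 1
    refine Finset.sum_congr rfl fun f _ => ?_
    rw [m.riemUp_antisymm a f, m.Γ_symm f b e]; ring
  have cyc : (m.D e (m.riemUp a b c d) + ∑ f, (m.Γ c e f * m.riemUp a b f d
        - m.Γ f e d * m.riemUp a b c f))
      + (m.D a (m.riemUp b e c d) + ∑ f, (m.Γ c a f * m.riemUp b e f d
        - m.Γ f a d * m.riemUp b e c f))
      + (m.D b (m.riemUp e a c d) + ∑ f, (m.Γ c b f * m.riemUp e a f d
        - m.Γ f b d * m.riemUp e a c f)) = 0 := by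
    simp only [riemUp, Fin.sum_univ_four, map_add, map_sub, Derivation.leibniz, smul_eq_mul,
      m.D_comm a e, m.D_comm b e, m.D_comm b a]
    ring
  rw [aux, aux, aux]
  simp only [Finset.sum_sub_distrib] at cyc ⊢
  simp only [m.Γ_symm _ b e, m.Γ_symm _ b a]
  linear_combination cyc

lemma sum_covRiem (e b d : Fin 4) : ∑ a, m.covRiem e a b a d = m.cov2 m.ric e b d := by
  simp only [covRiem, cov2, ric, map_add, Fin.sum_univ_four]
  ring

/-- The trace of `bianchi` over its upper index and one form index. -/
lemma sum_covRiem' (b e d : Fin 4) :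
    ∑ a, m.covRiem a b e a d = m.cov2 m.ric b e d - m.cov2 m.ric e b d := by
  have h := fun a => m.bianchi e a b a d
  have h2 : ∀ a, m.covRiem b e a a d = - m.covRiem b a e a d := by
    intro a
    simp only [covRiem, m.riemUp_antisymm e a, map_neg, Finset.sum_sub_distrib]
    have : ∀ f, m.riemUp e f a d = - m.riemUp f e a d := fun f => m.riemUp_antisymm _ _ _ _
    have h3 : ∀ f, m.riemUp f a a d = - m.riemUp a f a d := fun f => m.riemUp_antisymm _ _ _ _
    simp only [this, h3, mul_neg, Finset.sum_neg_distrib]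
    ring
  have h4 : ∑ a, (m.covRiem e a b a d + m.covRiem a b e a d + m.covRiem b e a a d) = 0 :=
    Finset.sum_eq_zero fun a _ => h a
  simp only [Finset.sum_add_distrib, h2, Finset.sum_neg_distrib, sum_covRiem] at h4
  linear_combination h4

/-- The twice contracted Bianchi identity, obtained by tracing `sum_covRiem'`. -/
lemma D_scal (b : Fin 4) : m.D b m.scal = 2 * m.div2 m.ric b := by
  have hY : ∀ b c, ∑ e, ∑ d, m.G e d * m.riemUp b e c d = ∑ f, m.G c f * m.ric b f := by
    intro b c
    simp only [riemUp_eq, ric_eq, Finset.mul_sum]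
    calc _ = ∑ e, ∑ f, ∑ d, m.G e d * (m.G c f * m.riem b e f d) :=
          Finset.sum_congr rfl fun e _ => Finset.sum_comm
      _ = ∑ f, ∑ e, ∑ d, m.G e d * (m.G c f * m.riem b e f d) := Finset.sum_comm
      _ = _ := by
        refine Finset.sum_congr rfl fun f _ => Finset.sum_congr rfl fun e _ =>
          Finset.sum_congr rfl fun d _ => ?_
        rw [m.riem_antisymm b e, m.riem_antisymm' e b]; ring
  -- The contraction passes through ∇, so that by `hY` a trace of the differentiated curvature is a
  -- derivative of the Ricci tensor.
  have hc : ∀ a c, ∑ e, ∑ d, m.G e d * m.covRiem a b e c d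
      = ∑ f, m.G c f * m.cov2 m.ric a b f := by
    intro a c
    have h1 : ∑ e, ∑ d, m.G e d * m.covRiem a b e c d
        = m.D a (∑ e, ∑ d, m.G e d * m.riemUp b e c d)
          + ∑ f, m.Γ c a f * (∑ e, ∑ d, m.G e d * m.riemUp b e f d)
          - ∑ f, m.Γ f a b * (∑ e, ∑ d, m.G e d * m.riemUp f e c d) := by
      simp only [covRiem, map_add, Derivation.leibniz, smul_eq_mul, D_G, Fin.sum_univ_four]
      ring
    rw [h1]
    simp only [hY]
    simp only [cov2, map_add, Derivation.leibniz, smul_eq_mul, D_G, Fin.sum_univ_four]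
    ring
  have h := fun e d => m.sum_covRiem' b e d
  have h5 : ∑ e, ∑ d, m.G e d * ∑ a, m.covRiem a b e a d
      = ∑ e, ∑ d, m.G e d * (m.cov2 m.ric b e d - m.cov2 m.ric e b d) := by simp only [h]
  have h6 : ∑ e, ∑ d, m.G e d * ∑ a, m.covRiem a b e a d
      = ∑ a, ∑ f, m.G a f * m.cov2 m.ric a b f := by
    simp only [← hc, Finset.mul_sum]
    rw [Finset.sum_comm' (t' := Finset.univ) (s' := fun _ => Finset.univ) (by simp)]
    conv_rhs => rw [Finset.sum_comm]
    conv_lhs => rw [Finset.sum_comm]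
    refine Finset.sum_congr rfl fun e _ => ?_
    rw [Finset.sum_comm]
  rw [h6] at h5
  simp only [mul_sub, Finset.sum_sub_distrib] at h5
  have h7 := m.D_trace m.ric b
  rw [scal, h7, tr, div2]
  linear_combination -h5

lemma cov2_comm (v : Fin 4 → A) (c a b : Fin 4) :
    m.cov2 (m.cov1 v) c a b - m.cov2 (m.cov1 v) a c b = - ∑ d, m.riemUp c a d b * v d := by
  simp only [cov1, cov2, riemUp, map_add, map_sub, Derivation.leibniz, smul_eq_mul,
    Fin.sum_univ_four, m.D_comm c a, m.Γ_symm _ c a]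
  ring

lemma cov3_comm (t : Fin 4 → Fin 4 → A) (e b c a : Fin 4) :
    m.cov3 (m.cov2 t) e b c a - m.cov3 (m.cov2 t) b e c a
      = - ∑ d, m.riemUp e b d c * t d a - ∑ d, m.riemUp e b d a * t c d := by
  simp only [cov3, cov2, riemUp, map_add, map_sub, Derivation.leibniz, smul_eq_mul,
    Fin.sum_univ_four, m.D_comm e b, m.Γ_symm _ e b]
  ring

lemma cov1_D_symm (f : A) (a b : Fin 4) :
    m.cov1 (fun i => m.D i f) a b = m.cov1 (fun i => m.D i f) b a := by
  simp only [cov1, m.D_comm a b, m.Γ_symm _ a b]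

end MetricRing
end ConformalInfinity

/-! ### Schouten, Cotton and Weyl tensors -/

namespace ConformalInfinity
namespace MetricRing

variable {A : Type*} [CommRing A] [Algebra ℝ A] (m : MetricRing A)

/-- the Schouten tensor -/
noncomputable def P (a b : Fin 4) : A := (1 / 2 : ℝ) • (m.ric a b - (1 / 6 : ℝ) • (m.scal * m.g a b))

/-- the trace of the Schouten tensor -/
noncomputable def J : A := m.tr m.P

/-- the Cotton tensor -/
noncomputable def cotton (a b c : Fin 4) : A := m.cov2 m.P b c a - m.cov2 m.P c b a

/-- the Weyl tensor -/
noncomputable def weyl (a b c d : Fin 4) : A :=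
  m.riem a b c d
    - (m.g c a * m.P b d - m.g c b * m.P a d + m.g d b * m.P a c - m.g d a * m.P b c)

lemma P_symm (a b : Fin 4) : m.P a b = m.P b a := by
  rw [P, P, m.ric_symm a b, m.g_symm a b]

lemma twelve_P (a b : Fin 4) : 12 * m.P a b = 6 * m.ric a b - m.scal * m.g a b := by
  have h12 : (12 : A) = algebraMap ℝ A 12 := (map_ofNat (algebraMap ℝ A) 12).symm
  have h6 : (6 : A) = algebraMap ℝ A 6 := (map_ofNat (algebraMap ℝ A) 6).symm
  rw [P, h12, h6, ← Algebra.smul_def, ← Algebra.smul_def, smul_smul, smul_sub, smul_smul]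
  norm_num

lemma tr_sub_mul (t : Fin 4 → Fin 4 → A) (f k : A) :
    m.tr (fun a b => k * t a b - f * m.g a b) = k * m.tr t - 4 * f := by
  have := m.tr_g
  simp only [tr] at this ⊢
  rw [← this]
  simp only [Fin.sum_univ_four]; ring

lemma scal_eq : m.scal = 6 * m.J := by
  apply natCast_mul_cancel 2
  have h : m.tr (fun a b => 12 * m.P a b - 0 * m.g a b) = m.tr (fun a b => 6 * m.ric a b
      - m.scal * m.g a b) := by
    congr 1; ext a b; rw [twelve_P]; ring
  rw [tr_sub_mul, tr_sub_mul] at h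
  rw [J]
  push_cast
  rw [scal] at *
  linear_combination -h

lemma ric_eq_P (a b : Fin 4) : m.ric a b = 2 * m.P a b + m.J * m.g a b := by
  apply natCast_mul_cancel 6
  push_cast
  linear_combination -m.twelve_P a b + m.g a b * m.scal_eq

lemma cov2_g (c a b : Fin 4) : m.cov2 m.g c a b = 0 := by
  rw [cov2, compat]; ring

lemma cov2_mul (f : A) (t : Fin 4 → Fin 4 → A) (c a b : Fin 4) :
    m.cov2 (fun a b => f * t a b) c a b = m.D c f * t a b + f * m.cov2 t c a b := by
  simp only [cov2, Derivation.leibniz, smul_eq_mul, Fin.sum_univ_four]; ring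

lemma cov2_add (s t : Fin 4 → Fin 4 → A) (c a b : Fin 4) :
    m.cov2 (fun a b => s a b + t a b) c a b = m.cov2 s c a b + m.cov2 t c a b := by
  simp only [cov2, map_add, Fin.sum_univ_four]; ring

lemma cov2_sub (s t : Fin 4 → Fin 4 → A) (c a b : Fin 4) :
    m.cov2 (fun a b => s a b - t a b) c a b = m.cov2 s c a b - m.cov2 t c a b := by
  simp only [cov2, map_sub, Fin.sum_univ_four]; ring

lemma cov1_mul (f : A) (t : Fin 4 → A) (c a : Fin 4) :
    m.cov1 (fun a => f * t a) c a = m.D c f * t a + f * m.cov1 t c a := by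
  simp only [cov1, Derivation.leibniz, smul_eq_mul, Fin.sum_univ_four]; ring

lemma cov3_mul (f : A) (t : Fin 4 → Fin 4 → Fin 4 → A) (e a b c : Fin 4) :
    m.cov3 (fun a b c => f * t a b c) e a b c = m.D e f * t a b c + f * m.cov3 t e a b c := by
  simp only [cov3, Derivation.leibniz, smul_eq_mul, Fin.sum_univ_four]; ring

lemma sum_G_g_mul (v : Fin 4 → A) (a : Fin 4) :
    ∑ b, ∑ c, m.G b c * (v b * m.g a c) = v a := by
  calc _ = ∑ b, (∑ c, m.g a c * m.G c b) * v b := by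
        refine Finset.sum_congr rfl fun b _ => ?_
        rw [Finset.sum_mul]
        refine Finset.sum_congr rfl fun c _ => ?_
        rw [m.G_symm b c]; ring
    _ = v a := by simp [m.g_G]

lemma div2_mul_g (f : A) (a : Fin 4) : m.div2 (fun a b => f * m.g a b) a = m.D a f := by
  simp only [div2, cov2_mul, cov2_g, mul_zero, add_zero]
  exact m.sum_G_g_mul (fun b => m.D b f) a

lemma div2_add (s t : Fin 4 → Fin 4 → A) (a : Fin 4) :
    m.div2 (fun a b => s a b + t a b) a = m.div2 s a + m.div2 t a := by
  simp only [div2, cov2_add, mul_add, Finset.sum_add_distrib]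

lemma div2_sub (s t : Fin 4 → Fin 4 → A) (a : Fin 4) :
    m.div2 (fun a b => s a b - t a b) a = m.div2 s a - m.div2 t a := by
  simp only [div2, cov2_sub, mul_sub, Finset.sum_sub_distrib]

lemma div2_mul (f : A) (t : Fin 4 → Fin 4 → A) (a : Fin 4) :
    m.div2 (fun a b => f * t a b) a
      = ∑ c, t a c * m.up (fun i => m.D i f) c + f * m.div2 t a := by
  simp only [div2, cov2_mul, up, Fin.sum_univ_four, m.G_symm 1 0, m.G_symm 2 0, m.G_symm 3 0,
    m.G_symm 2 1, m.G_symm 3 1, m.G_symm 3 2]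
  ring

lemma D_natCast (k : ℕ) (i : Fin 4) : m.D i (k : A) = 0 := by simp

/-- Insert Ric = 2P + Jg and scal = 6J into the twice contracted Bianchi identity. -/
lemma div2_P (a : Fin 4) : m.div2 m.P a = m.D a m.J := by
  apply natCast_mul_cancel 4
  have h := m.D_scal a
  have h2 : m.ric = fun a b => (2 : ℕ) * m.P a b + m.J * m.g a b := by
    ext a b; rw [ric_eq_P]; norm_num
  have h3 : m.div2 (fun a b => ((2 : ℕ) : A) * m.P a b) a = 2 * m.div2 m.P a := by
    rw [div2_mul]
    have hd : ∀ i, m.D i (2 : A) = 0 := fun i => by exact_mod_cast m.D_natCast 2 i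
    simp only [hd, up, mul_zero, Finset.sum_const_zero, zero_add, Nat.cast_ofNat]
  rw [h2, div2_add, div2_mul_g, h3, scal_eq, Derivation.leibniz] at h
  have h6 : m.D a (6 : A) = 0 := by exact_mod_cast m.D_natCast 6 a
  rw [h6] at h
  simp only [smul_eq_mul] at h
  push_cast
  linear_combination -h

lemma cotton_antisymm (a b c : Fin 4) : m.cotton a b c = - m.cotton a c b := by
  simp only [cotton]; ring

lemma cotton_cyclic (a b c : Fin 4) :
    m.cotton a b c + m.cotton b c a + m.cotton c a b = 0 := by
  simp only [cotton, m.cov2_symm m.P_symm _ a b, m.cov2_symm m.P_symm _ a c,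
    m.cov2_symm m.P_symm _ c b]
  ring

/-- Both traces of ∇P that occur are equal to dJ: one by metric compatibility, the other by
`div2_P`. -/
lemma cotton_trace (b : Fin 4) : ∑ a, ∑ c, m.G a c * m.cotton a c b = 0 := by
  have h1 : m.D b m.J = ∑ a, ∑ c, m.G a c * m.cov2 m.P b c a := by
    rw [J, D_trace, tr]
    refine Finset.sum_congr rfl fun a _ => Finset.sum_congr rfl fun c _ => ?_
    rw [m.cov2_symm m.P_symm]
  have h2 : m.div2 m.P b = ∑ a, ∑ c, m.G a c * m.cov2 m.P c b a := by
    rw [div2, Finset.sum_comm]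
    refine Finset.sum_congr rfl fun a _ => Finset.sum_congr rfl fun c _ => ?_
    rw [m.G_symm]
  simp only [cotton, mul_sub, Finset.sum_sub_distrib]
  rw [← h1, ← h2, div2_P, sub_self]

lemma sum_G_riemUp (b c : Fin 4) :
    ∑ e, ∑ d, m.G e d * m.riemUp e b c d = - ∑ f, m.G c f * m.ric b f := by
  simp only [riemUp_eq, ric_eq, Finset.mul_sum]
  calc _ = ∑ e, ∑ f, ∑ d, m.G e d * (m.G c f * m.riem e b f d) :=
        Finset.sum_congr rfl fun e _ => Finset.sum_comm
    _ = ∑ f, ∑ e, ∑ d, m.G e d * (m.G c f * m.riem e b f d) := Finset.sum_comm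
    _ = _ := by
      rw [← Finset.sum_neg_distrib]
      refine Finset.sum_congr rfl fun f _ => ?_
      rw [← Finset.sum_neg_distrib]
      refine Finset.sum_congr rfl fun e _ => ?_
      rw [← Finset.sum_neg_distrib]
      refine Finset.sum_congr rfl fun d _ => ?_
      rw [m.riem_antisymm' e b]; ring

/-- Commuting the derivatives in ∇^a∇_b P_ca yields ∇_b∇_c J plus curvature times P. Each term is
symmetric in b and c, so the skew part, which is the divergence of the Cotton tensor, vanishes. -/
lemma div_cotton (b c : Fin 4) : ∑ e, ∑ a, m.G e a * m.cov3 m.cotton e a b c = 0 := by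
  have key : ∀ b c, ∑ e, ∑ a, m.G e a * m.cov3 (m.cov2 m.P) e b c a
      = m.cov1 (fun i => m.D i m.J) b c
        - ∑ e, ∑ a, m.G e a * ∑ d, m.riemUp e b d c * m.P d a
        + ∑ d, (∑ f, m.G d f * m.ric b f) * m.P c d := by
    intro b c
    have h1 := m.cov_trace3 (m.cov2 m.P) b c
    have h2 : (fun c => ∑ e, ∑ a, m.G e a * m.cov2 m.P e c a) = fun i => m.D i m.J := by
      ext c; exact m.div2_P c
    rw [h2] at h1
    have h3 : ∑ e, ∑ a, m.G e a * ∑ d, m.riemUp e b d a * m.P c d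
        = ∑ d, (∑ e, ∑ a, m.G e a * m.riemUp e b d a) * m.P c d := by
      simp only [Fin.sum_univ_four]; ring
    simp only [sum_G_riemUp, neg_mul, Finset.sum_neg_distrib] at h3
    have h5 : ∀ e a, m.G e a * m.cov3 (m.cov2 m.P) e b c a = m.G e a * (m.cov3 (m.cov2 m.P) b e c a
        - ∑ d, m.riemUp e b d c * m.P d a - ∑ d, m.riemUp e b d a * m.P c d) := by
      intro e a; congr 1; linear_combination m.cov3_comm m.P e b c a
    simp only [h5, mul_sub, Finset.sum_sub_distrib]
    rw [h1, h3]
    ring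
  have hs : ∀ b c, ∑ e, ∑ a, m.G e a * ∑ d, m.riemUp e b d c * m.P d a
      = ∑ e, ∑ a, m.G e a * ∑ d, m.riemUp e c d b * m.P d a := by
    intro b c
    simp only [riemUp_eq, Finset.mul_sum, Finset.sum_mul]
    -- `G e a * (G d f * R e b f c * P d a)`: exchange `(e, a)` with `(f, d)`
    calc _ = ∑ e, ∑ a, ∑ d, ∑ f, m.G f d * (m.G a e * m.riem f b e c * m.P a d) := by
          rw [Finset.sum_comm]
          calc _ = ∑ a, ∑ d, ∑ e, ∑ f, m.G e a * (m.G d f * m.riem e b f c * m.P d a) :=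
                Finset.sum_congr rfl fun a _ => Finset.sum_comm
            _ = ∑ d, ∑ a, ∑ e, ∑ f, m.G e a * (m.G d f * m.riem e b f c * m.P d a) :=
                Finset.sum_comm
            _ = ∑ d, ∑ a, ∑ f, ∑ e, m.G e a * (m.G d f * m.riem e b f c * m.P d a) :=
                Finset.sum_congr rfl fun d _ => Finset.sum_congr rfl fun a _ => Finset.sum_comm
            _ = ∑ d, ∑ f, ∑ a, ∑ e, m.G e a * (m.G d f * m.riem e b f c * m.P d a) :=
                Finset.sum_congr rfl fun d _ => Finset.sum_comm
            _ = ∑ f, ∑ d, ∑ a, ∑ e, m.G e a * (m.G d f * m.riem e b f c * m.P d a) :=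
                Finset.sum_comm
      _ = _ := by
        refine Finset.sum_congr rfl fun e _ => Finset.sum_congr rfl fun a _ =>
          Finset.sum_congr rfl fun d _ => Finset.sum_congr rfl fun f _ => ?_
        rw [m.riem_symm_pair f b e c, m.P_symm a d, m.G_symm f d, m.G_symm a e]; ring
  have hr : ∀ b c, ∑ d, (∑ f, m.G d f * m.ric b f) * m.P c d
      = 2 * ∑ d, ∑ f, m.G d f * m.P b f * m.P c d + m.J * m.P b c := by
    intro b c
    have h1 : ∑ d, (∑ f, m.G d f * m.g b f) * m.P c d = m.P b c := by
      have : ∀ d, ∑ f, m.G d f * m.g b f = if d = b then 1 else 0 := by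
        intro d; simp only [m.g_symm b]; exact m.G_g d b
      simp only [this]
      simp [m.P_symm b c]
    rw [← h1]
    simp only [ric_eq_P, mul_add, Finset.sum_add_distrib, add_mul, Finset.mul_sum, Finset.sum_mul]
    congr 1 <;> refine Finset.sum_congr rfl fun d _ => Finset.sum_congr rfl fun f _ => ?_ <;> ring
  have hq : ∀ b c, ∑ d, ∑ f, m.G d f * m.P b f * m.P c d
      = ∑ d, ∑ f, m.G d f * m.P c f * m.P b d := by
    intro b c
    rw [Finset.sum_comm]
    refine Finset.sum_congr rfl fun d _ => Finset.sum_congr rfl fun f _ => ?_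
    rw [m.G_symm]; ring
  have h0 : ∀ e a, m.cov3 m.cotton e a b c
      = m.cov3 (m.cov2 m.P) e b c a - m.cov3 (m.cov2 m.P) e c b a := by
    intro e a
    simp only [cov3, cotton, map_sub, Fin.sum_univ_four]; ring
  simp only [h0, mul_sub, Finset.sum_sub_distrib]
  rw [key b c, key c b, hs b c, hr b c, hr c b, hq b c, m.P_symm b c, m.cov1_D_symm _ b c]
  ring

lemma weyl_antisymm' (a b c d : Fin 4) : m.weyl a b c d = - m.weyl a b d c := by
  simp only [weyl]; rw [m.riem_antisymm']; ring

lemma weyl_symm_pair (a b c d : Fin 4) : m.weyl a b c d = m.weyl c d a b := by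
  simp only [weyl]
  rw [m.riem_symm_pair, m.g_symm c a, m.g_symm c b, m.g_symm d b, m.g_symm d a,
    m.P_symm b d, m.P_symm a d, m.P_symm a c, m.P_symm b c]; ring

end MetricRing
end ConformalInfinity

/-! ### The conformal Einstein equations and the conservation law -/

namespace ConformalInfinity

/-- The Einstein equations for `Ω⁻² g`, written as equations for the Hessian and for the norm of the
gradient of `Ω` which extend to the zero set of `Ω`. -/
structure ConformalEinstein {A : Type*} [CommRing A] [Algebra ℝ A] (m : MetricRing A)
    (lam : ℝ) (q : ℕ) where
  /-- defining function -/
  Ω : A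
  /-- Friedrich scalar -/
  ρ : A
  /-- unphysical stress-energy tensor -/
  T : Fin 4 → Fin 4 → A
  T_symm : ∀ a b, T a b = T b a
  regular : ∀ f, Ω * f = 0 → f = 0
  hess : ∀ a b, 8 * (m.cov1 (fun i => m.D i Ω) a b + Ω * m.P a b + ρ * m.g a b)
    = Ω ^ (q + 1) * (4 * T a b - m.tr T * m.g a b)
  norm : 12 * (∑ a, m.D a Ω * m.up (fun i => m.D i Ω) a + algebraMap ℝ A lam + 2 * Ω * ρ)
    = Ω ^ (q + 2) * m.tr T

namespace ConformalEinstein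

variable {A : Type*} [CommRing A] [Algebra ℝ A] {m : MetricRing A} {lam : ℝ} {q : ℕ}
  (c : ConformalEinstein m lam q)

/-- This replaces dividing by Ω in the interior and extending the result to Σ by continuity. -/
lemma Ω_cancel {x y : A} (h : c.Ω * x = c.Ω * y) : x = y :=
  sub_eq_zero.mp (c.regular _ (by rw [mul_sub, h, sub_self]))

lemma Ω_pow_cancel (k : ℕ) {x y : A} (h : c.Ω ^ k * x = c.Ω ^ k * y) : x = y := by
  induction k with
  | zero => simpa using h
  | succ k ih => exact ih (c.Ω_cancel (by simpa only [pow_succ', mul_assoc] using h))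

/-- gradient of `Ω` -/
def dΩ (a : Fin 4) : A := m.D a c.Ω

/-- gradient of `Ω`, as a vector -/
def uΩ (a : Fin 4) : A := m.up c.dΩ a

/-- Hessian of `Ω` -/
def S (a b : Fin 4) : A := m.cov1 c.dΩ a b

/-- `E_{ab}` -/
noncomputable def E (a b : Fin 4) : A := c.S a b + c.Ω * m.P a b + c.ρ * m.g a b

/-- trace of the stress-energy tensor -/
def t : A := m.tr c.T

/-- half the trace-free part of the stress-energy tensor -/
noncomputable def σ (a b : Fin 4) : A := (1 / 8 : ℝ) • (4 * c.T a b - c.t * m.g a b)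

/-- divergence of the stress-energy tensor -/
def divT (a : Fin 4) : A := m.div2 c.T a

/-- contraction with the gradient of `Ω` -/
def con (t : Fin 4 → Fin 4 → A) (a : Fin 4) : A := ∑ b, t a b * c.uΩ b

lemma eight_σ (a b : Fin 4) : 8 * c.σ a b = 4 * c.T a b - c.t * m.g a b := by
  have h8 : (8 : A) = algebraMap ℝ A 8 := (map_ofNat (algebraMap ℝ A) 8).symm
  rw [σ, h8, ← Algebra.smul_def, smul_smul]
  norm_num

/-- The trace-free part of the Einstein equations: E vanishes on Σ to order q+1, with coefficient σ.
-/
lemma E_eq (a b : Fin 4) : c.E a b = c.Ω ^ (q + 1) * c.σ a b := by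
  apply natCast_mul_cancel 8
  have := c.hess a b
  have h := c.eight_σ a b
  simp only [E, S, t] at *
  push_cast
  unfold dΩ
  linear_combination this - c.Ω ^ (q + 1) * h

lemma S_eq (a b : Fin 4) :
    c.S a b = c.Ω ^ (q + 1) * c.σ a b - c.Ω * m.P a b - c.ρ * m.g a b := by
  rw [← E_eq, E]; ring

lemma σ_symm (a b : Fin 4) : c.σ a b = c.σ b a := by
  rw [σ, σ, c.T_symm, m.g_symm]

lemma norm' : 12 * (∑ a, c.dΩ a * c.uΩ a) = c.Ω ^ (q + 2) * c.t
    - 12 * algebraMap ℝ A lam - 24 * c.Ω * c.ρ := by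
  have : 12 * (∑ a, c.dΩ a * c.uΩ a + algebraMap ℝ A lam + 2 * c.Ω * c.ρ)
    = c.Ω ^ (q + 2) * c.t := c.norm
  linear_combination this

lemma sum_g_uΩ (a : Fin 4) : ∑ b, m.g a b * c.uΩ b = c.dΩ a := m.sum_g_up _ a

lemma con_g (a : Fin 4) : c.con m.g a = c.dΩ a := c.sum_g_uΩ a

lemma eight_con_σ (a : Fin 4) : 8 * c.con c.σ a = 4 * c.con c.T a - c.t * c.dΩ a := by
  rw [← c.con_g a]
  simp only [con, Fin.sum_univ_four]
  linear_combination c.eight_σ a 0 * c.uΩ 0 + c.eight_σ a 1 * c.uΩ 1 + c.eight_σ a 2 * c.uΩ 2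
    + c.eight_σ a 3 * c.uΩ 3

lemma tr_σ : m.tr c.σ = 0 := by
  apply natCast_mul_cancel 8
  have h1 : m.tr (fun a b => 8 * c.σ a b - 0 * m.g a b)
      = m.tr (fun a b => 4 * c.T a b - c.t * m.g a b) := by
    congr 1; ext a b; rw [eight_σ]; ring
  rw [m.tr_sub_mul, m.tr_sub_mul] at h1
  push_cast
  rw [t] at h1
  linear_combination h1

lemma covV_uΩ (a b : Fin 4) : m.covV c.uΩ a b = ∑ d, m.G b d * c.S a d := m.covV_up c.dΩ a b

lemma D_norm (a : Fin 4) : m.D a (∑ b, c.dΩ b * c.uΩ b) = 2 * c.con c.S a := by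
  have h1 : ∑ b, c.dΩ b * m.covV c.uΩ a b = c.con c.S a := by
    simp only [covV_uΩ, con, uΩ, MetricRing.up, Finset.mul_sum]
    rw [Finset.sum_comm]
    refine Finset.sum_congr rfl fun d _ => Finset.sum_congr rfl fun b _ => ?_
    rw [m.G_symm b d]; ring
  rw [m.D_contract, Finset.sum_add_distrib, h1]
  simp only [con, S]; ring

lemma D_lam (a : Fin 4) : m.D a (algebraMap ℝ A lam) = 0 := by simp

lemma con_S (a : Fin 4) : c.con c.S a
    = c.Ω ^ (q + 1) * c.con c.σ a - c.Ω * c.con m.P a - c.ρ * c.dΩ a := by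
  rw [← c.con_g]
  simp only [con, S_eq, Fin.sum_univ_four]; ring

lemma D_pow (k : ℕ) (a : Fin 4) : m.D a (c.Ω ^ (k + 1)) = (k + 1) * c.Ω ^ k * c.dΩ a := by
  rw [Derivation.leibniz_pow]
  simp only [dΩ, Nat.add_sub_cancel, nsmul_eq_mul, smul_eq_mul]
  push_cast; ring

lemma D_ofNat (k : ℕ) [k.AtLeastTwo] (a : Fin 4) : m.D a (ofNat(k) : A) = 0 := by
  exact_mod_cast m.D_natCast k a

/-- Differentiate the norm equation and replace the Hessian by `con_S`. The terms ρ dΩ cancel, and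
one factor Ω can then be divided out. -/
lemma con_P_sub (a : Fin 4) : 24 * (c.con m.P a - m.D a c.ρ)
    = c.Ω ^ q * (24 * c.con c.σ a - (q + 2) * c.dΩ a * c.t - c.Ω * m.D a c.t) := by
  apply c.Ω_cancel
  have h := congrArg (m.D a) c.norm'
  simp only [Derivation.leibniz, map_sub, D_lam, D_norm, smul_eq_mul, D_ofNat, con_S,
    c.D_pow (q + 1)] at h
  push_cast at h
  rw [show m.D a c.Ω = c.dΩ a from rfl] at h
  linear_combination -h

/-- The Ricci identity for dΩ, contracted; the Ricci tensor enters as 2P + Jg. -/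
lemma div2_S (a : Fin 4) :
    m.div2 c.S a = m.D a (m.tr c.S) + 2 * c.con m.P a + m.J * c.dΩ a := by
  have h := fun d b => m.cov2_comm c.dΩ d a b
  have h1 : ∑ d, ∑ b, m.G d b * (m.cov2 c.S d a b - m.cov2 c.S a d b)
      = ∑ d, ∑ b, m.G d b * (- ∑ f, m.riemUp d a f b * c.dΩ f) := by
    simp only [← h]; rfl
  have h2 : ∑ d, ∑ b, m.G d b * (- ∑ f, m.riemUp d a f b * c.dΩ f)
      = - ∑ f, (∑ d, ∑ b, m.G d b * m.riemUp d a f b) * c.dΩ f := by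
    simp only [Fin.sum_univ_four]; ring
  have h3 : ∑ f, (∑ k, m.G f k * m.ric a k) * c.dΩ f = c.con m.ric a := by
    simp only [con, uΩ, MetricRing.up, Finset.mul_sum, Finset.sum_mul]
    rw [Finset.sum_comm]
    refine Finset.sum_congr rfl fun d _ => Finset.sum_congr rfl fun b _ => ?_
    rw [m.G_symm b d]; ring
  have h4 : c.con m.ric a = 2 * c.con m.P a + m.J * c.dΩ a := by
    rw [← c.con_g]; simp only [con, m.ric_eq_P, Fin.sum_univ_four]; ring
  rw [m.D_trace, MetricRing.div2, MetricRing.tr]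
  rw [h2] at h1
  simp only [m.sum_G_riemUp, neg_mul, Finset.sum_neg_distrib, neg_neg, h3, h4, mul_sub,
    Finset.sum_sub_distrib] at h1
  linear_combination h1

lemma tr_S : m.tr c.S = - c.Ω * m.J - 4 * c.ρ := by
  have h : m.tr c.S = c.Ω ^ (q + 1) * m.tr c.σ - c.Ω * m.J - c.ρ * m.tr m.g := by
    simp only [MetricRing.J, MetricRing.tr, S_eq, Fin.sum_univ_four]; ring
  rw [h, tr_σ, m.tr_g]; ring

/-- The first computation of div E, from its definition. All terms with J cancel because div P = dJ.
-/
lemma div2_E (a : Fin 4) : m.div2 c.E a = 3 * (c.con m.P a - m.D a c.ρ) := by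
  have h : m.div2 c.E a = m.div2 c.S a + m.div2 (fun a b => c.Ω * m.P a b) a
      + m.div2 (fun a b => c.ρ * m.g a b) a := by
    rw [← m.div2_add, ← m.div2_add]; rfl
  have h2 : m.div2 (fun a b => c.Ω * m.P a b) a = c.con m.P a + c.Ω * m.div2 m.P a := m.div2_mul _ _ _
  rw [h, div2_S, h2, m.div2_mul_g, m.div2_P, tr_S]
  simp only [map_sub, map_neg, Derivation.leibniz, smul_eq_mul, D_ofNat, neg_mul]
  rw [show m.D a c.Ω = c.dΩ a from rfl]
  ring

/-- The second computation of div E, by the Leibniz rule for Ω^{q+1} σ. -/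
lemma div2_E' (a : Fin 4) : m.div2 c.E a
    = c.Ω ^ q * ((q + 1) * c.con c.σ a + c.Ω * m.div2 c.σ a) := by
  have h : c.E = fun a b => c.Ω ^ (q + 1) * c.σ a b := by ext a b; exact c.E_eq a b
  rw [h, m.div2_mul]
  have h2 : ∀ b, m.up (fun i => m.D i (c.Ω ^ (q + 1))) b = (q + 1) * c.Ω ^ q * c.uΩ b := by
    intro b; simp only [uΩ, MetricRing.up, D_pow, Fin.sum_univ_four]; ring
  simp only [h2, con, Fin.sum_univ_four]; ring

lemma eight_div_σ (a : Fin 4) : 8 * m.div2 c.σ a = 4 * c.divT a - m.D a c.t := by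
  have h : m.div2 (fun a b => 8 * c.σ a b) a = m.div2 (fun a b => 4 * c.T a b - c.t * m.g a b) a := by
    simp only [eight_σ]
  rw [m.div2_sub, m.div2_mul, m.div2_mul, m.div2_mul_g] at h
  simpa only [divT, MetricRing.up, D_ofNat, mul_zero, Finset.sum_const_zero, zero_add] using h

/-- The conservation law for the physical stress-energy tensor. -/
lemma constraint (a : Fin 4) :
    ((q : A) - 2) * c.con c.T a + c.dΩ a * c.t = - c.Ω * c.divT a := by
  apply natCast_mul_cancel 4
  -- Equating the two values of div E, with `con_P_sub` for the first, gives the law multiplied by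
  -- Ω^q.
  apply c.Ω_pow_cancel q
  have h1 := c.div2_E a
  rw [div2_E'] at h1
  have h2 := c.con_P_sub a
  have h3 := c.eight_con_σ a
  have h4 := c.eight_div_σ a
  push_cast
  linear_combination 8 * h1 + h2 - c.Ω ^ q * ((q : A) - 2) * h3 - c.Ω ^ q * c.Ω * h4

end ConformalEinstein
end ConformalInfinity

/-! ### The Weyl tensor contracted with the gradient of Ω -/

namespace ConformalInfinity
namespace ConformalEinstein

variable {A : Type*} [CommRing A] [Algebra ℝ A] {m : MetricRing A} {lam : ℝ}

section
variable {q : ℕ} (c : ConformalEinstein m lam q)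

/-- `C_{cadb} ∇^dΩ` -/
noncomputable def V (e a b : Fin 4) : A := ∑ d, m.weyl e a d b * c.uΩ d

lemma V_eq (e a b : Fin 4) : c.V e a b = ∑ d, m.riemUp e a d b * c.dΩ d
    - (c.dΩ e * m.P a b - c.dΩ a * m.P e b + m.g b a * c.con m.P e - m.g b e * c.con m.P a) := by
  have h1 : ∑ d, m.riem e a d b * c.uΩ d = ∑ d, m.riemUp e a d b * c.dΩ d := by
    simp only [MetricRing.riem, ← c.sum_g_uΩ, Finset.mul_sum, Finset.sum_mul]
    rw [Finset.sum_comm]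
    refine Finset.sum_congr rfl fun d _ => Finset.sum_congr rfl fun b _ => ?_
    rw [m.g_symm b d]; ring
  have h2 : ∀ e, c.dΩ e = ∑ d, m.g d e * c.uΩ d := by
    intro e; rw [← c.con_g e, con]; simp only [m.g_symm e]
  rw [← h1, h2 e, h2 a]
  simp only [V, MetricRing.weyl, con, Fin.sum_univ_four]
  ring

/-- Commuting two derivatives of dΩ produces Riemann contracted with ∇Ω. Writing ∇∇Ω as E - ΩP - ρg
turns Riemann into Weyl and ∇P into the Cotton tensor. -/
lemma weyl_cotton (e a b : Fin 4) : - c.V e a b = m.cov2 c.E e a b - m.cov2 c.E a e b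
    - c.Ω * m.cotton b e a + m.g a b * (c.con m.P e - m.D e c.ρ)
    - m.g e b * (c.con m.P a - m.D a c.ρ) := by
  have hE : ∀ e a b, m.cov2 c.E e a b = m.cov2 c.S e a b
      + (c.dΩ e * m.P a b + c.Ω * m.cov2 m.P e a b) + m.D e c.ρ * m.g a b := by
    intro e a b
    have : m.cov2 c.E e a b = m.cov2 c.S e a b + m.cov2 (fun a b => c.Ω * m.P a b) e a b
      + m.cov2 (fun a b => c.ρ * m.g a b) e a b := by
      rw [← m.cov2_add, ← m.cov2_add]; rfl
    rw [this, m.cov2_mul, m.cov2_mul, m.cov2_g]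
    simp only [dΩ]; ring
  have h := m.cov2_comm c.dΩ e a b
  change m.cov2 c.S e a b - m.cov2 c.S a e b = _ at h
  rw [hE, hE, V_eq, MetricRing.cotton, 
    m.g_symm b a, m.g_symm b e]
  linear_combination -h

/-- The Weyl tensor is skew in its last pair, into which ∇Ω is inserted twice. -/
lemma con_V (e a : Fin 4) : ∑ b, c.V e a b * c.uΩ b = 0 := by
  apply natCast_mul_cancel 2
  simp only [V, Fin.sum_univ_four]
  push_cast
  have h := fun d b => m.weyl_antisymm' e a d b
  have h0 := h 0 0; have h1 := h 1 1; have h2 := h 2 2; have h3 := h 3 3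
  rw [h 0 1, h 0 2, h 0 3, h 1 2, h 1 3, h 2 3]
  linear_combination h0 * c.uΩ 0 * c.uΩ 0 + h1 * c.uΩ 1 * c.uΩ 1 + h2 * c.uΩ 2 * c.uΩ 2
    + h3 * c.uΩ 3 * c.uΩ 3

end

variable {p : ℕ} (c : ConformalEinstein m lam (p + 1))

/-- `Ω⁻¹` times the divergence of `E_{ab}` -/
noncomputable def e' (a : Fin 4) : A :=
  c.Ω ^ p * ((p + 2) * c.con c.σ a + c.Ω * m.div2 c.σ a)

/-- the contribution of the stress-energy tensor to the Cotton tensor -/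
noncomputable def Z (e a b : Fin 4) : A :=
  3 * (p + 2) * c.Ω ^ p * (c.dΩ e * c.σ a b - c.dΩ a * c.σ e b)
    + 3 * c.Ω ^ (p + 1) * (m.cov2 c.σ e a b - m.cov2 c.σ a e b)
    + m.g a b * c.e' e - m.g e b * c.e' a

/-- `3 Ω⁻¹ C_{cadb} ∇^dΩ` -/
noncomputable def Y (e a b : Fin 4) : A := 3 * m.cotton b e a - c.Z e a b

/-- With q = p+1 ≥ 1, both ∇E and div E carry a factor Ω, and so does every term of `weyl_cotton`.
In particular C(·,·,∇Ω,·) vanishes on Σ. -/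
lemma three_V (e a b : Fin 4) : 3 * c.V e a b = c.Ω * c.Y e a b := by
  have h := c.weyl_cotton e a b
  have hE : ∀ e a b, m.cov2 c.E e a b = (p + 2) * c.Ω ^ (p + 1) * c.dΩ e * c.σ a b
      + c.Ω ^ (p + 2) * m.cov2 c.σ e a b := by
    intro e a b
    have h : c.E = fun a b => c.Ω ^ (p + 2) * c.σ a b := by ext a b; exact c.E_eq a b
    rw [h, m.cov2_mul, c.D_pow (p + 1)]
    push_cast; ring
  have hd : ∀ a, 3 * (c.con m.P a - m.D a c.ρ) = c.Ω * c.e' a := by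
    intro a
    rw [← div2_E, div2_E', e']
    push_cast; ring
  rw [hE, hE] at h
  rw [Y, Z]
  linear_combination -3 * h - m.g a b * hd e + m.g e b * hd a

/-- Contract `three_V` with ∇Ω: the left side vanishes by `con_V` and Ω can be cancelled. The Cotton
tensor with ∇Ω in its first slot is thus determined by the matter. -/
lemma con_cotton (e a : Fin 4) :
    3 * ∑ b, m.cotton b e a * c.uΩ b = ∑ b, c.Z e a b * c.uΩ b := by
  apply c.Ω_cancel
  have h := c.con_V e a
  have h3 := c.three_V e a
  have h4 : 3 * ∑ b, c.V e a b * c.uΩ b = ∑ b, c.Ω * c.Y e a b * c.uΩ b := by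
    simp only [← h3, Fin.sum_univ_four]; ring
  rw [h, mul_zero] at h4
  simp only [Y, Fin.sum_univ_four] at h4 ⊢
  linear_combination -h4

end ConformalEinstein
end ConformalInfinity

/-! ### The divergence of the Weyl tensor on the boundary -/

namespace ConformalInfinity
namespace MetricRing

variable {A : Type*} [CommRing A] [Algebra ℝ A] (m : MetricRing A)

/-- Moves a divergence to the tensor with its first index raised, where the contracted Bianchi
identity is available. -/
lemma cov3_lower (X : Fin 4 → Fin 4 → Fin 4 → A) (e f a b : Fin 4) :
    m.cov3 (fun f a b => ∑ k, m.g f k * X k a b) e f a b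
      = ∑ k, m.g f k * (m.D e (X k a b) + ∑ j, (m.Γ k e j * X j a b - m.Γ j e a * X k j b
        - m.Γ j e b * X k a j)) := by
  simp only [cov3, Fin.sum_univ_four, map_add, Derivation.leibniz, smul_eq_mul, compat]
  ring

lemma sum_G_lower (X : Fin 4 → Fin 4 → A) :
    ∑ e, ∑ f, m.G e f * ∑ k, m.g f k * X e k = ∑ e, X e e :=
  Finset.sum_congr rfl fun e _ => m.sum_G_low (X e) e

lemma cov3_prod (v : Fin 4 → A) (t : Fin 4 → Fin 4 → A) (e f a b : Fin 4) :
    m.cov3 (fun f a b => v f * t a b) e f a b = m.cov1 v e f * t a b + v f * m.cov2 t e a b := by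
  simp only [cov3, cov2, cov1, Fin.sum_univ_four, Derivation.leibniz, smul_eq_mul]; ring

lemma cov3_prod_swap (v : Fin 4 → A) (t : Fin 4 → Fin 4 → A) (e f a b : Fin 4) :
    m.cov3 (fun f a b => v a * t f b) e f a b = m.cov1 v e a * t f b + v a * m.cov2 t e f b := by
  simp only [cov3, cov2, cov1, Fin.sum_univ_four, Derivation.leibniz, smul_eq_mul]; ring

lemma cov3_g_prod (v : Fin 4 → A) (e f a b : Fin 4) :
    m.cov3 (fun f a b => m.g b a * v f) e f a b = m.g b a * m.cov1 v e f := by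
  simp only [cov3, cov1, Fin.sum_univ_four, Derivation.leibniz, smul_eq_mul, compat]; ring

lemma cov3_g_prod_swap (v : Fin 4 → A) (e f a b : Fin 4) :
    m.cov3 (fun f a b => m.g b f * v a) e f a b = m.g b f * m.cov1 v e a := by
  simp only [cov3, cov1, Fin.sum_univ_four, Derivation.leibniz, smul_eq_mul, compat]; ring

lemma cov3_add (s t : Fin 4 → Fin 4 → Fin 4 → A) (e a b c : Fin 4) :
    m.cov3 (fun a b c => s a b c + t a b c) e a b c = m.cov3 s e a b c + m.cov3 t e a b c := by
  simp only [cov3, map_add, Fin.sum_univ_four]; ring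

lemma cov3_sub (s t : Fin 4 → Fin 4 → Fin 4 → A) (e a b c : Fin 4) :
    m.cov3 (fun a b c => s a b c - t a b c) e a b c = m.cov3 s e a b c - m.cov3 t e a b c := by
  simp only [cov3, map_sub, Fin.sum_univ_four]; ring

/-- The Leibniz rule for curvature contracted with u; the derivative of the curvature is evaluated
by `sum_covRiem'`. -/
lemma sum_covRiem_contract (u : Fin 4 → A) (a b : Fin 4) :
    ∑ e, (m.D e (∑ d, m.riemUp d b e a * u d) + ∑ f, (m.Γ e e f * (∑ d, m.riemUp d b f a * u d)
      - m.Γ f e a * (∑ d, m.riemUp d b e f * u d) - m.Γ f e b * (∑ d, m.riemUp d f e a * u d)))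
    = ∑ d, (m.cov2 m.ric d b a - m.cov2 m.ric b d a) * u d
      + ∑ e, ∑ d, m.riemUp d b e a * m.covV u e d := by
  have h : ∀ e, (m.D e (∑ d, m.riemUp d b e a * u d)
      + ∑ f, (m.Γ e e f * (∑ d, m.riemUp d b f a * u d)
      - m.Γ f e a * (∑ d, m.riemUp d b e f * u d) - m.Γ f e b * (∑ d, m.riemUp d f e a * u d)))
      = ∑ d, (m.covRiem e d b e a * u d) + ∑ d, m.riemUp d b e a * m.covV u e d := by
    intro e
    simp only [covRiem, covV, Fin.sum_univ_four, map_add, Derivation.leibniz, smul_eq_mul]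
    ring
  simp only [h, Finset.sum_add_distrib, ← sum_covRiem', Finset.sum_mul]
  rw [Finset.sum_comm]

end MetricRing

namespace ConformalEinstein

variable {A : Type*} [CommRing A] [Algebra ℝ A] {m : MetricRing A} {lam : ℝ}

section
variable {q : ℕ} (c : ConformalEinstein m lam q) (ev : A →ₐ[ℝ] ℝ)

/-- The exponent q+1 is positive even for q = 0, so the matter term dies on Σ and the Hessian is
pure trace. -/
lemma ev_S (h0 : ev c.Ω = 0) (a b : Fin 4) : ev (c.S a b) = - ev c.ρ * ev (m.g a b) := by
  rw [S_eq]; simp [h0]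

lemma ev_norm (h0 : ev c.Ω = 0) : ∑ a, ev (c.dΩ a) * ev (c.uΩ a) = - lam := by
  have h := congrArg ev c.norm'
  simp only [map_mul, map_sum, map_sub, map_pow, h0, AlgHom.commutes, map_ofNat,
    Algebra.algebraMap_self, RingHom.id_apply] at h
  simp only [ne_eq, Nat.add_eq_zero_iff, OfNat.ofNat_ne_zero, and_false, not_false_eq_true,
    zero_pow, zero_mul, mul_zero] at h
  linarith

lemma ev_covV (h0 : ev c.Ω = 0) (a b : Fin 4) : ev (m.covV c.uΩ a b) = if a = b then - ev c.ρ else 0 := by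
  rw [covV_uΩ, map_sum]
  simp only [map_mul, c.ev_S ev h0]
  have h := congrArg ev (m.G_g b a)
  simp only [m.g_symm a, map_sum, map_mul] at h ⊢
  calc _ = - ev c.ρ * ∑ x, ev (m.G b x) * ev (m.g x a) := by
        rw [Finset.mul_sum]; exact Finset.sum_congr rfl fun _ _ => by ring
    _ = _ := by rw [h]; by_cases hab : a = b <;> simp [hab, eq_comm]

lemma ev_cov1_con (h0 : ev c.Ω = 0) (t : Fin 4 → Fin 4 → A) (e a : Fin 4) : ev (m.cov1 (c.con t) e a)
    = ∑ b, ev (m.cov2 t e a b) * ev (c.uΩ b) - ev c.ρ * ev (t a e) := by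
  rw [show c.con t = fun a => ∑ b, t a b * c.uΩ b from rfl, m.cov1_contract]
  simp only [map_sum, map_add, map_mul, c.ev_covV ev h0, Finset.sum_add_distrib, mul_ite, mul_zero,
    Finset.sum_ite_eq, Finset.mem_univ, if_true]
  ring

/-- In dimension four the divergence of the Weyl tensor is the Cotton tensor. The term where ∇Ω is
differentiated is a trace of the Weyl tensor, since ∇∇Ω = -ρ g on Σ, and so it vanishes. No
assumption on q is needed. -/
lemma ev_div_V (h0 : ev c.Ω = 0) (a b : Fin 4) : ∑ e, ∑ f, ev (m.G e f) * ev (m.cov3 c.V e f a b)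
    = ∑ d, ev (m.cotton a d b) * ev (c.uΩ d) := by
  have hV : c.V = fun e a b => (∑ k, m.g e k * ∑ d, m.riemUp d b k a * c.uΩ d)
      - (c.dΩ e * m.P a b - c.dΩ a * m.P e b + m.g b a * c.con m.P e - m.g b e * c.con m.P a) := by
    ext e a b
    rw [V_eq]
    congr 1
    have h1 : ∑ d, m.riemUp e a d b * c.dΩ d = ∑ d, m.riem e a d b * c.uΩ d := by
      simp only [MetricRing.riem, ← c.sum_g_uΩ, Finset.mul_sum, Finset.sum_mul]
      rw [Finset.sum_comm]
      refine Finset.sum_congr rfl fun d _ => Finset.sum_congr rfl fun b _ => ?_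
      rw [m.g_symm b d]; ring
    rw [h1]
    simp only [m.riem_symm_pair e a]
    simp only [MetricRing.riem, Finset.mul_sum, Finset.sum_mul]
    rw [Finset.sum_comm]
    simp only [mul_assoc]
  -- The curvature part of ∇V is kept opaque. Only its trace matters, and `h2` evaluates that as a
  -- whole.
  obtain ⟨X, hX⟩ : ∃ X : Fin 4 → Fin 4 → A, ∀ e f, X e f = ∑ k, m.g f k * (m.D e (∑ d, m.riemUp d b k a * c.uΩ d)
          + ∑ j, (m.Γ k e j * (∑ d, m.riemUp d b j a * c.uΩ d)
          - m.Γ j e a * (∑ d, m.riemUp d b k j * c.uΩ d)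
          - m.Γ j e b * (∑ d, m.riemUp d j k a * c.uΩ d))) :=
    ⟨_, fun _ _ => rfl⟩
  have h1 : ∀ e f, m.cov3 c.V e f a b
      = X e f
      - (c.S e f * m.P a b + c.dΩ f * m.cov2 m.P e a b
        - (c.S e a * m.P f b + c.dΩ a * m.cov2 m.P e f b)
        + m.g b a * m.cov1 (c.con m.P) e f - m.g b f * m.cov1 (c.con m.P) e a) := by
    intro e f
    rw [hX, hV, m.cov3_sub, m.cov3_lower (fun k a b => ∑ d, m.riemUp d b k a * c.uΩ d),
      m.cov3_sub, m.cov3_add, m.cov3_sub, m.cov3_prod, m.cov3_prod_swap, m.cov3_g_prod,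
      m.cov3_g_prod_swap]
    rfl
  have h2 : ∑ e, ∑ f, m.G e f * X e f
      = ∑ d, (m.cov2 m.ric d b a - m.cov2 m.ric b d a) * c.uΩ d
        + ∑ e, ∑ d, m.riemUp d b e a * m.covV c.uΩ e d := by
    rw [← m.sum_covRiem_contract]
    simp only [hX]
    exact m.sum_G_lower _
  have h2' := congrArg ev h2
  have hric : ∀ e a b, m.cov2 m.ric e a b = 2 * m.cov2 m.P e a b + m.D e m.J * m.g a b := by
    intro e a b
    have : m.ric = fun a b => 2 * m.P a b + m.J * m.g a b := by ext a b; exact m.ric_eq_P a b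
    rw [this, m.cov2_add, m.cov2_mul, m.cov2_mul, m.cov2_g, D_ofNat]; ring
  have hG : ∀ f a, ∑ e, ev (m.G f e) * ev (m.g e a) = if f = a then 1 else 0 := by
    intro f a
    have := congrArg ev (m.G_g f a)
    simpa [apply_ite ev] using this
  have hup : ∀ e, ∑ f, ev (m.G e f) * ev (c.dΩ f) = ev (c.uΩ e) := by
    intro e; simp [uΩ, MetricRing.up]
  -- the contractions of the second group of terms
  have t1 : ∑ e, ∑ f, ev (m.G e f) * (ev (m.g e f)) = 4 := by
    have : ∀ e, ∑ f, ev (m.G e f) * ev (m.g e f) = 1 := fun e => by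
      simp only [m.g_symm e, hG]; simp
    simp [this]
  have t2 : ∑ e, ∑ f, ev (m.G e f) * (ev (c.dΩ f) * ev (m.cov2 m.P e a b))
      = ∑ e, ev (m.cov2 m.P e a b) * ev (c.uΩ e) := by
    refine Finset.sum_congr rfl fun e _ => ?_
    rw [← hup, Finset.mul_sum]; exact Finset.sum_congr rfl fun f _ => by ring
  have t3 : ∑ e, ∑ f, ev (m.G e f) * (ev (m.g e a) * ev (m.P f b)) = ev (m.P a b) := by
    rw [Finset.sum_comm]
    have : ∀ f, ∑ e, ev (m.G e f) * (ev (m.g e a) * ev (m.P f b))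
        = (if f = a then 1 else 0) * ev (m.P f b) := by
      intro f
      rw [← hG, Finset.sum_mul]
      exact Finset.sum_congr rfl fun e _ => by rw [m.G_symm]; ring
    simp [this]
  have t4 : ∀ d, ∑ e, ∑ f, ev (m.G e f) * ev (m.cov2 m.P e f d) = ev (m.D d m.J) := by
    intro d
    rw [← m.div2_P, MetricRing.div2]
    simp only [map_sum, map_mul]
    refine Finset.sum_congr rfl fun e _ => Finset.sum_congr rfl fun f _ => ?_
    rw [m.cov2_symm m.P_symm]
  have t5 : ∑ e, ∑ f, ev (m.G e f) * ev (m.cov1 (c.con m.P) e f)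
      = ∑ d, ev (m.D d m.J) * ev (c.uΩ d) - ev c.ρ * ev m.J := by
    have hJ : ev m.J = ∑ e, ∑ f, ev (m.G e f) * ev (m.P e f) := by
      simp [MetricRing.J, MetricRing.tr]
    rw [hJ]
    simp only [c.ev_cov1_con ev h0, ← t4, Fin.sum_univ_four, m.P_symm 1 0, m.P_symm 2 0,
      m.P_symm 3 0, m.P_symm 2 1, m.P_symm 3 1, m.P_symm 3 2]
    ring
  have t6 : ∑ e, ∑ f, ev (m.G e f) * (ev (m.g b f) * ev (m.cov1 (c.con m.P) e a))
      = ev (m.cov1 (c.con m.P) b a) := by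
    have : ∀ e, ∑ f, ev (m.G e f) * (ev (m.g b f) * ev (m.cov1 (c.con m.P) e a))
        = (if e = b then 1 else 0) * ev (m.cov1 (c.con m.P) e a) := by
      intro e
      rw [← hG, Finset.sum_mul]
      exact Finset.sum_congr rfl fun f _ => by rw [m.g_symm]; ring
    simp [this]
  have hdec : ∑ e, ∑ f, ev (m.G e f) * ev (m.cov3 c.V e f a b)
      = ev (∑ e, ∑ f, m.G e f * X e f)
      - ((- ev c.ρ * ev (m.P a b)) * (∑ e, ∑ f, ev (m.G e f) * (ev (m.g e f)))
        + (∑ e, ∑ f, ev (m.G e f) * (ev (c.dΩ f) * ev (m.cov2 m.P e a b)))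
        + ev c.ρ * (∑ e, ∑ f, ev (m.G e f) * (ev (m.g e a) * ev (m.P f b)))
        - ev (c.dΩ a) * (∑ e, ∑ f, ev (m.G e f) * ev (m.cov2 m.P e f b))
        + ev (m.g b a) * (∑ e, ∑ f, ev (m.G e f) * ev (m.cov1 (c.con m.P) e f))
        - ∑ e, ∑ f, ev (m.G e f) * (ev (m.g b f) * ev (m.cov1 (c.con m.P) e a))) := by
    simp only [h1, map_sub, map_add, map_mul, c.ev_S ev h0]
    simp only [map_sum, map_mul, Finset.mul_sum, ← Finset.sum_add_distrib,
      ← Finset.sum_sub_distrib]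
    refine Finset.sum_congr rfl fun e _ => Finset.sum_congr rfl fun f _ => ?_
    ring
  have hr : ∑ e, ∑ d, ev (m.riemUp d b e a) * ev (m.covV c.uΩ e d)
      = - ev c.ρ * ev (m.ric b a) := by
    simp only [c.ev_covV ev h0, mul_ite, mul_zero, Finset.sum_ite_eq, Finset.mem_univ, if_true]
    rw [MetricRing.ric, map_sum, Finset.mul_sum]
    exact Finset.sum_congr rfl fun e _ => mul_comm _ _
  rw [hdec, h2', t1, t2, t3, t4, t5, t6, c.ev_cov1_con ev h0]
  simp only [map_add, map_sum, map_mul, map_sub, hric, hr, m.ric_eq_P, MetricRing.cotton,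
    map_ofNat, m.cov2_symm m.P_symm b a, m.cov2_symm m.P_symm _ b a, m.g_symm b a,
    m.P_symm b a]
  have hg : ev (c.dΩ a) = ∑ d, ev (m.g d a) * ev (c.uΩ d) := by
    rw [← c.con_g a, con]; simp [m.g_symm a]
  rw [hg]
  simp only [Fin.sum_univ_four]
  ring

end

end ConformalEinstein
end ConformalInfinity

/-! ### Consequences on the boundary for the Cotton and stress-energy tensors -/

namespace ConformalInfinity
namespace ConformalEinstein

variable {A : Type*} [CommRing A] [Algebra ℝ A] {m : MetricRing A} {lam : ℝ}

section
variable {q : ℕ} (c : ConformalEinstein m lam q) (ev : A →ₐ[ℝ] ℝ)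

lemma ev_sum_g_uΩ (a : Fin 4) : ∑ b, ev (m.g a b) * ev (c.uΩ b) = ev (c.dΩ a) := by
  rw [← c.sum_g_uΩ]; simp

lemma ev_sum_G_dΩ (e : Fin 4) : ∑ f, ev (m.G e f) * ev (c.dΩ f) = ev (c.uΩ e) := by
  simp [uΩ, MetricRing.up]

lemma ev_con (t : Fin 4 → Fin 4 → A) (a : Fin 4) :
    ev (c.con t a) = ∑ b, ev (t a b) * ev (c.uΩ b) := by
  simp [con]

lemma ev_constraint (h0 : ev c.Ω = 0) (a : Fin 4) :
    ((q : ℝ) - 2) * ev (c.con c.T a) + ev (c.dΩ a) * ev c.t = 0 := by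
  simpa [h0, map_ofNat] using congrArg ev (c.constraint a)

/-- `A_{acb} ∇^cΩ` -/
noncomputable def B (a b : Fin 4) : A := ∑ d, m.cotton a d b * c.uΩ d

/-- The Cotton tensor is divergence-free in its first slot, and differentiating ∇Ω = u contributes
only ρ times a trace of it, which is zero as well. -/
lemma ev_div_B (h0 : ev c.Ω = 0) (b : Fin 4) :
    ∑ e, ∑ a, ev (m.G e a) * ev (m.cov2 c.B e a b) = 0 := by
  have h1 : ∀ e a, ev (m.cov2 c.B e a b)
      = ∑ d, ev (m.cov3 m.cotton e a d b) * ev (c.uΩ d) - ev c.ρ * ev (m.cotton a e b) := by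
    intro e a
    rw [show c.B = fun a b => ∑ d, m.cotton a d b * c.uΩ d from rfl, m.cov2_contract]
    simp only [map_sum, map_add, map_mul, c.ev_covV ev h0, Finset.sum_add_distrib, mul_ite,
      mul_zero, Finset.sum_ite_eq, Finset.mem_univ, if_true]
    ring
  have h2 : ∀ d, ∑ e, ∑ a, ev (m.G e a) * ev (m.cov3 m.cotton e a d b) = 0 := fun d => by
    simpa using congrArg ev (m.div_cotton d b)
  have h3 : ∑ e, ∑ a, ev (m.G e a) * ev (m.cotton a e b) = 0 := by
    have := congrArg ev (m.cotton_trace b)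
    simp only [map_sum, map_mul, map_zero] at this
    rw [← this, Finset.sum_comm]
    exact Finset.sum_congr rfl fun e _ => Finset.sum_congr rfl fun f _ => by rw [m.G_symm]
  have h4 : ∑ e, ∑ a, ev (m.G e a) * ev (m.cov2 c.B e a b)
      = ∑ d, (∑ e, ∑ a, ev (m.G e a) * ev (m.cov3 m.cotton e a d b)) * ev (c.uΩ d)
        - ev c.ρ * ∑ e, ∑ a, ev (m.G e a) * ev (m.cotton a e b) := by
    simp only [h1, Fin.sum_univ_four]; ring
  rw [h4, h3]; simp [h2]

end

section
variable {p : ℕ} (c : ConformalEinstein m lam (p + 1)) (ev : A →ₐ[ℝ] ℝ)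

lemma ev_V (h0 : ev c.Ω = 0) (e a b : Fin 4) : ev (c.V e a b) = 0 := by
  have := congrArg ev (c.three_V e a b)
  simpa [h0, map_ofNat] using this

/-- For `q = 1`, the stress-energy tensor is determined on the boundary by its trace. -/
lemma ev_T_of_one (c : ConformalEinstein m lam 1) (h0 : ev c.Ω = 0) (a b : Fin 4) :
    lam * ev (c.T a b) = - (ev c.t * ev (c.dΩ a) * ev (c.dΩ b)) := by
  -- On Σ only the derivative of the factor Ω survives in ∇(ΩY), so the divergence of V is a third
  -- of Y contracted with ∇Ω.
  have hdiv : ∀ a b, ∑ f, ev (c.uΩ f) * ev (c.Y (p := 0) f a b)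
      = 3 * ∑ d, ev (m.cotton a d b) * ev (c.uΩ d) := by
    intro a b
    rw [← c.ev_div_V ev h0]
    have h1 : ∀ e f, 3 * ev (m.cov3 c.V e f a b) = ev (c.dΩ e) * ev (c.Y (p := 0) f a b) := by
      intro e f
      have h2 : m.cov3 (fun a b d => 3 * c.V a b d) e f a b
          = m.cov3 (fun a b d => c.Ω * c.Y (p := 0) a b d) e f a b := by
        congr 1; ext a b d; exact c.three_V (p := 0) a b d
      rw [m.cov3_mul, m.cov3_mul, D_ofNat] at h2
      have h3 := congrArg ev h2
      simpa [h0, dΩ, map_ofNat] using h3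
    simp only [Finset.mul_sum, ← c.ev_sum_G_dΩ, Finset.sum_mul]
    rw [Finset.sum_comm]
    refine Finset.sum_congr rfl fun e _ => Finset.sum_congr rfl fun f _ => ?_
    rw [m.G_symm f e]
    linear_combination (-ev (m.G e f)) * h1 e f
  -- The cyclic identity combines the two Cotton terms into one that is skew in a and b. The
  -- symmetric part of the left side must therefore vanish.
  have hZ : ∀ a b, ∑ f, ev (c.uΩ f) * ev (c.Z (p := 0) f a b)
      = -3 * ∑ f, ev (c.uΩ f) * ev (m.cotton f a b) := by
    intro a b
    have h := hdiv a b
    simp only [Y, map_sub, map_mul, map_ofNat, Fin.sum_univ_four] at h ⊢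
    have hc : ∀ f, ev (m.cotton a b f) + ev (m.cotton b f a) + ev (m.cotton f a b) = 0 :=
      fun f => by simpa using congrArg ev (m.cotton_cyclic a b f)
    have ha : ∀ f, ev (m.cotton a b f) = - ev (m.cotton a f b) :=
      fun f => by simpa using congrArg ev (m.cotton_antisymm a b f)
    linear_combination -h + 3 * ev (c.uΩ 0) * (hc 0 - ha 0) + 3 * ev (c.uΩ 1) * (hc 1 - ha 1)
      + 3 * ev (c.uΩ 2) * (hc 2 - ha 2) + 3 * ev (c.uΩ 3) * (hc 3 - ha 3)
  have hsym : ∑ f, ev (c.uΩ f) * ev (c.Z (p := 0) f a b)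
      + ∑ f, ev (c.uΩ f) * ev (c.Z (p := 0) f b a) = 0 := by
    have ha : ∀ f, ev (m.cotton f a b) = - ev (m.cotton f b a) :=
      fun f => by simpa using congrArg ev (m.cotton_antisymm f a b)
    rw [hZ, hZ]
    simp only [ha, mul_neg, Finset.sum_neg_distrib]; ring
  -- For q = 1 the constraint gives T(∇Ω) = (tr T) dΩ on Σ.
  have hσ : ∀ a, ev (c.con c.σ a) = 3 / 8 * ev c.t * ev (c.dΩ a) := by
    intro a
    have h1 := congrArg ev (c.eight_con_σ a)
    have h2 := c.ev_constraint ev h0 a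
    simp only [map_mul, map_sub, map_ofNat] at h1
    push_cast at h2
    linear_combination h1 / 8 - h2 / 2
  have he : ∀ a, ev (c.e' (p := 0) a) = 3 / 4 * ev c.t * ev (c.dΩ a) := by
    intro a
    simp only [e', map_mul, map_add, h0, map_pow, hσ, zero_mul, map_natCast, map_ofNat]
    norm_num; ring
  have hN := c.ev_norm ev h0
  -- With σ(∇Ω) known, the only unknown left is |dΩ|² σ_ab, so `hsym` can be solved for σ.
  have hexp : ∀ a b, ∑ f, ev (c.uΩ f) * ev (c.Z (p := 0) f a b)
      = 6 * ((∑ f, ev (c.dΩ f) * ev (c.uΩ f)) * ev (c.σ a b)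
        - ev (c.dΩ a) * ev (c.con c.σ b))
        + ev (m.g a b) * (3 / 4 * ev c.t * ∑ f, ev (c.dΩ f) * ev (c.uΩ f))
        - ev (c.dΩ b) * (3 / 4 * ev c.t * ev (c.dΩ a)) := by
    intro a b
    rw [ev_con, ← c.ev_sum_g_uΩ ev b]
    simp only [Z, map_mul, map_add, map_sub, h0, map_pow, map_natCast, map_ofNat, he,
      Fin.sum_univ_four, m.g_symm _ b, c.σ_symm _ b]
    norm_num; ring
  rw [hexp, hexp, hN, hσ, hσ, c.σ_symm b a, m.g_symm b a] at hsym
  have h8 := congrArg ev (c.eight_σ a b)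
  simp only [map_mul, map_sub, map_ofNat] at h8
  linear_combination -hsym / 6 - lam * h8 / 4

/-- `3 ∇^aΩ ∇^cΩ A_{acb}`, in terms of the stress-energy tensor -/
lemma three_con_B (b : Fin 4) : 3 * ∑ a, c.uΩ a * c.B a b
    = 2 * (p + 2) * c.Ω ^ p * ((∑ f, c.dΩ f * c.uΩ f) * c.con c.σ b
        - c.dΩ b * ∑ f, c.con c.σ f * c.uΩ f)
      + c.Ω ^ (p + 1) * (3 * ∑ e, ∑ a, (m.cov2 c.σ e b a - m.cov2 c.σ b e a) * c.uΩ a * c.uΩ e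
        + c.dΩ b * ∑ f, m.div2 c.σ f * c.uΩ f
        - (∑ f, c.dΩ f * c.uΩ f) * m.div2 c.σ b) := by
  have h1 : 3 * ∑ a, c.uΩ a * c.B a b
      = ∑ e, c.uΩ e * ∑ a, c.Z e b a * c.uΩ a := by
    simp only [← con_cotton]
    simp only [B, Finset.mul_sum]
    rw [Finset.sum_comm]
    exact Finset.sum_congr rfl fun e _ => Finset.sum_congr rfl fun f _ => by ring
  have h2 : ∀ e, ∑ a, c.Z e b a * c.uΩ a
      = 3 * (p + 2) * c.Ω ^ p * (c.dΩ e * c.con c.σ b - c.dΩ b * c.con c.σ e)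
        + 3 * c.Ω ^ (p + 1) * ∑ a, (m.cov2 c.σ e b a - m.cov2 c.σ b e a) * c.uΩ a
        + c.dΩ b * c.e' e - c.dΩ e * c.e' b := by
    intro e
    have h3 : c.dΩ b * c.e' e - c.dΩ e * c.e' b = (∑ d, m.g b d * c.uΩ d) * c.e' e
        - (∑ d, m.g e d * c.uΩ d) * c.e' b := by rw [c.sum_g_uΩ, c.sum_g_uΩ]
    rw [add_sub_assoc, h3]
    simp only [Z, con, Fin.sum_univ_four]; ring
  rw [h1]
  simp only [h2, e', Fin.sum_univ_four]
  ring

/-- By the cyclic identity the skew part of B is the Cotton tensor with ∇Ω in its first slot, which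
`con_cotton` expresses through Z. On Σ that is a multiple of Ω^p (dΩ_b σ(∇Ω)_a - dΩ_a σ(∇Ω)_b). For
p = 1 the factor Ω vanishes; for p = 0 the constraint makes σ(∇Ω) parallel to dΩ. -/
lemma ev_B_symm (h0 : ev c.Ω = 0) (hp : p ≤ 1) (a b : Fin 4) : ev (c.B a b) = ev (c.B b a) := by
  have h1 : 3 * (ev (c.B a b) - ev (c.B b a)) = - ∑ d, ev (c.Z b a d) * ev (c.uΩ d) := by
    have h2 := congrArg ev (c.con_cotton b a)
    simp only [map_sum, map_mul, map_ofNat] at h2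
    rw [← h2]
    simp only [B, map_add, map_mul, Fin.sum_univ_four]
    have hc : ∀ f, ev (m.cotton a b f) + ev (m.cotton b f a) + ev (m.cotton f a b) = 0 :=
      fun f => by simpa using congrArg ev (m.cotton_cyclic a b f)
    have ha : ∀ f, ev (m.cotton a b f) = - ev (m.cotton a f b) :=
      fun f => by simpa using congrArg ev (m.cotton_antisymm a b f)
    have hb : ∀ f, ev (m.cotton f a b) = - ev (m.cotton f b a) :=
      fun f => by simpa using congrArg ev (m.cotton_antisymm f a b)
    linear_combination -3 * ev (c.uΩ 0) * (hc 0 - ha 0 - hb 0)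
      - 3 * ev (c.uΩ 1) * (hc 1 - ha 1 - hb 1)
      - 3 * ev (c.uΩ 2) * (hc 2 - ha 2 - hb 2) - 3 * ev (c.uΩ 3) * (hc 3 - ha 3 - hb 3)
  have h3 : ∑ d, ev (c.Z b a d) * ev (c.uΩ d) = 0 := by
    have h4 : ∑ d, ev (c.Z b a d) * ev (c.uΩ d)
        = 2 * (p + 2) * ev c.Ω ^ p * (ev (c.dΩ b) * ev (c.con c.σ a)
          - ev (c.dΩ a) * ev (c.con c.σ b)) := by
      have h5 : ∀ d, ev (c.Z b a d) = 3 * (p + 2) * ev c.Ω ^ p * (ev (c.dΩ b) * ev (c.σ a d)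
          - ev (c.dΩ a) * ev (c.σ b d)) + ev (m.g a d) * ev (c.e' b)
          - ev (m.g b d) * ev (c.e' a) := by
        intro d
        simp only [Z, map_mul, map_add, map_sub, map_pow, map_natCast, map_ofNat, h0]
        ring
      have h6 : ∀ a, ev (c.e' a) = ev c.Ω ^ p * ((p + 2) * ev (c.con c.σ a)) := by
        intro a
        simp only [e', map_mul, map_add, map_pow, map_natCast, map_ofNat, h0]
        ring
      have h7 : ∑ d, ev (c.Z b a d) * ev (c.uΩ d)
          = 3 * (p + 2) * ev c.Ω ^ p * (ev (c.dΩ b) * (∑ d, ev (c.σ a d) * ev (c.uΩ d))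
          - ev (c.dΩ a) * (∑ d, ev (c.σ b d) * ev (c.uΩ d)))
          + (∑ d, ev (m.g a d) * ev (c.uΩ d)) * ev (c.e' b)
          - (∑ d, ev (m.g b d) * ev (c.uΩ d)) * ev (c.e' a) := by
        simp only [h5, Fin.sum_univ_four]; ring
      rw [h7, ← ev_con, ← ev_con, ev_sum_g_uΩ, ev_sum_g_uΩ, h6, h6]
      ring
    rw [h4, h0]
    interval_cases p
    · have hσ : ∀ a, ev (c.con c.σ a) = 3 / 8 * ev c.t * ev (c.dΩ a) := by
        intro a
        have h1 := congrArg ev (c.eight_con_σ a)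
        have h2 := c.ev_constraint ev h0 a
        simp only [map_mul, map_sub, map_ofNat] at h1
        push_cast at h2
        linear_combination h1 / 8 - h2 / 2
      rw [hσ, hσ]; ring
    · simp
  linarith

end

end ConformalEinstein
end ConformalInfinity

/-! ### The normal derivative of the contracted Cotton tensor -/

namespace ConformalInfinity
namespace ConformalEinstein

variable {A : Type*} [CommRing A] [Algebra ℝ A] {m : MetricRing A} {lam : ℝ}

lemma sum_B_uΩ {q : ℕ} (c : ConformalEinstein m lam q) (a : Fin 4) :
    ∑ b, c.B a b * c.uΩ b = 0 := by
  apply natCast_mul_cancel 2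
  simp only [B, Fin.sum_univ_four]
  have h := fun d b => m.cotton_antisymm a d b
  have h0 := h 0 0; have h1 := h 1 1; have h2 := h 2 2; have h3 := h 3 3
  rw [h 0 1, h 0 2, h 0 3, h 1 2, h 1 3, h 2 3]
  push_cast
  linear_combination h0 * c.uΩ 0 * c.uΩ 0 + h1 * c.uΩ 1 * c.uΩ 1 + h2 * c.uΩ 2 * c.uΩ 2
    + h3 * c.uΩ 3 * c.uΩ 3

variable {p : ℕ} (c : ConformalEinstein m lam (p + 1)) (ev : A →ₐ[ℝ] ℝ)

lemma ev_sum_B_uΩ {q : ℕ} (c : ConformalEinstein m lam q) (a : Fin 4) :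
    ∑ b, ev (c.B a b) * ev (c.uΩ b) = 0 := by
  simpa using congrArg ev (c.sum_B_uΩ a)

lemma ev_sum_uΩ_B (h0 : ev c.Ω = 0) (hp : p ≤ 1) (b : Fin 4) :
    ∑ a, ev (c.uΩ a) * ev (c.B a b) = 0 := by
  simp only [c.ev_B_symm ev h0 hp _ b, mul_comm]
  exact ev_sum_B_uΩ ev c b

/-- Differentiate `hM` along ∇Ω. On the right |dΩ|² = -λ appears; on the left the derivative of ∇Ω
gives ρ times the contraction of B with ∇Ω, which is zero on Σ. -/
lemma ev_normal_cov_B (h0 : ev c.Ω = 0) (hp : p ≤ 1) {M : Fin 4 → A}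
    (hM : ∀ b, 3 * ∑ a, c.uΩ a * c.B a b = c.Ω * M b) (b : Fin 4) :
    3 * ∑ e, ∑ a, ev (c.uΩ e) * ev (c.uΩ a) * ev (m.cov2 c.B e a b) = - lam * ev (M b) := by
  have h1 : ∀ e, m.cov1 (fun b => ∑ a, c.uΩ a * c.B a b) e b
      = ∑ a, (m.cov2 c.B e a b * c.uΩ a + c.B a b * m.covV c.uΩ e a) := by
    intro e
    simp only [MetricRing.cov1, MetricRing.cov2, MetricRing.covV, map_add, Derivation.leibniz,
      smul_eq_mul, Fin.sum_univ_four]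
    ring
  have h2 : ∀ e, 3 * m.cov1 (fun b => ∑ a, c.uΩ a * c.B a b) e b
      = c.dΩ e * M b + c.Ω * m.cov1 M e b := by
    intro e
    have h : m.cov1 (fun b => 3 * ∑ a, c.uΩ a * c.B a b) e b = m.cov1 (fun b => c.Ω * M b) e b := by
      simp only [hM]
    rw [m.cov1_mul, m.cov1_mul, D_ofNat] at h
    rw [dΩ]
    linear_combination h
  have h3 : ∀ e, 3 * (∑ a, ev (m.cov2 c.B e a b) * ev (c.uΩ a) - ev c.ρ * ev (c.B e b))
      = ev (c.dΩ e) * ev (M b) := by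
    intro e
    have h := congrArg ev (h2 e)
    rw [h1] at h
    simp only [map_sum, map_add, map_mul, c.ev_covV ev h0, Finset.sum_add_distrib, mul_ite,
      mul_zero, Finset.sum_ite_eq, Finset.mem_univ, if_true, h0, zero_mul, add_zero,
      map_ofNat] at h
    linear_combination h
  have h4 := c.ev_sum_uΩ_B ev h0 hp b
  rw [← c.ev_norm ev h0]
  simp only [Fin.sum_univ_four] at h3 h4 ⊢
  linear_combination ev (c.uΩ 0) * h3 0 + ev (c.uΩ 1) * h3 1 + ev (c.uΩ 2) * h3 2
    + ev (c.uΩ 3) * h3 3 + 3 * ev c.ρ * h4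

/-- In a tangential direction, where `hb` removes the dΩ_b terms, M reduces to -6λ σ(∇Ω), and 2σ(∇Ω)
= T(∇Ω). -/
lemma ev_normal_cov_B_of_two (c : ConformalEinstein m lam 2) (h0 : ev c.Ω = 0) (b : Fin 4)
    (hb : ev (c.dΩ b) = 0) :
    ∑ e, ∑ a, ev (c.uΩ e) * ev (c.uΩ a) * ev (m.cov2 c.B e a b)
      = lam ^ 2 * ev (c.con c.T b) := by
  have h := ev_normal_cov_B (p := 1) c ev h0 le_rfl (M := fun b =>
    6 * ((∑ f, c.dΩ f * c.uΩ f) * c.con c.σ b - c.dΩ b * ∑ f, c.con c.σ f * c.uΩ f)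
      + c.Ω * (3 * ∑ e, ∑ a, (m.cov2 c.σ e b a - m.cov2 c.σ b e a) * c.uΩ a * c.uΩ e
        + c.dΩ b * ∑ f, m.div2 c.σ f * c.uΩ f
        - (∑ f, c.dΩ f * c.uΩ f) * m.div2 c.σ b)) (fun b => by
      rw [three_con_B (p := 1)]; push_cast; ring) b
  have hN := c.ev_norm ev h0
  have hσ := congrArg ev (c.eight_con_σ b)
  simp only [map_add, map_mul, map_sub, map_ofNat, map_sum, h0, hb, hN] at h hσ
  linear_combination h / 3 + lam ^ 2 / 4 * hσ

/-- Here `three_con_B` has no explicit factor Ω in its first term; the constraint provides it. M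
then involves first derivatives of σ, all of which reduce to div T and the gradient of tr T. -/
lemma ev_normal_cov_B_of_one (c : ConformalEinstein m lam 1) (h0 : ev c.Ω = 0) (b : Fin 4)
    (hb : ev (c.dΩ b) = 0) :
    ∑ e, ∑ a, ev (c.uΩ e) * ev (c.uΩ a) * ev (m.cov2 c.B e a b)
      = lam ^ 2 * (ev (c.divT b) - 1 / 3 * ev (m.D b c.t)) := by
  -- The conservation law off Σ. Its part along dΩ cancels in the skew combination of `three_con_B`,
  -- leaving a multiple of Ω.
  have hσ : ∀ a, 8 * c.con c.σ a = 3 * c.t * c.dΩ a + 4 * c.Ω * c.divT a := by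
    intro a
    have h1 := c.eight_con_σ a
    have h2 := c.constraint a
    push_cast at h2
    linear_combination h1 - 4 * h2
  have h := ev_normal_cov_B (p := 0) c ev h0 zero_le_one (M := fun b =>
    2 * ((∑ f, c.dΩ f * c.uΩ f) * c.divT b - c.dΩ b * ∑ f, c.divT f * c.uΩ f)
      + (3 * ∑ e, ∑ a, (m.cov2 c.σ e b a - m.cov2 c.σ b e a) * c.uΩ a * c.uΩ e
        + c.dΩ b * ∑ f, m.div2 c.σ f * c.uΩ f
        - (∑ f, c.dΩ f * c.uΩ f) * m.div2 c.σ b)) (fun b => by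
      apply natCast_mul_cancel 2
      have h1 := c.three_con_B (p := 0) b
      have h2 : 8 * ∑ f, c.con c.σ f * c.uΩ f = 3 * c.t * (∑ f, c.dΩ f * c.uΩ f)
          + 4 * c.Ω * ∑ f, c.divT f * c.uΩ f := by
        simp only [Fin.sum_univ_four]
        linear_combination hσ 0 * c.uΩ 0 + hσ 1 * c.uΩ 1 + hσ 2 * c.uΩ 2 + hσ 3 * c.uΩ 3
      push_cast at h1 ⊢
      linear_combination 2 * h1 + (∑ f, c.dΩ f * c.uΩ f) * hσ b - c.dΩ b * h2) b
  have hN := c.ev_norm ev h0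
  have hgb : ∑ f, ev (m.g b f) * ev (c.uΩ f) = 0 := by rw [c.ev_sum_g_uΩ, hb]
  have hσb : ev (c.con c.σ b) = 0 := by
    have := congrArg ev (hσ b)
    simp only [map_mul, map_add, h0, hb, map_ofNat] at this
    linarith
  -- The derivatives of σ enter M contracted with ∇Ω, apart from div σ, so differentiating `hσ`
  -- determines them.
  have hD : ∀ e a, 8 * ev (m.cov1 (c.con c.σ) e a)
      = 3 * (ev (m.D e c.t) * ev (c.dΩ a) - ev c.t * ev c.ρ * ev (m.g e a))
        + 4 * ev (c.dΩ e) * ev (c.divT a) := by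
    intro e a
    have h1 : m.cov1 (fun a => 8 * c.con c.σ a) e a
        = m.cov1 (fun a => 3 * c.t * c.dΩ a + 4 * c.Ω * c.divT a) e a := by simp only [hσ]
    have h2 : m.cov1 (fun a => 3 * c.t * c.dΩ a + 4 * c.Ω * c.divT a) e a
        = m.cov1 (fun a => 3 * c.t * c.dΩ a) e a + m.cov1 (fun a => 4 * c.Ω * c.divT a) e a := by
      simp only [MetricRing.cov1, map_add, Fin.sum_univ_four]; ring
    rw [h2, m.cov1_mul, m.cov1_mul, m.cov1_mul, D_ofNat, zero_mul, zero_add] at h1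
    have h3 := congrArg ev h1
    have h4 := c.ev_S ev h0 e a
    simp only [S] at h4
    simp only [map_mul, map_add, map_ofNat, Derivation.leibniz, D_ofNat, smul_eq_mul, h4, h0,
      mul_zero, zero_mul, add_zero] at h3
    rw [show m.D e c.Ω = c.dΩ e from rfl] at h3
    linear_combination h3
  have hX1 : 8 * ∑ e, ∑ a, ev (m.cov2 c.σ e b a) * ev (c.uΩ a) * ev (c.uΩ e)
      = - 4 * lam * ev (c.divT b) := by
    have h1 : ∀ e, 8 * ∑ a, ev (m.cov2 c.σ e b a) * ev (c.uΩ a)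
        = - 3 * ev c.t * ev c.ρ * ev (m.g e b) + 4 * ev (c.dΩ e) * ev (c.divT b)
          + 8 * ev c.ρ * ev (c.σ b e) := by
      intro e
      have h2 := c.ev_cov1_con ev h0 c.σ e b
      have h3 := hD e b
      rw [hb] at h3
      linear_combination h3 - 8 * h2
    rw [ev_con] at hσb
    simp only [Fin.sum_univ_four, m.g_symm _ b] at h1 hN hσb hgb ⊢
    linear_combination ev (c.uΩ 0) * h1 0 + ev (c.uΩ 1) * h1 1 + ev (c.uΩ 2) * h1 2
      + ev (c.uΩ 3) * h1 3 + 4 * ev (c.divT b) * hN - 3 * ev c.t * ev c.ρ * hgb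
      + 8 * ev c.ρ * hσb
  have hX2 : 8 * ∑ e, ∑ a, ev (m.cov2 c.σ b e a) * ev (c.uΩ a) * ev (c.uΩ e)
      = - 3 * lam * ev (m.D b c.t) := by
    have h1 : ∀ e, 8 * ∑ a, ev (m.cov2 c.σ b e a) * ev (c.uΩ a)
        = 3 * (ev (m.D b c.t) * ev (c.dΩ e) - ev c.t * ev c.ρ * ev (m.g b e))
          + 8 * ev c.ρ * ev (c.σ b e) := by
      intro e
      have h2 := c.ev_cov1_con ev h0 c.σ b e
      have h3 := hD b e
      rw [hb] at h3
      rw [c.σ_symm e b] at h2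
      linear_combination h3 - 8 * h2
    rw [ev_con] at hσb
    simp only [Fin.sum_univ_four] at h1 hN hσb hgb ⊢
    linear_combination ev (c.uΩ 0) * h1 0 + ev (c.uΩ 1) * h1 1 + ev (c.uΩ 2) * h1 2
      + ev (c.uΩ 3) * h1 3 + 3 * ev (m.D b c.t) * hN - 3 * ev c.t * ev c.ρ * hgb
      + 8 * ev c.ρ * hσb
  have h8 := congrArg ev (c.eight_div_σ b)
  simp only [map_add, map_mul, map_sub, map_ofNat, map_sum, hb, hN, sub_mul,
    Finset.sum_sub_distrib] at h h8
  linear_combination h / 3 - lam / 8 * hX1 + lam / 8 * hX2 - lam ^ 2 / 24 * h8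

end ConformalEinstein
end ConformalInfinity

/-! ### Conformal change of the metric -/

namespace ConformalInfinity
namespace MetricRing

variable {A : Type*} [CommRing A] [Algebra ℝ A] (m : MetricRing A)

lemma koszul (k i j : Fin 4) : 2 * m.Γ k i j
    = ∑ l, m.G k l * (m.D i (m.g j l) + m.D j (m.g i l) - m.D l (m.g i j)) := by
  have h : ∀ l, m.D i (m.g j l) + m.D j (m.g i l) - m.D l (m.g i j)
      = ∑ d, m.g l d * (2 * m.Γ d i j) := by
    intro l
    simp only [compat, m.Γ_symm _ j i, m.Γ_symm _ l i, m.Γ_symm _ l j, Fin.sum_univ_four]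
    simp only [m.g_symm _ l, m.g_symm _ j]
    ring
  simp only [h]
  exact (m.sum_G_low (fun d => 2 * m.Γ d i j) k).symm

/-- The difference of the curvatures of two torsion-free connections. -/
lemma riemUp_sub {m m' : MetricRing A} (hD : m'.D = m.D) {Q : Fin 4 → Fin 4 → Fin 4 → A}
    (hQ : ∀ k i j, m'.Γ k i j = m.Γ k i j + Q k i j)
    (a b c d : Fin 4) :
    m'.riemUp a b c d = m.riemUp a b c d
      + (m.D a (Q c b d) + ∑ f, (m.Γ c a f * Q f b d - m.Γ f a b * Q c f d - m.Γ f a d * Q c b f))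
      - (m.D b (Q c a d) + ∑ f, (m.Γ c b f * Q f a d - m.Γ f b a * Q c f d - m.Γ f b d * Q c a f))
      + ∑ e, (Q c a e * Q e b d - Q c b e * Q e a d) := by
  simp only [riemUp, hD, hQ, map_add, Fin.sum_univ_four, m.Γ_symm _ b a]
  ring

section Conformal

variable {m m' : MetricRing A} {Ω w : A}

/-- gradient of `log Ω` -/
def dlog (m : MetricRing A) (Ω w : A) (a : Fin 4) : A := w * m.D a Ω

/-- Here w plays the role of Ω⁻¹, so that `m'` carries the metric Ω⁻²g. The two Koszul formulas are
subtracted. -/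
lemma conformal_Γ (hD : m'.D = m.D) (hg : ∀ a b, m'.g a b = w * w * m.g a b)
    (hG : ∀ a b, m'.G a b = Ω * Ω * m.G a b) (hw : w * Ω = 1) (k i j : Fin 4) :
    m'.Γ k i j = m.Γ k i j + (m.g i j * m.up (m.dlog Ω w) k
      - (if k = i then 1 else 0) * m.dlog Ω w j - (if k = j then 1 else 0) * m.dlog Ω w i) := by
  apply natCast_mul_cancel 2
  have hDw : ∀ a, m.D a w = - w * m.dlog Ω w a := by
    intro a
    have h := congrArg (m.D a) hw
    simp only [Derivation.leibniz, smul_eq_mul, Derivation.map_one_eq_zero] at h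
    rw [dlog]
    linear_combination w * h - m.D a w * hw
  have h1 := m'.koszul k i j
  have h2 := m.koszul k i j
  have h3 : ∀ a b c, m'.D a (m'.g b c) = w * w * (m.D a (m.g b c) - 2 * m.dlog Ω w a * m.g b c) := by
    intro a b c
    rw [hD, hg, Derivation.leibniz, Derivation.leibniz, hDw]
    simp only [smul_eq_mul]; ring
  have hww : w * w * (Ω * Ω) = 1 := by linear_combination (w * Ω + 1) * hw
  have h4 : ∑ l, m'.G k l * (m'.D i (m'.g j l) + m'.D j (m'.g i l) - m'.D l (m'.g i j))
      = ∑ l, m.G k l * (m.D i (m.g j l) + m.D j (m.g i l) - m.D l (m.g i j))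
        - 2 * ((∑ l, m.G k l * m.g l j) * m.dlog Ω w i + (∑ l, m.G k l * m.g l i) * m.dlog Ω w j
          - m.g i j * m.up (m.dlog Ω w) k) := by
    have : ∀ l, m'.G k l * (m'.D i (m'.g j l) + m'.D j (m'.g i l) - m'.D l (m'.g i j))
        = m.G k l * (m.D i (m.g j l) + m.D j (m.g i l) - m.D l (m.g i j))
        - 2 * (m.G k l * m.g l j * m.dlog Ω w i + m.G k l * m.g l i * m.dlog Ω w j
          - m.g i j * (m.G k l * m.dlog Ω w l)) := by
      intro l
      rw [h3, h3, h3, hG, m.g_symm j l, m.g_symm i l]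
      linear_combination (m.G k l * (m.D i (m.g l j) + m.D j (m.g l i) - m.D l (m.g i j)
        - 2 * (m.g l j * m.dlog Ω w i + m.g l i * m.dlog Ω w j
          - m.g i j * m.dlog Ω w l))) * hww
    simp only [this, up, Fin.sum_univ_four]
    ring
  rw [h4, ← h2, m.G_g, m.G_g] at h1
  push_cast
  linear_combination h1

/-- Trace `riemUp_sub` for the difference tensor Q of `conformal_Γ`: t1 and t2 are its derivative
terms, t3 the quadratic ones. -/
lemma conformal_ric (hD : m'.D = m.D) (hg : ∀ a b, m'.g a b = w * w * m.g a b)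
    (hG : ∀ a b, m'.G a b = Ω * Ω * m.G a b) (hw : w * Ω = 1) (b d : Fin 4) :
    m'.ric b d = m.ric b d + 2 * m.cov1 (m.dlog Ω w) b d
      + m.g b d * (∑ a, m.covV (m.up (m.dlog Ω w)) a a)
      + 2 * m.dlog Ω w b * m.dlog Ω w d
      - 2 * m.g b d * ∑ a, m.dlog Ω w a * m.up (m.dlog Ω w) a := by
  have hΓ := conformal_Γ hD hg hG hw
  have hy : ∀ a, ∑ b, m.g a b * m.up (m.dlog Ω w) b = m.dlog Ω w a := m.sum_g_up _
  -- The form d log Ω is closed. After the `generalize` below this is all that is remembered of it.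
  have hsymm : m.cov1 (m.dlog Ω w) d b = m.cov1 (m.dlog Ω w) b d := by
    have e : m.dlog Ω w = fun a => w * m.D a Ω := rfl
    rw [e, m.cov1_mul, m.cov1_mul, m.cov1_D_symm Ω d b]
    have hDw : ∀ a, m.D a w = - w * (w * m.D a Ω) := by
      intro a
      have h := congrArg (m.D a) hw
      simp only [Derivation.leibniz, smul_eq_mul, Derivation.map_one_eq_zero] at h
      linear_combination w * h - m.D a w * hw
    rw [hDw, hDw]; ring
  generalize m.dlog Ω w = y at *
  obtain ⟨z, hz⟩ : ∃ z, z = m.up y := ⟨_, rfl⟩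
  rw [← hz] at hΓ hy ⊢
  obtain ⟨Q, hQ⟩ : ∃ Q : Fin 4 → Fin 4 → Fin 4 → A, ∀ k i j, Q k i j = m.g i j * z k
      - (if k = i then 1 else 0) * y j - (if k = j then 1 else 0) * y i := ⟨_, fun _ _ _ => rfl⟩
  have hR := riemUp_sub (Q := Q) hD (fun k i j => by rw [hΓ, hQ])
  have hgz : ∀ e, ∑ a, m.g e a * z a = y e := hy
  have hcov : ∀ a c b d, m.D a (Q c b d) + ∑ f, (m.Γ c a f * Q f b d - m.Γ f a b * Q c f d
        - m.Γ f a d * Q c b f)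
      = m.g b d * m.covV z a c - (if c = b then 1 else 0) * m.cov1 y a d
        - (if c = d then 1 else 0) * m.cov1 y a b := by
    intro a c b d
    have hif : ∀ p : Prop, ∀ _ : Decidable p, m.D a (if p then (1 : A) else 0) = 0 := by
      intro p _; split_ifs <;> simp
    have e1 : m.D a (Q c b d) = (∑ f, m.Γ f a b * m.g f d + ∑ f, m.Γ f a d * m.g b f) * z c
        + m.g b d * m.D a (z c) - (if c = b then 1 else 0) * m.D a (y d)
        - (if c = d then 1 else 0) * m.D a (y b) := by
      rw [hQ]
      simp only [map_sub, Derivation.leibniz, smul_eq_mul, compat, hif]; ring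
    have e2 : ∑ f, (m.Γ c a f * Q f b d - m.Γ f a b * Q c f d - m.Γ f a d * Q c b f)
        = m.g b d * (∑ f, m.Γ c a f * z f)
        - (∑ f, m.Γ f a b * m.g f d + ∑ f, m.Γ f a d * m.g b f) * z c
        + (if c = b then 1 else 0) * (∑ f, m.Γ f a d * y f)
        + (if c = d then 1 else 0) * (∑ f, m.Γ f a b * y f) := by
      have e3 : ∀ f, m.Γ c a f * Q f b d - m.Γ f a b * Q c f d - m.Γ f a d * Q c b f
          = m.g b d * (m.Γ c a f * z f) - (m.Γ f a b * m.g f d) * z c - (m.Γ f a d * m.g b f) * z c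
            + (if c = b then 1 else 0) * (m.Γ f a d * y f)
            + (if c = d then 1 else 0) * (m.Γ f a b * y f)
            - (if f = b then m.Γ c a f * y d else 0) - (if f = d then m.Γ c a f * y b else 0)
            + (if c = f then m.Γ f a b * y d else 0) + (if c = f then m.Γ f a d * y b else 0) := by
        intro f; rw [hQ, hQ, hQ]; split_ifs <;> ring
      simp only [e3, Finset.sum_add_distrib, Finset.sum_sub_distrib, Finset.sum_ite_eq,
        Finset.sum_ite_eq', Finset.mem_univ, if_true, ← Finset.mul_sum, ← Finset.sum_mul]
      rw [m.Γ_symm c a b, m.Γ_symm c a d]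
      ring
    rw [e1, e2, cov1, cov1, covV]; ring
  have t1 : ∑ a, (m.D a (Q a b d) + ∑ f, (m.Γ a a f * Q f b d - m.Γ f a b * Q a f d
        - m.Γ f a d * Q a b f))
      = m.g b d * ∑ a, m.covV z a a - 2 * m.cov1 y b d := by
    rw [Finset.sum_congr rfl fun a _ => hcov a a b d]
    simp only [Finset.sum_sub_distrib, ite_mul, one_mul, zero_mul, Finset.sum_ite_eq',
      Finset.mem_univ, if_true, ← Finset.mul_sum, hsymm]
    ring
  have t2 : ∑ a, (m.D b (Q a a d) + ∑ f, (m.Γ a b f * Q f a d - m.Γ f b a * Q a f d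
        - m.Γ f b d * Q a a f)) = - 4 * m.cov1 y b d := by
    rw [Finset.sum_congr rfl fun a _ => hcov b a a d]
    simp only [Finset.sum_sub_distrib, ite_mul, one_mul, zero_mul, Finset.sum_ite_eq',
      Finset.mem_univ, if_true]
    have : ∑ a, m.g a d * m.covV z b a = m.cov1 y b d := by
      rw [hz]
      simp only [covV_up, m.g_symm _ d, Finset.mul_sum]
      have := m.sum_g_up (fun k => m.cov1 y b k) d
      simpa only [up, Finset.mul_sum] using this
    rw [this]
    simp
  have t3 : ∑ a, ∑ e, (Q a a e * Q e b d - Q a b e * Q e a d)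
      = 2 * y b * y d - 2 * m.g b d * ∑ a, y a * z a := by
    have q1 : ∀ e, ∑ a, Q a a e = - 4 * y e := by
      intro e
      simp only [hQ, Finset.sum_sub_distrib, m.g_symm _ e, hgz]
      simp
    have q2 : ∑ a, ∑ e, Q a a e * Q e b d = ∑ e, (- 4 * y e) * Q e b d := by
      rw [Finset.sum_comm]; simp only [← Finset.sum_mul, q1]
    have q3 : ∑ e, y e * Q e b d = m.g b d * (∑ a, y a * z a) - 2 * y b * y d := by
      have : ∀ e, y e * Q e b d = m.g b d * (y e * z e) - (if e = b then y e * y d else 0)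
          - (if e = d then y e * y b else 0) := by
        intro e; rw [hQ]; split_ifs <;> ring
      simp only [this, Finset.sum_sub_distrib, Finset.sum_ite_eq', Finset.mem_univ, if_true,
        ← Finset.mul_sum]
      ring
    have q4 : ∑ a, ∑ e, Q a b e * Q e a d = 6 * y b * y d - 2 * m.g b d * ∑ a, y a * z a := by
      have r1 : ∀ a, ∑ e, Q a b e * Q e a d = ∑ e, (m.g b e * z a * Q e a d)
          - (if a = b then ∑ e, y e * Q e a d else 0) - y b * Q a a d := by
        intro a
        have : ∀ e, Q a b e * Q e a d = m.g b e * z a * Q e a d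
          - (if a = b then y e * Q e a d else 0) - (if a = e then y b * Q e a d else 0) := by
          intro e; rw [hQ a b e]; split_ifs <;> ring
        simp only [this, Finset.sum_sub_distrib, Finset.sum_ite_eq, Finset.mem_univ, if_true]
        congr 2
        split_ifs <;> simp
      have r2 : ∀ a, ∑ e, (m.g b e * z a * Q e a d) = m.g a d * z a * y b
          - m.g b a * z a * y d - m.g b d * (y a * z a) := by
        intro a
        have : ∀ e, m.g b e * z a * Q e a d = m.g a d * z a * (m.g b e * z e)
            - (if e = a then m.g b e * z a * y d else 0)
            - (if e = d then m.g b e * (y a * z a) else 0) := by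
          intro e; rw [hQ]; split_ifs <;> ring
        simp only [this, Finset.sum_sub_distrib, Finset.sum_ite_eq', Finset.mem_univ, if_true,
          ← Finset.mul_sum, hgz]
      have r3 : ∑ a, m.g a d * z a = y d := by simp only [m.g_symm _ d, hgz]
      simp only [r1, r2, Finset.sum_sub_distrib, Finset.sum_ite_eq', Finset.mem_univ, if_true,
        ← Finset.mul_sum, ← Finset.sum_mul, q1, q3, hgz, r3]
      ring
    simp only [Finset.sum_sub_distrib]
    rw [q2, q4]
    simp only [mul_assoc, ← Finset.mul_sum, q3]
    ring
  have hfin : m'.ric b d = m.ric b d + ∑ a, (m.D a (Q a b d)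
        + ∑ f, (m.Γ a a f * Q f b d - m.Γ f a b * Q a f d - m.Γ f a d * Q a b f))
      - ∑ a, (m.D b (Q a a d) + ∑ f, (m.Γ a b f * Q f a d - m.Γ f b a * Q a f d
        - m.Γ f b d * Q a a f))
      + ∑ a, ∑ e, (Q a a e * Q e b d - Q a b e * Q e a d) := by
    simp only [ric, hR, Finset.sum_add_distrib, Finset.sum_sub_distrib]
  rw [hfin, t1, t2, t3]
  ring

lemma conformal_ric' (hD : m'.D = m.D) (hg : ∀ a b, m'.g a b = w * w * m.g a b)
    (hG : ∀ a b, m'.G a b = Ω * Ω * m.G a b) (hw : w * Ω = 1) (b d : Fin 4) :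
    m'.ric b d = m.ric b d + 2 * w * m.cov1 (fun i => m.D i Ω) b d
      + m.g b d * (w * m.tr (m.cov1 fun i => m.D i Ω)
        - 3 * w * w * ∑ a, m.D a Ω * m.up (fun i => m.D i Ω) a) := by
  have hDw : ∀ a, m.D a w = - w * (w * m.D a Ω) := by
    intro a
    have h := congrArg (m.D a) hw
    simp only [Derivation.leibniz, smul_eq_mul, Derivation.map_one_eq_zero] at h
    linear_combination w * h - m.D a w * hw
  have e : m.dlog Ω w = fun a => w * m.D a Ω := rfl
  have hup : ∀ a, m.up (fun i => w * m.D i Ω) a = w * m.up (fun i => m.D i Ω) a := by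
    intro a; simp only [up, Finset.mul_sum]; exact Finset.sum_congr rfl fun _ _ => by ring
  have hcov : ∑ a, m.covV (m.up fun i => w * m.D i Ω) a a
      = w * m.tr (m.cov1 fun i => m.D i Ω)
        - w * w * ∑ a, m.D a Ω * m.up (fun i => m.D i Ω) a := by
    simp only [covV_up, m.cov1_mul, hDw, tr, up, Fin.sum_univ_four]; ring
  rw [conformal_ric hD hg hG hw, e, hcov, m.cov1_mul, hDw]
  simp only [hup, Fin.sum_univ_four]; ring

lemma conformal_scal (hD : m'.D = m.D) (hg : ∀ a b, m'.g a b = w * w * m.g a b)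
    (hG : ∀ a b, m'.G a b = Ω * Ω * m.G a b) (hw : w * Ω = 1) :
    m'.scal = 6 * Ω * Ω * m.J + 6 * Ω * m.tr (m.cov1 fun i => m.D i Ω)
      - 12 * ∑ a, m.D a Ω * m.up (fun i => m.D i Ω) a := by
  have h4 := m.tr_g
  have hJ := m.scal_eq
  have h1 : m'.scal = Ω * Ω * (m.scal + 2 * w * m.tr (m.cov1 fun i => m.D i Ω)
      + m.tr m.g * (w * m.tr (m.cov1 fun i => m.D i Ω)
        - 3 * w * w * ∑ a, m.D a Ω * m.up (fun i => m.D i Ω) a)) := by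
    rw [scal, scal]
    generalize hX : (w * m.tr (m.cov1 fun i => m.D i Ω)
        - 3 * w * w * ∑ a, m.D a Ω * m.up (fun i => m.D i Ω) a) = X
    have h := conformal_ric' hD hg hG hw
    rw [hX] at h
    simp only [tr, hG, h, Finset.mul_sum, Finset.sum_mul, ← Finset.sum_add_distrib]
    exact Finset.sum_congr rfl fun _ _ => Finset.sum_congr rfl fun _ _ => by ring
  rw [h1, h4, hJ]
  linear_combination (6 * Ω * m.tr (m.cov1 fun i => m.D i Ω)
    - 12 * (w * Ω + 1) * ∑ a, m.D a Ω * m.up (fun i => m.D i Ω) a) * hw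

/-- The conformal form of the Einstein equations with stress-energy tensor `Ω^q T`. -/
lemma hess_and_norm_of_einstein (hD : m'.D = m.D) (hg : ∀ a b, m'.g a b = w * w * m.g a b)
    (hG : ∀ a b, m'.G a b = Ω * Ω * m.G a b) (hw : w * Ω = 1) {lam : A} {q : ℕ}
    {T : Fin 4 → Fin 4 → A} {ρ : A}
    (hρ : 4 * ρ = - (m.tr (m.cov1 fun i => m.D i Ω) + m.J * Ω))
    (hE : ∀ a b, 2 * m'.ric a b - m'.scal * m'.g a b + 6 * lam * m'.g a b
      = 2 * (Ω ^ q * T a b)) :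
    (∀ a b, 8 * (m.cov1 (fun i => m.D i Ω) a b + Ω * m.P a b + ρ * m.g a b)
      = Ω ^ (q + 1) * (4 * T a b - m.tr T * m.g a b)) ∧
    12 * (∑ a, m.D a Ω * m.up (fun i => m.D i Ω) a + lam + 2 * Ω * ρ) = Ω ^ (q + 2) * m.tr T := by
  have h4 := m'.tr_g
  -- The trace of the Einstein equations. Raising an index with the physical metric costs Ω², which
  -- turns Ω^q into Ω^{q+2}.
  have htr : 2 * m'.scal - (m'.scal - 6 * lam) * 4 = 2 * (Ω ^ (q + 2) * m.tr T) := by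
    have h1 : ∀ k l : A, ∑ a, ∑ b, m'.G a b * (2 * m'.ric a b - k * m'.g a b + l * m'.g a b)
        = 2 * m'.scal - (k - l) * m'.tr m'.g := by
      intro k l
      simp only [scal, tr, Finset.mul_sum, ← Finset.sum_sub_distrib]
      exact Finset.sum_congr rfl fun _ _ => Finset.sum_congr rfl fun _ _ => by ring
    rw [← h4, ← h1]
    simp only [hE, hG, tr, Finset.mul_sum]
    exact Finset.sum_congr rfl fun _ _ => Finset.sum_congr rfl fun _ _ => by ring
  have hs := conformal_scal hD hg hG hw
  have hN : 12 * (∑ a, m.D a Ω * m.up (fun i => m.D i Ω) a + lam + 2 * Ω * ρ)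
      = Ω ^ (q + 2) * m.tr T := by
    apply natCast_mul_cancel 2
    push_cast
    linear_combination htr + 2 * hs + 12 * Ω * hρ
  refine ⟨fun a b => ?_, hN⟩
  have hr := conformal_ric' hD hg hG hw a b
  have hP := m.ric_eq_P a b
  have h := hE a b
  rw [hr, hg, hP] at h
  generalize ∑ a, m.D a Ω * m.up (fun i => m.D i Ω) a = N at *
  generalize m.tr (m.cov1 fun i => m.D i Ω) = S at *
  linear_combination 2 * Ω * h - (8 * m.cov1 (fun i => m.D i Ω) a b + 4 * m.g a b * S
    + w * (-12 * N - 2 * m'.scal + 12 * lam) * m.g a b - 12 * Ω * m.J * m.g a b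
    - 12 * S * m.g a b - 24 * ρ * m.g a b + Ω ^ (q + 1) * m.tr T * m.g a b) * hw
    + 2 * w * m.g a b * hs - w * m.g a b * hN + 8 * m.g a b * hρ

/-- The converse direction in vacuum, needed for the examples. -/
lemma conformal_ric_of_hess (hD : m'.D = m.D) (hg : ∀ a b, m'.g a b = w * w * m.g a b)
    (hG : ∀ a b, m'.G a b = Ω * Ω * m.G a b) (hw : w * Ω = 1) {lam ρ : A}
    (hρ : 4 * ρ = - (m.tr (m.cov1 fun i => m.D i Ω) + m.J * Ω))
    (hE : ∀ a b, m.cov1 (fun i => m.D i Ω) a b + Ω * m.P a b + ρ * m.g a b = 0)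
    (hN : ∑ a, m.D a Ω * m.up (fun i => m.D i Ω) a + lam + 2 * Ω * ρ = 0) (a b : Fin 4) :
    m'.ric a b = 3 * lam * m'.g a b := by
  rw [conformal_ric' hD hg hG hw a b, hg, m.ric_eq_P]
  linear_combination 2 * w * hE a b + w * m.g a b * hρ - 3 * w * w * m.g a b * hN
    + (6 * w * ρ * m.g a b - m.J * m.g a b - 2 * m.P a b) * hw

end Conformal
end MetricRing
end ConformalInfinity

/-! ### The ring of smooth functions on a relatively open part of the half-space -/

namespace ConformalInfinity

/-- A relatively open subset of the half-space. -/
def IsRelOpen (U : Set (Coord 4)) : Prop := ∃ O, IsOpen O ∧ U = halfSpace ∩ O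

namespace IsRelOpen

variable {U : Set (Coord 4)} (hU : IsRelOpen U)
include hU

lemma subset : U ⊆ halfSpace := by
  obtain ⟨O, _, rfl⟩ := hU; exact inter_subset_left

lemma mem_nhdsWithin {y : Coord 4} (hy : y ∈ U) : U ∈ 𝓝[halfSpace] y := by
  obtain ⟨O, hO, rfl⟩ := hU
  exact Filter.inter_mem self_mem_nhdsWithin (mem_nhdsWithin_of_mem_nhds (hO.mem_nhds hy.2))

lemma uniqueDiffOn : UniqueDiffOn ℝ U := by
  obtain ⟨O, hO, rfl⟩ := hU
  exact (𝓡∂ 4).uniqueDiffOn.inter hO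

lemma fderivWithin_eq {F : Coord 4 → ℝ} {y : Coord 4} (hy : y ∈ U) :
    fderivWithin ℝ F halfSpace y = fderivWithin ℝ F U y := by
  obtain ⟨O, hO, rfl⟩ := hU
  exact (fderivWithin_inter (hO.mem_nhds hy.2)).symm

/-- Needed for the symmetry of second derivatives at boundary points, and for extending equations
from the interior. -/
lemma mem_closure_interior {y : Coord 4} (hy : y ∈ U) : y ∈ closure (interior U) := by
  obtain ⟨O, hO, rfl⟩ := hU
  rw [interior_inter, hO.interior_eq, inter_comm]
  exact hO.inter_closure ⟨hy.2, (𝓡∂ 4).range_subset_closure_interior hy.1⟩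

end IsRelOpen

/-- extension by zero -/
def extendZero {U : Set (Coord 4)} (f : U → ℝ) : Coord 4 → ℝ := Function.extend Subtype.val f 0

lemma extendZero_apply {U : Set (Coord 4)} (f : U → ℝ) {y : Coord 4} (hy : y ∈ U) :
    extendZero f y = f ⟨y, hy⟩ :=
  Subtype.val_injective.extend_apply f 0 ⟨y, hy⟩

/-- The ring of smooth functions on a subset of the space of coordinates. -/
def SmoothFn (U : Set (Coord 4)) : Subalgebra ℝ (U → ℝ) where
  carrier := {f | ContDiffOn ℝ ∞ (extendZero f) U}
  mul_mem' {f g} hf hg := (hf.mul hg).congr fun y hy => by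
    simp only [extendZero_apply _ hy, Pi.mul_apply]
  add_mem' {f g} hf hg := (hf.add hg).congr fun y hy => by
    simp only [extendZero_apply _ hy, Pi.add_apply]
  algebraMap_mem' r := (contDiffOn_const (c := r)).congr fun y hy => by
    simp [extendZero_apply _ hy]

namespace SmoothFn

variable {U : Set (Coord 4)}

/-- A smooth function on `U`. -/
def mk (F : Coord 4 → ℝ) (hF : ContDiffOn ℝ ∞ F U) : SmoothFn U :=
  ⟨fun y => F y, hF.congr fun y hy => by rw [extendZero_apply _ hy]⟩

/-- evaluation at a point -/
def ev (y : U) : SmoothFn U →ₐ[ℝ] ℝ := (Pi.evalAlgHom ℝ (fun _ : U => ℝ) y).comp (SmoothFn U).val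

lemma ext_ev {f g : SmoothFn U} (h : ∀ y, ev y f = ev y g) : f = g :=
  Subtype.ext (funext h)

/-- `F` restricts to the element `f` of the ring of smooth functions on `U`. -/
def IsRep (F : Coord 4 → ℝ) (f : SmoothFn U) : Prop := ∀ y : U, F y = ev y f

lemma isRep_mk (F : Coord 4 → ℝ) (hF : ContDiffOn ℝ ∞ F U) : IsRep F (mk F hF) := fun _ => rfl

lemma isRep_extendZero (f : SmoothFn U) : IsRep (extendZero f.1) f :=
  fun y => extendZero_apply f.1 y.2

lemma IsRep.contDiffOn {F : Coord 4 → ℝ} {f : SmoothFn U} (h : IsRep F f) :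
    ContDiffOn ℝ ∞ F U :=
  f.2.congr fun y hy => by rw [extendZero_apply _ hy]; exact h ⟨y, hy⟩

lemma IsRep.eq {F : Coord 4 → ℝ} {f : SmoothFn U} (h : IsRep F f) {y : Coord 4} (hy : y ∈ U) :
    F y = ev ⟨y, hy⟩ f := h ⟨y, hy⟩

/-- partial derivative -/
def partialD (hU : IsRelOpen U) (i : Fin 4) : Derivation ℝ (SmoothFn U) (SmoothFn U) :=
  have hd : ∀ (f : SmoothFn U) (y : U), DifferentiableWithinAt ℝ (extendZero f.1) halfSpace y :=
    fun f y => by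
      have := (f.2.differentiableOn (by simp)) y y.2
      exact this.mono_of_mem_nhdsWithin (hU.mem_nhdsWithin y.2)
  have hu : ∀ y : U, UniqueDiffWithinAt ℝ halfSpace (y : Coord 4) :=
    fun y => (𝓡∂ 4).uniqueDiffOn _ (hU.subset y.2)
  have hc : ∀ {F G : Coord 4 → ℝ} (y : U), (∀ z ∈ U, F z = G z) →
      fderivWithin ℝ F halfSpace (y : Coord 4) = fderivWithin ℝ G halfSpace (y : Coord 4) :=
    fun y h => Filter.EventuallyEq.fderivWithin_eq
      (Filter.eventually_of_mem (hU.mem_nhdsWithin y.2) h) (h y y.2)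
  Derivation.mk'
    { toFun := fun f => mk (fun y => pderiv halfSpace (extendZero f.1) y i) (by
        have h1 : ContDiffOn ℝ ∞ (fderivWithin ℝ (extendZero f.1) U) U :=
          f.2.fderivWithin hU.uniqueDiffOn (by simp)
        have h2 := h1.clm_apply (contDiffOn_const (c := EuclideanSpace.single i (1 : ℝ)))
        exact h2.congr fun y hy => by rw [pderiv, hU.fderivWithin_eq hy])
      map_add' := fun f g => ext_ev fun y => by
        change fderivWithin ℝ (extendZero (f.1 + g.1)) halfSpace y _
          = fderivWithin ℝ (extendZero f.1) halfSpace y _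
            + fderivWithin ℝ (extendZero g.1) halfSpace y _
        rw [hc (G := extendZero f.1 + extendZero g.1) y fun z hz => by
          simp [extendZero_apply _ hz], fderivWithin_add (hu y) (hd f y) (hd g y)]
        rfl
      map_smul' := fun r f => ext_ev fun y => by
        change fderivWithin ℝ (extendZero (r • f.1)) halfSpace y _
          = r * fderivWithin ℝ (extendZero f.1) halfSpace y _
        rw [hc (G := r • extendZero f.1) y fun z hz => by
          simp [extendZero_apply _ hz], fderivWithin_const_smul (hu y) (hd f y)]
        rfl }
    (fun f g => ext_ev fun y => by
      change fderivWithin ℝ (extendZero (f.1 * g.1)) halfSpace y _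
        = f.1 y * fderivWithin ℝ (extendZero g.1) halfSpace y _
          + g.1 y * fderivWithin ℝ (extendZero f.1) halfSpace y _
      rw [hc (G := extendZero f.1 * extendZero g.1) y fun z hz => by
        simp [extendZero_apply _ hz], fderivWithin_mul (hu y) (hd f y) (hd g y)]
      simp [extendZero_apply _ y.2])

lemma IsRep.pderiv (hU : IsRelOpen U) {F : Coord 4 → ℝ} {f : SmoothFn U} (h : IsRep F f)
    (i : Fin 4) : IsRep (fun y => pderiv halfSpace F y i) (partialD hU i f) := fun y => by
  change fderivWithin ℝ F halfSpace y _ = fderivWithin ℝ (extendZero f.1) halfSpace y _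
  rw [Filter.EventuallyEq.fderivWithin_eq (Filter.eventually_of_mem (hU.mem_nhdsWithin y.2)
    fun z hz => (h.eq hz).trans (isRep_extendZero f ⟨z, hz⟩).symm)
    ((h y).trans (isRep_extendZero f y).symm)]

/-- The symmetry of second derivatives within a set holds at points in the closure of its interior,
hence also on the boundary. -/
lemma partialD_comm (hU : IsRelOpen U) (i j : Fin 4) (f : SmoothFn U) :
    partialD hU i (partialD hU j f) = partialD hU j (partialD hU i f) := by
  have key : ∀ i j (y : U), ev y (partialD hU i (partialD hU j f))
      = fderivWithin ℝ (fderivWithin ℝ (extendZero f.1) U) U y (EuclideanSpace.single i 1)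
        (EuclideanSpace.single j 1) := by
    intro i j y
    have h1 := ((isRep_extendZero f).pderiv hU j).pderiv hU i y
    rw [← h1]
    change fderivWithin ℝ (fun y => ConformalInfinity.pderiv halfSpace (extendZero f.1) y j)
      halfSpace y _ = _
    rw [hU.fderivWithin_eq y.2]
    have h2 : DifferentiableWithinAt ℝ (fderivWithin ℝ (extendZero f.1) U) U y :=
      ((f.2.fderivWithin hU.uniqueDiffOn (m := ∞) (by simp)).differentiableOn (by simp)) y y.2
    have h3 : fderivWithin ℝ (fun y => ConformalInfinity.pderiv halfSpace (extendZero f.1) y j) U y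
        = fderivWithin ℝ (fun y => fderivWithin ℝ (extendZero f.1) U y
          (EuclideanSpace.single j 1)) U y :=
      fderivWithin_congr (fun z hz => by rw [ConformalInfinity.pderiv, hU.fderivWithin_eq hz])
        (by rw [ConformalInfinity.pderiv, hU.fderivWithin_eq y.2])
    rw [h3, fderivWithin_clm_apply (hU.uniqueDiffOn y y.2) h2 (differentiableWithinAt_const _)]
    simp
  refine ext_ev fun y => ?_
  rw [key, key]
  have hsym : IsSymmSndFDerivWithinAt ℝ (extendZero f.1) U y :=
    (f.2 y y.2).isSymmSndFDerivWithinAt (by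
      simpa [minSmoothness] using WithTop.coe_le_coe.2 (le_top (a := (2 : ℕ∞)))) hU.uniqueDiffOn
      (hU.mem_closure_interior y.2) y.2
  exact hsym _ _

section Rep

variable {F F' : Coord 4 → ℝ} {f f' : SmoothFn U}

lemma IsRep.add (h : IsRep F f) (h' : IsRep F' f') : IsRep (fun y => F y + F' y) (f + f') :=
  fun y => by rw [map_add, ← h y, ← h' y]

lemma IsRep.sub (h : IsRep F f) (h' : IsRep F' f') : IsRep (fun y => F y - F' y) (f - f') :=
  fun y => by rw [map_sub, ← h y, ← h' y]

lemma IsRep.mul (h : IsRep F f) (h' : IsRep F' f') : IsRep (fun y => F y * F' y) (f * f') :=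
  fun y => by rw [map_mul, ← h y, ← h' y]

lemma IsRep.const_mul (r : ℝ) (h : IsRep F f) : IsRep (fun y => r * F y) (r • f) :=
  fun y => by rw [map_smul, ← h y, smul_eq_mul]

lemma IsRep.sum {ι : Type*} (s : Finset ι) {F : ι → Coord 4 → ℝ} {f : ι → SmoothFn U}
    (h : ∀ i, IsRep (F i) (f i)) : IsRep (fun y => ∑ i ∈ s, F i y) (∑ i ∈ s, f i) :=
  fun y => by rw [map_sum]; exact Finset.sum_congr rfl fun i _ => h i y

lemma IsRep.unique {f' : SmoothFn U} (h : IsRep F f) (h' : IsRep F f') : f = f' :=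
  ext_ev fun y => (h y).symm.trans (h' y)

end Rep

end SmoothFn
end ConformalInfinity

/-! ### The metric ring of a smooth metric -/

namespace ConformalInfinity

/-- The Levi-Civita connection of a metric in a ring with commuting derivations. -/
def MetricRing.ofMetric {A : Type*} [CommRing A] [Algebra ℝ A] (D : Fin 4 → Derivation ℝ A A)
    (D_comm : ∀ i j f, D i (D j f) = D j (D i f)) (g G : Fin 4 → Fin 4 → A)
    (g_symm : ∀ a b, g a b = g b a) (G_symm : ∀ a b, G a b = G b a)
    (G_g : ∀ a b, ∑ c, G a c * g c b = if a = b then 1 else 0) : MetricRing A where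
  D := D
  D_comm := D_comm
  g := g
  G := G
  Γ k i j := (1 / 2 : ℝ) • ∑ l, G k l * (D i (g j l) + D j (g i l) - D l (g i j))
  g_symm := g_symm
  G_symm := G_symm
  G_g := G_g
  Γ_symm k i j := by
    congr 1; refine Finset.sum_congr rfl fun l _ => ?_
    rw [g_symm i j]; ring
  compat c a b := by
    have hg : ∀ a b, ∑ c, g a c * G c b = if a = b then 1 else 0 := fun a b => by
      simpa only [g_symm a, G_symm _ b, mul_comm, eq_comm] using G_g b a
    have h : ∀ (X : Fin 4 → A) b, ∑ d, (((1 / 2 : ℝ) • ∑ l, G d l * X l) * g d b)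
        = (1 / 2 : ℝ) • X b := by
      intro X b
      have : ∑ d, (∑ l, G d l * X l) * g d b = X b := by
        simp only [Finset.sum_mul]
        rw [Finset.sum_comm]
        have : ∀ l, ∑ d, G d l * X l * g d b = (if b = l then 1 else 0) * X l := by
          intro l
          rw [← hg b l, Finset.sum_mul]
          exact Finset.sum_congr rfl fun d _ => by rw [g_symm b d]; ring
        simp [this]
      rw [← this, Finset.smul_sum]
      exact Finset.sum_congr rfl fun d _ => smul_mul_assoc _ _ _
    have h' := h (fun l => D c (g b l) + D b (g c l) - D l (g c b)) a
    simp only [g_symm _ a] at h'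
    rw [h (fun l => D c (g a l) + D a (g c l) - D l (g c a)) b, h', ← smul_add]
    rw [show D c (g a b) + D a (g c b) - D b (g c a) + (D c (g a b) + D b (g a c)
      - D a (g c b)) = (2 : ℝ) • D c (g a b) by rw [g_symm a c, two_smul]; abel, smul_smul]
    norm_num

/-- A smooth metric on a relatively open subset of the half-space. -/
structure IsSmoothMetric (U : Set (Coord 4)) (g : Tensor2 4) : Prop where
  isRelOpen : IsRelOpen U
  smooth : ∀ a b, ContDiffOn ℝ ∞ (fun y => g y a b) U
  symm : ∀ y ∈ U, ∀ a b, g y a b = g y b a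
  det_ne_zero : ∀ y ∈ U, (Matrix.of (g y)).det ≠ 0

lemma contDiffOn_det {U : Set (Coord 4)} {M : Coord 4 → Matrix (Fin 4) (Fin 4) ℝ}
    (h : ∀ a b, ContDiffOn ℝ ∞ (fun y => M y a b) U) :
    ContDiffOn ℝ ∞ (fun y => (M y).det) U := by
  simp only [Matrix.det_apply]
  exact ContDiffOn.sum fun σ _ => (contDiffOn_prod fun i _ => h _ _).const_smul _

namespace IsSmoothMetric

open SmoothFn

variable {U : Set (Coord 4)} {g : Tensor2 4} (h : IsSmoothMetric U g)
include h

/-- Cramer's rule: the entries are quotients of determinants, which are polynomials in the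
components. -/
lemma smooth_invMetric (a b : Fin 4) : ContDiffOn ℝ ∞ (fun y => invMetric g y a b) U := by
  have h1 : ∀ y, invMetric g y a b
      = ((Matrix.of (g y)).det)⁻¹ * ((Matrix.of (g y)).updateRow b (Pi.single a 1)).det := by
    intro y
    rw [invMetric, Matrix.inv_def, Matrix.smul_apply, Matrix.adjugate_apply, smul_eq_mul,
      Ring.inverse_eq_inv']
  simp only [h1]
  refine ((contDiffOn_det h.smooth).inv h.det_ne_zero).mul (contDiffOn_det fun i j => ?_)
  by_cases hi : i = b
  · subst hi
    simpa using contDiffOn_const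
  · simpa [Matrix.updateRow_ne hi] using h.smooth i j

lemma invMetric_mul {y : Coord 4} (hy : y ∈ U) (a b : Fin 4) :
    ∑ c, invMetric g y a c * g y c b = if a = b then 1 else 0 := by
  have := congrFun (congrFun (Matrix.nonsing_inv_mul (Matrix.of (g y))
    (isUnit_iff_ne_zero.mpr (h.det_ne_zero y hy))) a) b
  rw [Matrix.mul_apply, Matrix.one_apply] at this
  exact this

lemma invMetric_symm {y : Coord 4} (hy : y ∈ U) (a b : Fin 4) :
    invMetric g y a b = invMetric g y b a := by
  have h1 : (Matrix.of (g y)).transpose = Matrix.of (g y) := by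
    ext i j; exact h.symm y hy j i
  have h2 : ((Matrix.of (g y))⁻¹).transpose = (Matrix.of (g y))⁻¹ := by
    rw [Matrix.transpose_nonsing_inv, h1]
  exact congrFun (congrFun h2 b) a

/-- The ring of smooth functions with the Levi-Civita connection of the metric. -/
def ring : MetricRing (SmoothFn U) :=
  MetricRing.ofMetric (partialD h.isRelOpen) (partialD_comm h.isRelOpen)
    (fun a b => SmoothFn.mk _ (h.smooth a b)) (fun a b => SmoothFn.mk _ (h.smooth_invMetric a b))
    (fun a b => ext_ev fun y => h.symm y y.2 a b)
    (fun a b => ext_ev fun y => h.invMetric_symm y.2 a b)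
    (fun a b => ext_ev fun y => by
      simp only [map_sum, map_mul, apply_ite (ev y), map_one, map_zero]
      exact h.invMetric_mul y.2 a b)

lemma ring_D : h.ring.D = partialD h.isRelOpen := rfl

lemma isRep_pderiv {F : Coord 4 → ℝ} {f : SmoothFn U} (hF : IsRep F f) (i : Fin 4) :
    IsRep (fun y => pderiv halfSpace F y i) (h.ring.D i f) := hF.pderiv h.isRelOpen i

lemma isRep_g (a b : Fin 4) : IsRep (fun y => g y a b) (h.ring.g a b) := fun _ => rfl

lemma isRep_G (a b : Fin 4) : IsRep (fun y => invMetric g y a b) (h.ring.G a b) := fun _ => rfl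

lemma isRep_christoffel (k i j : Fin 4) :
    IsRep (fun y => christoffel halfSpace g y k i j) (h.ring.Γ k i j) :=
  IsRep.const_mul _ <| IsRep.sum _ fun l => (h.isRep_G k l).mul <|
    ((h.isRep_pderiv (h.isRep_g j l) i).add (h.isRep_pderiv (h.isRep_g i l) j)).sub
      (h.isRep_pderiv (h.isRep_g i j) l)

section Tensors

variable {t : Tensor1 4} {t' : Fin 4 → SmoothFn U} (ht : ∀ a, IsRep (fun y => t y a) (t' a))
variable {r : Tensor2 4} {r' : Fin 4 → Fin 4 → SmoothFn U}
  (hr : ∀ a b, IsRep (fun y => r y a b) (r' a b))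
variable {s : Tensor3 4} {s' : Fin 4 → Fin 4 → Fin 4 → SmoothFn U}
  (hs : ∀ a b c, IsRep (fun y => s y a b c) (s' a b c))

include ht in
lemma isRep_cov1 (c a : Fin 4) :
    IsRep (fun y => cov1 halfSpace g t y c a) (h.ring.cov1 t' c a) :=
  (h.isRep_pderiv (ht a) c).sub <| IsRep.sum _ fun d => (h.isRep_christoffel d c a).mul (ht d)

include hr in
lemma isRep_cov2 (c a b : Fin 4) :
    IsRep (fun y => cov2 halfSpace g r y c a b) (h.ring.cov2 r' c a b) :=
  ((h.isRep_pderiv (hr a b) c).sub <| IsRep.sum _ fun d =>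
    (h.isRep_christoffel d c a).mul (hr d b)).sub <| IsRep.sum _ fun d =>
    (h.isRep_christoffel d c b).mul (hr a d)

include hs in
lemma isRep_cov3 (e a b c : Fin 4) :
    IsRep (fun y => cov3 halfSpace g s y e a b c) (h.ring.cov3 s' e a b c) :=
  (((h.isRep_pderiv (hs a b c) e).sub <| IsRep.sum _ fun d =>
    (h.isRep_christoffel d e a).mul (hs d b c)).sub <| IsRep.sum _ fun d =>
    (h.isRep_christoffel d e b).mul (hs a d c)).sub <| IsRep.sum _ fun d =>
    (h.isRep_christoffel d e c).mul (hs a b d)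

include hr in
lemma isRep_trace2 : IsRep (fun y => trace2 g r y) (h.ring.tr r') :=
  IsRep.sum _ fun a => IsRep.sum _ fun b => (h.isRep_G a b).mul (hr a b)

include ht in
lemma isRep_up (a : Fin 4) :
    IsRep (fun y => ∑ b, invMetric g y a b * t y b) (h.ring.up t' a) :=
  IsRep.sum _ fun b => (h.isRep_G a b).mul (ht b)

include hr in
lemma isRep_div2 (a : Fin 4) :
    IsRep (fun y => div2 halfSpace g r y a) (h.ring.div2 r' a) :=
  IsRep.sum _ fun b => IsRep.sum _ fun c => (h.isRep_G b c).mul (h.isRep_cov2 hr b a c)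

end Tensors

lemma isRep_riemannUp (a b c d : Fin 4) :
    IsRep (fun y => riemannUp halfSpace g y a b c d) (h.ring.riemUp a b c d) :=
  ((h.isRep_pderiv (h.isRep_christoffel c b d) a).sub
    (h.isRep_pderiv (h.isRep_christoffel c a d) b)).add <| IsRep.sum _ fun e =>
    ((h.isRep_christoffel c a e).mul (h.isRep_christoffel e b d)).sub
      ((h.isRep_christoffel c b e).mul (h.isRep_christoffel e a d))

lemma isRep_riemann (a b c d : Fin 4) :
    IsRep (fun y => riemann halfSpace g y a b c d) (h.ring.riem a b c d) :=
  IsRep.sum _ fun e => (h.isRep_g c e).mul (h.isRep_riemannUp a b e d)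

lemma isRep_ricci (b d : Fin 4) :
    IsRep (fun y => ricci halfSpace g y b d) (h.ring.ric b d) :=
  IsRep.sum _ fun a => h.isRep_riemannUp a b a d

lemma isRep_scalarCurv : IsRep (fun y => scalarCurv halfSpace g y) h.ring.scal :=
  h.isRep_trace2 h.isRep_ricci

lemma isRep_schouten (a b : Fin 4) :
    IsRep (fun y => schouten halfSpace g y a b) (h.ring.P a b) := fun y => by
  rw [MetricRing.P, map_smul, map_sub, map_smul, map_mul, ← h.isRep_ricci a b y,
    ← h.isRep_scalarCurv y, ← h.isRep_g a b y]
  simp only [schouten, smul_eq_mul]; push_cast; ring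

lemma isRep_schoutenTrace : IsRep (fun y => schoutenTrace halfSpace g y) h.ring.J :=
  h.isRep_trace2 h.isRep_schouten

lemma isRep_weyl (a b c d : Fin 4) :
    IsRep (fun y => weyl halfSpace g y a b c d) (h.ring.weyl a b c d) :=
  (h.isRep_riemann a b c d).sub <|
    ((((h.isRep_g c a).mul (h.isRep_schouten b d)).sub
      ((h.isRep_g c b).mul (h.isRep_schouten a d))).add
      ((h.isRep_g d b).mul (h.isRep_schouten a c))).sub
      ((h.isRep_g d a).mul (h.isRep_schouten b c))

lemma isRep_cotton (a b c : Fin 4) :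
    IsRep (fun y => cotton halfSpace g y a b c) (h.ring.cotton a b c) :=
  (h.isRep_cov2 h.isRep_schouten b c a).sub (h.isRep_cov2 h.isRep_schouten c b a)

end IsSmoothMetric
end ConformalInfinity

/-! ### The Einstein equations up to the boundary -/

namespace ConformalInfinity

lemma mem_halfSpace {y : Coord 4} : y ∈ halfSpace ↔ 0 ≤ y 0 := by
  rw [halfSpace, range_modelWithCornersEuclideanHalfSpace]; rfl

lemma IsRelOpen.inter {U : Set (Coord 4)} (hU : IsRelOpen U) {O : Set (Coord 4)} (hO : IsOpen O) :
    IsRelOpen (U ∩ O) := by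
  obtain ⟨O', hO', rfl⟩ := hU
  exact ⟨O' ∩ O, hO'.inter hO, by rw [inter_assoc]⟩

lemma isOpen_pos : IsOpen {y : Coord 4 | 0 < y 0} :=
  isOpen_lt continuous_const (by fun_prop)

/-- The points with x⁰ > 0 are dense, so continuity determines an element on the boundary. -/
lemma SmoothFn.ext_pos {U : Set (Coord 4)} (hU : IsRelOpen U) {f f' : SmoothFn U}
    (h : ∀ y : U, 0 < (y : Coord 4) 0 → SmoothFn.ev y f = SmoothFn.ev y f') : f = f' := by
  have hi : ∀ y ∈ interior U, 0 < y 0 := by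
    intro y hy
    have h1 : y ∈ interior halfSpace := interior_mono hU.subset hy
    rw [halfSpace, interior_range_modelWithCornersEuclideanHalfSpace] at h1
    exact h1
  have h1 : EqOn (extendZero f.1) (extendZero f'.1) U := by
    refine EqOn.of_subset_closure (s := interior U) (fun y hy => ?_) f.2.continuousOn
      f'.2.continuousOn interior_subset fun y hy => hU.mem_closure_interior hy
    rw [extendZero_apply _ (interior_subset hy), extendZero_apply _ (interior_subset hy)]
    exact h ⟨y, interior_subset hy⟩ (hi y hy)
  exact SmoothFn.ext_ev fun y => by
    have := h1 y.2
    rwa [extendZero_apply _ y.2, extendZero_apply _ y.2] at this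

/-- The components of an asymptotically de Sitter spacetime in the coordinates of a chart. -/
structure LocalSpacetime (L : LocalData) (q : ℕ) (U : Set (Coord 4)) : Prop where
  Λ_pos : 0 < L.Λ
  metric : IsSmoothMetric U L.g
  smooth_Ω : ContDiffOn ℝ ∞ L.Ω U
  smooth_T : ∀ a b, ContDiffOn ℝ ∞ (fun y => L.T y a b) U
  T_symm : ∀ y ∈ U, ∀ a b, L.T y a b = L.T y b a
  Ω_nonneg : ∀ y ∈ U, 0 ≤ L.Ω y
  Ω_eq_zero_iff : ∀ y ∈ U, L.Ω y = 0 ↔ y 0 = 0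
  einstein : ∀ y ∈ U, 0 < y 0 → EinsteinEquationAt halfSpace
    (fun x a b => (L.Ω x ^ 2)⁻¹ * L.g x a b) L.Λ (fun x a b => L.Ω x ^ q * L.T x a b) y

open SmoothFn

lemma isSmoothMetric_inter_pos {U : Set (Coord 4)} {g : Tensor2 4} (h : IsSmoothMetric U g) :
    IsSmoothMetric (U ∩ {y | 0 < y 0}) g where
  isRelOpen := h.isRelOpen.inter isOpen_pos
  smooth a b := (h.smooth a b).mono inter_subset_left
  symm y hy := h.symm y hy.1
  det_ne_zero y hy := h.det_ne_zero y hy.1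

/-- A rescaled metric. -/
lemma IsSmoothMetric.conformal {U : Set (Coord 4)} {g : Tensor2 4} (h : IsSmoothMetric U g)
    {Ω : Coord 4 → ℝ} (hΩ : ContDiffOn ℝ ∞ Ω U) (h0 : ∀ y ∈ U, Ω y ≠ 0) :
    IsSmoothMetric U (fun x a b => (Ω x ^ 2)⁻¹ * g x a b) where
  isRelOpen := h.isRelOpen
  smooth a b := ((hΩ.pow 2).inv fun y hy => pow_ne_zero 2 (h0 y hy)).mul (h.smooth a b)
  symm y hy a b := by rw [h.symm y hy a b]
  det_ne_zero y hy := by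
    have : Matrix.of (fun a b => (Ω y ^ 2)⁻¹ * g y a b) = (Ω y ^ 2)⁻¹ • Matrix.of (g y) := by
      ext; simp
    rw [this, Matrix.det_smul]
    exact mul_ne_zero (pow_ne_zero _ (inv_ne_zero (pow_ne_zero _ (h0 y hy)))) (h.det_ne_zero y hy)

lemma invMetric_conformal {g : Tensor2 4} {Ω : Coord 4 → ℝ} {y : Coord 4} (h0 : Ω y ≠ 0)
    (hg : (Matrix.of (g y)).det ≠ 0) (a b : Fin 4) :
    invMetric (fun x a b => (Ω x ^ 2)⁻¹ * g x a b) y a b = Ω y ^ 2 * invMetric g y a b := by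
  have h1 : Matrix.of (fun a b => (Ω y ^ 2)⁻¹ * g y a b) = (Ω y ^ 2)⁻¹ • Matrix.of (g y) := by
    ext; simp
  have h2 : (Matrix.of (fun a b => (Ω y ^ 2)⁻¹ * g y a b))⁻¹ = Ω y ^ 2 • (Matrix.of (g y))⁻¹ := by
    rw [h1]
    refine Matrix.inv_eq_left_inv ?_
    rw [Matrix.smul_mul, Matrix.mul_smul, smul_smul, mul_inv_cancel₀ (pow_ne_zero _ h0), one_smul,
      Matrix.nonsing_inv_mul _ (isUnit_iff_ne_zero.mpr hg)]
  exact congrFun (congrFun h2 a) b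

/-- In the interior, the Einstein equations for the physical metric are equations for the
Hessian and the gradient of `Ω`. -/
lemma hess_and_norm_pos {U : Set (Coord 4)} {g : Tensor2 4} (h : IsSmoothMetric U g)
    {Ω : Coord 4 → ℝ} (hΩ : ContDiffOn ℝ ∞ Ω U) (h0 : ∀ y ∈ U, Ω y ≠ 0)
    {T : Tensor2 4} (hT : ∀ a b, ContDiffOn ℝ ∞ (fun y => T y a b) U) {Λ : ℝ} {q : ℕ}
    (hE : ∀ y ∈ U, EinsteinEquationAt halfSpace (fun x a b => (Ω x ^ 2)⁻¹ * g x a b) Λ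
      (fun x a b => Ω x ^ q * T x a b) y) {ρ : Coord 4 → ℝ}
    (hρ : ∀ y ∈ U, 4 * ρ y = - (trace2 g (cov1 halfSpace g (pderiv halfSpace Ω)) y
      + schoutenTrace halfSpace g y * Ω y)) {y : Coord 4} (hy : y ∈ U) :
    (∀ a b, 8 * (cov1 halfSpace g (pderiv halfSpace Ω) y a b + Ω y * schouten halfSpace g y a b
        + ρ y * g y a b) = Ω y ^ (q + 1) * (4 * T y a b - trace2 g T y * g y a b)) ∧
    12 * (∑ a, pderiv halfSpace Ω y a * ∑ b, invMetric g y a b * pderiv halfSpace Ω y b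
      + Λ / 3 + 2 * Ω y * ρ y) = Ω y ^ (q + 2) * trace2 g T y := by
  have h' := h.conformal hΩ h0
  obtain ⟨Ω', hΩ'⟩ : ∃ f : SmoothFn U, IsRep Ω f := ⟨_, isRep_mk Ω hΩ⟩
  obtain ⟨w, hw⟩ : ∃ f : SmoothFn U, IsRep (fun y => (Ω y)⁻¹) f := ⟨_, isRep_mk _ (hΩ.inv h0)⟩
  have hdΩ : ∀ a, IsRep (fun y => pderiv halfSpace Ω y a) (h.ring.D a Ω') := h.isRep_pderiv hΩ'
  have hS := h.isRep_cov1 hdΩ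
  have hρ' : IsRep ρ (-(1 / 4 : ℝ) • (h.ring.tr (h.ring.cov1 fun i => h.ring.D i Ω')
      + h.ring.J * Ω')) := fun z => by
    rw [map_smul, map_add, map_mul, ← h.isRep_trace2 hS z, ← h.isRep_schoutenTrace z, ← hΩ' z,
      smul_eq_mul]
    linear_combination hρ z z.2 / 4
  have hT' : ∀ a b, IsRep (fun y => T y a b) (SmoothFn.mk _ (hT a b)) := fun a b => isRep_mk _ _
  obtain ⟨T', hTT⟩ : ∃ T' : Fin 4 → Fin 4 → SmoothFn U, ∀ a b, IsRep (fun y => T y a b) (T' a b) :=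
    ⟨_, hT'⟩
  have key := MetricRing.hess_and_norm_of_einstein (m := h.ring) (m' := h'.ring) (Ω := Ω')
    (w := w) (lam := algebraMap ℝ _ (Λ / 3)) (q := q) (T := T')
    (ρ := -(1 / 4 : ℝ) • (h.ring.tr (h.ring.cov1 fun i => h.ring.D i Ω') + h.ring.J * Ω'))
    (h'.ring_D.trans h.ring_D.symm)
    (fun a b => ext_ev fun z => by
      rw [← h'.isRep_g a b z, map_mul, map_mul, ← hw z, ← h.isRep_g a b z]
      simp only [pow_two, mul_inv])
    (fun a b => ext_ev fun z => by
      rw [← h'.isRep_G a b z, map_mul, map_mul, ← hΩ' z, ← h.isRep_G a b z]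
      rw [← pow_two]
      exact invMetric_conformal (h0 z z.2) (h.det_ne_zero z z.2) a b)
    (ext_ev fun z => by
      rw [map_mul, ← hw z, ← hΩ' z, map_one]
      exact inv_mul_cancel₀ (h0 z z.2))
    (ext_ev fun z => by
      rw [map_mul, ← hρ' z, map_neg, map_add, map_mul, ← h.isRep_trace2 hS z,
        ← h.isRep_schoutenTrace z, ← hΩ' z, map_ofNat]
      exact hρ z z.2)
    (fun a b => ext_ev fun z => by
      have h1 := hE z z.2 a b
      simp only [map_mul, map_add, map_sub, map_ofNat, ← h'.isRep_ricci a b z, map_pow,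
        ← h'.isRep_scalarCurv z, ← h'.isRep_g a b z, ← hTT a b z, ← hΩ' z, AlgHom.commutes]
      simp only [Algebra.algebraMap_self, RingHom.id_apply]
      linear_combination 2 * h1)
  refine ⟨fun a b => ?_, ?_⟩
  · have h1 := congrArg (ev ⟨y, hy⟩) (key.1 a b)
    simp only [map_mul, map_add, map_sub, map_ofNat, map_pow, ← (hS a b).eq hy,
      ← (h.isRep_schouten a b).eq hy, ← (h.isRep_g a b).eq hy, ← (hTT a b).eq hy, ← hΩ'.eq hy,
      ← hρ'.eq hy, ← (h.isRep_trace2 hTT).eq hy] at h1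
    exact h1
  · have h1 := congrArg (ev ⟨y, hy⟩) key.2
    simp only [map_mul, map_add, map_ofNat, map_pow, map_sum, ← (hdΩ _).eq hy,
      ← (h.isRep_up hdΩ _).eq hy, ← hΩ'.eq hy, ← hρ'.eq hy, ← (h.isRep_trace2 hTT).eq hy,
      AlgHom.commutes] at h1
    exact h1

namespace LocalSpacetime

variable {L : LocalData} {q : ℕ} {U : Set (Coord 4)} (h : LocalSpacetime L q U)
include h

lemma lam_pos : 0 < L.lam := div_pos h.Λ_pos (by norm_num)

/-- The ring of smooth functions with the Levi-Civita connection of the unphysical metric. -/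
abbrev ring : MetricRing (SmoothFn U) := h.metric.ring

lemma Ω_pos {y : Coord 4} (hy : y ∈ U) (h0 : 0 < y 0) : 0 < L.Ω y :=
  (h.Ω_nonneg y hy).lt_of_ne fun h1 => h0.ne' ((h.Ω_eq_zero_iff y hy).mp h1.symm)

/-- The scalar `ρ` as an element of the ring of smooth functions. -/
def rho' : SmoothFn U := -(1 / 4 : ℝ) • (h.ring.tr (h.ring.cov1 fun i =>
  h.ring.D i (SmoothFn.mk L.Ω h.smooth_Ω)) + h.ring.J * SmoothFn.mk L.Ω h.smooth_Ω)

lemma isRep_hessΩ (a b : Fin 4) : IsRep (fun y => L.hessΩ y a b)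
    (h.ring.cov1 (fun i => h.ring.D i (SmoothFn.mk L.Ω h.smooth_Ω)) a b) :=
  h.metric.isRep_cov1 (h.metric.isRep_pderiv (isRep_mk L.Ω h.smooth_Ω)) a b

lemma isRep_rho : IsRep L.rho h.rho' := fun y => by
  rw [rho', map_smul, map_add, map_mul, ← isRep_mk L.Ω h.smooth_Ω y, smul_eq_mul,
    ← h.metric.isRep_trace2 h.isRep_hessΩ y, ← h.metric.isRep_schoutenTrace y]
  rfl

/-- The conformal Einstein equations hold up to the boundary. -/
def conformalEinstein : ConformalEinstein h.ring L.lam q where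
  Ω := SmoothFn.mk L.Ω h.smooth_Ω
  ρ := h.rho'
  T a b := SmoothFn.mk _ (h.smooth_T a b)
  T_symm a b := ext_ev fun y => h.T_symm y y.2 a b
  -- Ω is positive off the boundary, so a function it annihilates vanishes on a dense set.
  regular f hf := ext_pos h.metric.isRelOpen fun y hy => by
    have h1 := congrArg (ev y) hf
    rw [map_mul, map_zero, ← isRep_mk L.Ω h.smooth_Ω y] at h1
    rw [map_zero]
    exact (mul_eq_zero.mp h1).resolve_left (h.Ω_pos y.2 hy).ne'
  hess a b := ext_pos h.metric.isRelOpen fun y hy => by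
    have h1 := (hess_and_norm_pos (isSmoothMetric_inter_pos h.metric)
      (h.smooth_Ω.mono inter_subset_left) (fun z hz => (h.Ω_pos hz.1 hz.2).ne')
      (fun a b => (h.smooth_T a b).mono inter_subset_left)
      (fun z hz => h.einstein z hz.1 hz.2) (ρ := L.rho)
      (fun z _ => by rw [LocalData.rho, LocalData.J]; unfold LocalData.hessΩ; ring)
      (y := y) ⟨y.2, hy⟩).1 a b
    have h2 := h.metric.isRep_trace2 (r := L.T) (fun a b => isRep_mk _ (h.smooth_T a b)) y
    have h3 := h.isRep_hessΩ a b y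
    have h4 := h.metric.isRep_schouten a b y
    have h5 := h.metric.isRep_g a b y
    have h6 := h.isRep_rho y
    simp only [map_mul, map_add, map_sub, map_ofNat, map_pow]
    rw [← h2, ← h3, ← h4, ← h5, ← h6]
    exact h1
  norm := ext_pos h.metric.isRelOpen fun y hy => by
    have h1 := (hess_and_norm_pos (isSmoothMetric_inter_pos h.metric)
      (h.smooth_Ω.mono inter_subset_left) (fun z hz => (h.Ω_pos hz.1 hz.2).ne')
      (fun a b => (h.smooth_T a b).mono inter_subset_left)
      (fun z hz => h.einstein z hz.1 hz.2) (ρ := L.rho)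
      (fun z _ => by rw [LocalData.rho, LocalData.J]; unfold LocalData.hessΩ; ring)
      (y := y) ⟨y.2, hy⟩).2
    have h2 := h.metric.isRep_trace2 (r := L.T) (fun a b => isRep_mk _ (h.smooth_T a b)) y
    have h3 := fun a => h.metric.isRep_pderiv (isRep_mk L.Ω h.smooth_Ω) a y
    have h5 := fun a => h.metric.isRep_up
      (h.metric.isRep_pderiv (isRep_mk L.Ω h.smooth_Ω)) a y
    have h6 := h.isRep_rho y
    simp only [map_mul, map_add, map_ofNat, map_pow, map_sum, AlgHom.commutes]
    have h7 : ∀ a, ev y (h.ring.D a (SmoothFn.mk L.Ω h.smooth_Ω))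
        * ev y (h.ring.up (fun i => h.ring.D i (SmoothFn.mk L.Ω h.smooth_Ω)) a)
        = pderiv halfSpace L.Ω y a * ∑ b, invMetric L.g y a b * pderiv halfSpace L.Ω y b :=
      fun a => by rw [← h3 a, ← h5 a]
    rw [Finset.sum_congr rfl fun a _ => h7 a]
    rw [← h2, ← h6]
    exact h1

end LocalSpacetime
end ConformalInfinity

/-! ### Restriction to the boundary and its intrinsic geometry -/

namespace ConformalInfinity

open SmoothFn

/-- The inclusion of the boundary as a linear map. -/
def inclL : Coord 3 →L[ℝ] Coord 4 := LinearMap.toContinuousLinearMap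
  { toFun := incl
    map_add' := fun x y => by
      ext i; refine Fin.cases ?_ (fun i => ?_) i <;> simp [incl]
    map_smul' := fun r x => by
      ext i; refine Fin.cases ?_ (fun i => ?_) i <;> simp [incl] }

lemma inclL_apply (z : Coord 3) : inclL z = incl z := rfl

lemma incl_zero (z : Coord 3) : incl z 0 = 0 := rfl

lemma incl_mem_halfSpace (z : Coord 3) : incl z ∈ halfSpace := mem_halfSpace.mpr le_rfl

lemma incl_single (i : Fin 3) :
    incl (EuclideanSpace.single i 1) = EuclideanSpace.single i.succ 1 := by
  ext j
  refine Fin.cases ?_ (fun j => ?_) j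
  · simp [incl, (Fin.succ_ne_zero i).symm]
  · simp [incl]

lemma pderiv_incl {F : Coord 4 → ℝ} {z : Coord 3}
    (hF : DifferentiableWithinAt ℝ F halfSpace (incl z)) (i : Fin 3) :
    pderiv univ (fun x => F (incl x)) z i = pderiv halfSpace F (incl z) i.succ := by
  have h1 : HasFDerivWithinAt (fun x => F (inclL x))
      ((fderivWithin ℝ F halfSpace (incl z)).comp inclL) univ z :=
    hF.hasFDerivWithinAt.comp z inclL.hasFDerivWithinAt fun x _ => incl_mem_halfSpace x
  have h2 := h1.fderivWithin uniqueDiffWithinAt_univ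
  rw [pderiv]
  change fderivWithin ℝ (fun x => F (inclL x)) univ z _ = _
  rw [h2, ContinuousLinearMap.comp_apply, inclL_apply, incl_single]; rfl

lemma IsRelOpen.eventually_incl {U : Set (Coord 4)} (hU : IsRelOpen U) {z : Coord 3}
    (hz : incl z ∈ U) : ∀ᶠ x in 𝓝 z, incl x ∈ U := by
  obtain ⟨O, hO, rfl⟩ := hU
  have : inclL ⁻¹' O ∈ 𝓝 z := inclL.continuous.continuousAt.preimage_mem_nhds (hO.mem_nhds hz.2)
  filter_upwards [this] with x hx using ⟨incl_mem_halfSpace x, hx⟩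

lemma pderiv_univ_congr {F G : Coord 3 → ℝ} {z : Coord 3} (h : ∀ᶠ x in 𝓝 z, F x = G x)
    (i : Fin 3) : pderiv univ F z i = pderiv univ G z i := by
  rw [pderiv, pderiv, Filter.EventuallyEq.fderivWithin_eq (by rwa [nhdsWithin_univ]) h.self_of_nhds]

lemma pderiv_univ_of_eventually_zero {F : Coord 3 → ℝ} {z : Coord 3}
    (h : ∀ᶠ x in 𝓝 z, F x = 0) (i : Fin 3) : pderiv univ F z i = 0 := by
  rw [pderiv_univ_congr h]
  simp [pderiv]

lemma _root_.ContDiffOn.differentiableWithinAt_halfSpace {U : Set (Coord 4)} (hU : IsRelOpen U)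
    {F : Coord 4 → ℝ} (hF : ContDiffOn ℝ ∞ F U) {y : Coord 4} (hy : y ∈ U) :
    DifferentiableWithinAt ℝ F halfSpace y :=
  (hF.differentiableOn (by simp) y hy).mono_of_mem_nhdsWithin (hU.mem_nhdsWithin hy)

lemma SmoothFn.IsRep.pderiv_incl {U : Set (Coord 4)} (hU : IsRelOpen U) {F : Coord 4 → ℝ}
    {f : SmoothFn U} (h : IsRep F f) {z : Coord 3} (hz : incl z ∈ U) (i : Fin 3) :
    ConformalInfinity.pderiv univ (fun x => F (incl x)) z i
      = ev ⟨incl z, hz⟩ (partialD hU i.succ f) := by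
  rw [ConformalInfinity.pderiv_incl (h.contDiffOn.differentiableWithinAt_halfSpace hU hz)]
  exact h.pderiv hU i.succ ⟨incl z, hz⟩

namespace LocalSpacetime

variable {L : LocalData} {q : ℕ} {U : Set (Coord 4)} (h : LocalSpacetime L q U)
variable {z : Coord 3} (hz : incl z ∈ U)

/-- evaluation at a boundary point -/
def bev {z : Coord 3} (hz : incl z ∈ U) : SmoothFn U →ₐ[ℝ] ℝ := ev ⟨incl z, hz⟩

include h

lemma isRep_Ω : IsRep L.Ω h.conformalEinstein.Ω := isRep_mk _ h.smooth_Ω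

lemma isRep_T (a b : Fin 4) : IsRep (fun y => L.T y a b) (h.conformalEinstein.T a b) :=
  isRep_mk _ (h.smooth_T a b)

lemma isRep_ρ : IsRep L.rho h.conformalEinstein.ρ := h.isRep_rho

lemma isRep_dΩ (a : Fin 4) : IsRep (fun y => pderiv halfSpace L.Ω y a)
    (h.conformalEinstein.dΩ a) := h.metric.isRep_pderiv h.isRep_Ω a

lemma isRep_normal (a : Fin 4) : IsRep (fun y => L.normal y a)
    ((√L.lam)⁻¹ • h.conformalEinstein.dΩ a) := (h.isRep_dΩ a).const_mul _

lemma isRep_normalUp (a : Fin 4) : IsRep (fun y => L.normalUp y a)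
    ((√L.lam)⁻¹ • h.conformalEinstein.uΩ a) := fun y => by
  have h1 := h.metric.isRep_up h.isRep_dΩ a y
  rw [map_smul, ConformalEinstein.uΩ, ← h1]
  simp only [LocalData.normalUp, LocalData.normal, smul_eq_mul, Finset.mul_sum]
  exact Finset.sum_congr rfl fun b _ => by ring

lemma isRep_trT : IsRep L.trT h.conformalEinstein.t := h.metric.isRep_trace2 h.isRep_T

lemma isRep_Tn (a : Fin 4) : IsRep (fun y => L.Tn y a)
    ((√L.lam)⁻¹ • h.conformalEinstein.con h.conformalEinstein.T a) := fun y => by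
  rw [map_smul, ConformalEinstein.con, map_sum, smul_eq_mul, Finset.mul_sum]
  refine Finset.sum_congr rfl fun b _ => ?_
  have h2 := h.isRep_normalUp b y
  rw [map_smul, smul_eq_mul] at h2
  rw [map_mul, ← h.isRep_T a b y]
  linear_combination L.T y a b * h2

lemma isRep_div2_T (a : Fin 4) : IsRep (fun y => div2 halfSpace L.g L.T y a)
    (h.conformalEinstein.divT a) := h.metric.isRep_div2 h.isRep_T a

lemma sqrt_lam_pos : 0 < √L.lam := Real.sqrt_pos.mpr h.lam_pos

lemma inv_sqrt_mul_self : (√L.lam)⁻¹ * (√L.lam)⁻¹ = L.lam⁻¹ := by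
  rw [← mul_inv, Real.mul_self_sqrt h.lam_pos.le]

lemma normalSq_eq {y : Coord 4} (hy : y ∈ U) : L.normalSq y
    = L.lam⁻¹ * ∑ a, ev ⟨y, hy⟩ (h.conformalEinstein.dΩ a) * ev ⟨y, hy⟩ (h.conformalEinstein.uΩ a)
    := by
  rw [LocalData.normalSq, Finset.mul_sum]
  refine Finset.sum_congr rfl fun a _ => ?_
  rw [(h.isRep_normal a).eq hy, (h.isRep_normalUp a).eq hy, map_smul, map_smul, smul_eq_mul,
    smul_eq_mul, ← h.inv_sqrt_mul_self]
  ring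

lemma constraint_eq {y : Coord 4} (hy : y ∈ U) (a : Fin 4) : L.constraint q y a
    = - (√L.lam)⁻¹ * L.Ω y * div2 halfSpace L.g L.T y a := by
  have h1 := congrArg (ev ⟨y, hy⟩) (h.conformalEinstein.constraint a)
  simp only [map_add, map_mul, map_sub, map_neg, map_natCast, map_ofNat, ← h.isRep_Ω.eq hy,
    ← (h.isRep_div2_T a).eq hy, ← h.isRep_trT.eq hy, ← (h.isRep_dΩ a).eq hy] at h1
  have h2 := (h.isRep_Tn a).eq hy
  rw [map_smul, smul_eq_mul] at h2
  rw [LocalData.constraint, h2, LocalData.normal]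
  linear_combination (√L.lam)⁻¹ * h1

lemma isRep_constraint (a : Fin 4) : IsRep (fun y => L.constraint q y a)
    ((-(√L.lam)⁻¹) • h.conformalEinstein.Ω * h.conformalEinstein.divT a) := fun y => by
  rw [map_mul, map_smul, ← h.isRep_Ω y, ← h.isRep_div2_T a y, smul_eq_mul]
  exact h.constraint_eq y.2 a

/-! ### Boundary points -/

lemma Ω_incl {z : Coord 3} (hz : incl z ∈ U) : L.Ω (incl z) = 0 :=
  (h.Ω_eq_zero_iff _ hz).mpr (incl_zero z)

lemma bev_Ω : bev hz h.conformalEinstein.Ω = 0 := by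
  rw [bev, ← h.isRep_Ω.eq hz, h.Ω_incl hz]

/-- Ω is zero along Σ, hence so are its tangential derivatives. -/
lemma bev_dΩ_succ (i : Fin 3) : bev hz (h.conformalEinstein.dΩ i.succ) = 0 := by
  have h1 := h.isRep_Ω.pderiv_incl h.metric.isRelOpen hz i
  rw [pderiv_univ_of_eventually_zero] at h1
  · exact h1.symm
  · filter_upwards [h.metric.isRelOpen.eventually_incl hz] with x hx using h.Ω_incl hx

lemma bev_norm : bev hz (h.conformalEinstein.dΩ 0) * bev hz (h.conformalEinstein.uΩ 0) = -L.lam := by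
  rw [← h.conformalEinstein.ev_norm (bev hz) (h.bev_Ω hz), Fin.sum_univ_succ]
  simp [h.bev_dΩ_succ hz]

lemma bev_uΩ (a : Fin 4) : bev hz (h.conformalEinstein.uΩ a)
    = bev hz (h.ring.G a 0) * bev hz (h.conformalEinstein.dΩ 0) := by
  rw [← h.conformalEinstein.ev_sum_G_dΩ, Fin.sum_univ_succ]
  simp [h.bev_dΩ_succ hz]

/-- The inverse `g^{ab} + n^a n^b` of the induced metric, extended by zero. -/
def tangG (hz : incl z ∈ U) (a b : Fin 4) : ℝ := bev hz (h.ring.G a b)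
  + L.lam⁻¹ * (bev hz (h.conformalEinstein.uΩ a) * bev hz (h.conformalEinstein.uΩ b))

lemma tangG_symm (a b : Fin 4) : h.tangG hz a b = h.tangG hz b a := by
  rw [tangG, tangG, h.ring.G_symm]; ring

/-- Because n_a n^a = -1, the tensor g^{ab} + n^a n^b annihilates n, whose only nonzero lower
component is the one of index 0. -/
lemma tangG_zero (a : Fin 4) : h.tangG hz a 0 = 0 := by
  have h1 := h.bev_norm hz
  have hl := h.lam_pos.ne'
  rw [tangG, h.bev_uΩ hz a, h.bev_uΩ hz 0]
  rw [h.bev_uΩ hz 0] at h1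
  linear_combination (L.lam⁻¹ * bev hz (h.ring.G a 0)) * h1 -
    bev hz (h.ring.G a 0) * (mul_inv_cancel₀ hl)

lemma tangG_zero' (a : Fin 4) : h.tangG hz 0 a = 0 := by
  rw [h.tangG_symm, h.tangG_zero]

lemma sum_tangG (X : Fin 4 → Fin 4 → ℝ) :
    ∑ k : Fin 3, ∑ l : Fin 3, h.tangG hz k.succ l.succ * X k.succ l.succ
      = ∑ a, ∑ b, h.tangG hz a b * X a b := by
  symm
  rw [Fin.sum_univ_succ]
  simp only [tangG_zero', zero_mul, Finset.sum_const_zero, zero_add]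
  refine Finset.sum_congr rfl fun k _ => ?_
  rw [Fin.sum_univ_succ]
  simp only [tangG_zero, zero_mul, zero_add]

lemma bev_g (a b : Fin 4) : bev hz (h.ring.g a b) = L.g (incl z) a b := rfl

lemma sum_tangG_g (a : Fin 4) (i : Fin 3) :
    ∑ k : Fin 3, h.tangG hz a k.succ * bev hz (h.ring.g k.succ i.succ)
      = if a = i.succ then 1 else 0 := by
  have h1 : ∑ b, h.tangG hz a b * bev hz (h.ring.g b i.succ)
      = if a = i.succ then 1 else 0 := by
    have h2 := congrArg (bev hz) (h.ring.G_g a i.succ)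
    have h3 := h.conformalEinstein.ev_sum_g_uΩ (bev hz) i.succ
    rw [h.bev_dΩ_succ hz] at h3
    simp only [map_sum, map_mul, apply_ite (bev hz), map_one, map_zero] at h2
    simp only [tangG, add_mul, Finset.sum_add_distrib, h2]
    have h4 : ∑ b, L.lam⁻¹ * (bev hz (h.conformalEinstein.uΩ a)
        * bev hz (h.conformalEinstein.uΩ b)) * bev hz (h.ring.g b i.succ)
        = L.lam⁻¹ * bev hz (h.conformalEinstein.uΩ a)
          * ∑ b, bev hz (h.ring.g i.succ b) * bev hz (h.conformalEinstein.uΩ b) := by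
      rw [Finset.mul_sum]
      exact Finset.sum_congr rfl fun b _ => by rw [h.ring.g_symm b]; ring
    rw [h4, h3, mul_zero, add_zero]
  rw [Fin.sum_univ_succ, h.tangG_zero, zero_mul, zero_add] at h1
  exact h1

lemma invMetric_bg (i j : Fin 3) : invMetric L.bg z i j = h.tangG hz i.succ j.succ := by
  have h1 : (Matrix.of (L.bg z))⁻¹ = Matrix.of fun i j : Fin 3 => h.tangG hz i.succ j.succ := by
    refine Matrix.inv_eq_left_inv ?_
    ext i j
    rw [Matrix.mul_apply, Matrix.one_apply]
    have := h.sum_tangG_g hz i.succ j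
    simp only [Fin.succ_inj] at this
    exact this
  rw [invMetric, h1]; rfl

lemma pderiv_bg (k i j : Fin 3) : pderiv univ (fun x => L.bg x i j) z k
    = bev hz (h.ring.D k.succ (h.ring.g i.succ j.succ)) :=
  (h.metric.isRep_g i.succ j.succ).pderiv_incl h.metric.isRelOpen hz k

/-- The Christoffel symbols of the boundary, contracted with a tangential covector. -/
lemma sum_christoffel_bg (t : Fin 4 → ℝ)
    (ht : ∑ a, bev hz (h.conformalEinstein.uΩ a) * t a = 0) (k i : Fin 3) :
    ∑ l, christoffel univ L.bg z l k i * t l.succ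
      = ∑ d, bev hz (h.ring.Γ d k.succ i.succ) * t d := by
  obtain ⟨X, hX⟩ : ∃ X : Fin 4 → ℝ, ∀ e, X e = bev hz (h.ring.D k.succ (h.ring.g i.succ e)
    + h.ring.D i.succ (h.ring.g k.succ e) - h.ring.D e (h.ring.g k.succ i.succ)) :=
    ⟨_, fun _ => rfl⟩
  have h1 : ∀ d, bev hz (h.ring.Γ d k.succ i.succ) = 1 / 2 * ∑ e, bev hz (h.ring.G d e) * X e := by
    intro d
    have h2 := congrArg (bev hz) (h.ring.koszul d k.succ i.succ)
    simp only [map_mul, map_sum, map_ofNat, ← hX] at h2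
    linarith
  have h2 : ∀ l, christoffel univ L.bg z l k i
      = 1 / 2 * ∑ m : Fin 3, h.tangG hz l.succ m.succ * X m.succ := by
    intro l
    simp only [christoffel, h.pderiv_bg hz, h.invMetric_bg hz, hX, map_add, map_sub]
  -- As t annihilates the normal, the inverse metric may be replaced by `tangG` in the contraction.
  have h3 : ∑ d, bev hz (h.ring.Γ d k.succ i.succ) * t d
      = 1 / 2 * ∑ d, ∑ e, h.tangG hz d e * (t d * X e) := by
    have h4 : ∑ d, ∑ e, h.tangG hz d e * (t d * X e)
        = ∑ d, (∑ e, bev hz (h.ring.G d e) * X e) * t d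
          + L.lam⁻¹ * (∑ d, bev hz (h.conformalEinstein.uΩ d) * t d)
            * ∑ e, bev hz (h.conformalEinstein.uΩ e) * X e := by
      simp only [tangG, Fin.sum_univ_four]; ring
    rw [h4, ht]
    simp only [h1, Finset.mul_sum, Finset.sum_mul, mul_zero, zero_mul, add_zero,
      Finset.sum_const_zero]
    exact Finset.sum_congr rfl fun _ _ => Finset.sum_congr rfl fun _ _ => by ring
  rw [h3, ← h.sum_tangG hz fun d e => t d * X e]
  simp only [h2, Finset.mul_sum, Finset.sum_mul]
  exact Finset.sum_congr rfl fun _ _ => Finset.sum_congr rfl fun _ _ => by ring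

/-- If both slots annihilate the normal on Σ, no second fundamental form appears and ∇̄ is the
restriction of ∇. -/
lemma cov2_bg {r : Tensor2 4} {r' : Fin 4 → Fin 4 → SmoothFn U}
    (hr : ∀ a b, IsRep (fun y => r y a b) (r' a b))
    (h1 : ∀ b, ∑ a, bev hz (h.conformalEinstein.uΩ a) * bev hz (r' a b) = 0)
    (h2 : ∀ b, ∑ a, bev hz (h.conformalEinstein.uΩ a) * bev hz (r' b a) = 0) (k i j : Fin 3) :
    cov2 univ L.bg (pull2 r) z k i j = bev hz (h.ring.cov2 r' k.succ i.succ j.succ) := by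
  have hv : ∀ a b, r (incl z) a b = bev hz (r' a b) := fun a b => (hr a b).eq hz
  rw [cov2, MetricRing.cov2]
  simp only [map_sub, map_sum, map_mul, pull2, hv]
  rw [h.sum_christoffel_bg hz (fun d => bev hz (r' d j.succ)) (h1 _),
    h.sum_christoffel_bg hz (fun d => bev hz (r' i.succ d)) (h2 _)]
  congr 2
  exact (hr i.succ j.succ).pderiv_incl h.metric.isRelOpen hz k

end LocalSpacetime

lemma div2_univ_congr {g t t' : Tensor2 3} {z : Coord 3}
    (h : ∀ᶠ x in 𝓝 z, ∀ i j, t x i j = t' x i j) (i : Fin 3) :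
    div2 univ g t z i = div2 univ g t' z i := by
  have h1 : ∀ i j, t z i j = t' z i j := h.self_of_nhds
  simp only [div2, cov2, h1]
  refine Finset.sum_congr rfl fun k _ => Finset.sum_congr rfl fun l _ => ?_
  rw [pderiv_univ_congr (h.mono fun x hx => hx i l)]

end ConformalInfinity

/-! ### Orders of vanishing, the constraints and the mean curvature -/

namespace ConformalInfinity

open SmoothFn

/-- The projection to the boundary. -/
def projL : Coord 4 →L[ℝ] Coord 3 := LinearMap.toContinuousLinearMap
  { toFun := fun y => WithLp.toLp 2 fun i => y i.succ
    map_add' := fun x y => by ext i; simp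
    map_smul' := fun r x => by ext i; simp }

lemma projL_incl (z : Coord 3) : projL (incl z) = z := by
  ext i; rfl

lemma dist_incl_projL {y : Coord 4} (hy : y ∈ halfSpace) : dist y (incl (projL y)) = y 0 := by
  rw [EuclideanSpace.dist_eq, Fin.sum_univ_succ]
  have h1 : ∀ i : Fin 3, dist (y i.succ) (incl (projL y) i.succ) = 0 := fun i => by
    rw [dist_eq_zero]; rfl
  simp only [h1, incl_zero]
  simp [Real.sqrt_sq (mem_halfSpace.mp hy)]

lemma tendsto_incl_projL (z : Coord 3) :
    Tendsto (fun y => incl (projL y)) (𝓝[halfSpace] (incl z)) (𝓝[halfSpace] (incl z)) := by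
  refine tendsto_nhdsWithin_iff.mpr ⟨?_, Eventually.of_forall fun y => incl_mem_halfSpace _⟩
  have h1 : Continuous fun y => inclL (projL y) := inclL.continuous.comp projL.continuous
  have h2 := h1.tendsto (incl z)
  rw [projL_incl] at h2
  exact h2.mono_left nhdsWithin_le_nhds

lemma tendsto_projL (z : Coord 3) : Tendsto projL (𝓝[halfSpace] (incl z)) (𝓝 z) := by
  have h2 := projL.continuous.tendsto (incl z)
  rw [projL_incl] at h2
  exact h2.mono_left nhdsWithin_le_nhds

lemma convex_halfSpace : Convex ℝ halfSpace := (𝓡∂ 4).convex_range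

/-- A function which vanishes on the boundary and is Lipschitz is bounded by the distance to the
boundary. -/
lemma eventually_abs_le {F : Coord 4 → ℝ} {z : Coord 3} (h0 : ∀ᶠ x in 𝓝 z, F (incl x) = 0)
    {K : NNReal} {t : Set (Coord 4)} (ht : t ∈ 𝓝[halfSpace] (incl z)) (hF : LipschitzOnWith K F t) :
    ∀ᶠ y in 𝓝[halfSpace] (incl z), |F y| ≤ K * y 0 := by
  filter_upwards [ht, tendsto_incl_projL z ht, (tendsto_projL z).eventually h0,
    self_mem_nhdsWithin] with y h1 h2 h3 h4
  have := hF.dist_le_mul y h1 _ h2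
  rwa [dist_incl_projL h4, h3, Real.dist_eq, sub_zero] at this

lemma isBigO_coord_zero {F : Coord 4 → ℝ} {z : Coord 3} (h0 : ∀ᶠ x in 𝓝 z, F (incl x) = 0)
    (hF : ContDiffWithinAt ℝ 1 F halfSpace (incl z)) :
    F =O[𝓝[halfSpace] (incl z)] fun y => y 0 := by
  obtain ⟨K, t, ht, hK⟩ := hF.exists_lipschitzOnWith convex_halfSpace
  refine IsBigO.of_bound K ((eventually_abs_le h0 ht hK).and self_mem_nhdsWithin |>.mono ?_)
  rintro y ⟨h1, h2⟩
  rwa [Real.norm_eq_abs, Real.norm_eq_abs, abs_of_nonneg (mem_halfSpace.mp h2)]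

lemma _root_.ContDiffOn.contDiffWithinAt_halfSpace {U : Set (Coord 4)} {F : Coord 4 → ℝ}
    {n : WithTop ℕ∞} (hF : ContDiffOn ℝ n F U) (hU : IsRelOpen U) {y : Coord 4} (hy : y ∈ U) :
    ContDiffWithinAt ℝ n F halfSpace y :=
  (hF y hy).mono_of_mem_nhdsWithin (hU.mem_nhdsWithin hy)

/-- With a = ∂₀F at the point, a x⁰ - F vanishes on the boundary and has zero derivative there, so
near the point it is Lipschitz with constant |a|/2. Hence |a x⁰ - F| ≤ |a| x⁰/2, and F is at least
comparable to x⁰. -/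
lemma coord_zero_isBigO {U : Set (Coord 4)} (hU : IsRelOpen U) {F : Coord 4 → ℝ} {z : Coord 3}
    (hz : incl z ∈ U) (h0 : ∀ᶠ x in 𝓝 z, F (incl x) = 0)
    (hF : ContDiffOn ℝ ∞ F U) (hd : pderiv halfSpace F (incl z) 0 ≠ 0) :
    (fun y => y 0) =O[𝓝[halfSpace] (incl z)] F := by
  obtain ⟨a, ha⟩ : ∃ a, a = pderiv halfSpace F (incl z) 0 := ⟨_, rfl⟩
  have hd' : a ≠ 0 := ha ▸ hd
  let p : Coord 4 →L[ℝ] ℝ := EuclideanSpace.proj (0 : Fin 4)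
  have hF' : ∀ y ∈ U, DifferentiableWithinAt ℝ F halfSpace y :=
    fun y hy => hF.differentiableWithinAt_halfSpace hU hy
  have hG : ∀ y ∈ U, HasFDerivWithinAt (fun y : Coord 4 => a * y 0 - F y)
      (a • p - fderivWithin ℝ F halfSpace y) halfSpace y := fun y hy =>
    (p.hasFDerivWithinAt.const_mul a).sub (hF' y hy).hasFDerivWithinAt
  have hs : ∀ i : Fin 3, pderiv halfSpace F (incl z) i.succ = 0 := fun i => by
    rw [← pderiv_incl (hF' _ hz), pderiv_univ_of_eventually_zero h0]
  have h2 : a • p - fderivWithin ℝ F halfSpace (incl z) = 0 := by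
    refine ContinuousLinearMap.coe_injective ((EuclideanSpace.basisFun (Fin 4) ℝ).toBasis.ext ?_)
    intro i
    simp only [OrthonormalBasis.coe_toBasis, EuclideanSpace.basisFun_apply]
    refine Fin.cases ?_ (fun i => ?_) i
    · have : fderivWithin ℝ F halfSpace (incl z) (EuclideanSpace.single 0 1) = a := ha.symm
      simp [this, p]
    · have : fderivWithin ℝ F halfSpace (incl z) (EuclideanSpace.single i.succ 1) = 0 := hs i
      simp [this, p, (Fin.succ_ne_zero i).symm]
  have hc : ContinuousWithinAt (fun y => a • p - fderivWithin ℝ F halfSpace y) halfSpace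
      (incl z) := by
    have h3 : ContinuousOn (fderivWithin ℝ F U) U :=
      hF.continuousOn_fderivWithin hU.uniqueDiffOn (by simp)
    refine (continuousWithinAt_const.sub ?_).mono_of_mem_nhdsWithin (hU.mem_nhdsWithin hz)
    exact (h3 _ hz).congr (fun y hy => hU.fderivWithin_eq hy) (hU.fderivWithin_eq hz)
  obtain ⟨t, ht, hK⟩ :=
    convex_halfSpace.exists_nhdsWithin_lipschitzOnWith_of_hasFDerivWithinAt_of_nnnorm_lt
      (eventually_of_mem (hU.mem_nhdsWithin hz) hG) hc
      (⟨|a| / 2, by positivity⟩ : NNReal) (by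
        rw [h2, nnnorm_zero]; exact_mod_cast half_pos (abs_pos.mpr hd'))
  have h1 := eventually_abs_le (z := z) (F := fun y => a * y 0 - F y)
    (h0.mono fun x hx => by rw [incl_zero, hx]; ring) ht hK
  refine IsBigO.of_bound (2 / |a|) ((h1.and self_mem_nhdsWithin).mono ?_)
  rintro y ⟨h2, h3⟩
  have h4 := mem_halfSpace.mp h3
  rw [Real.norm_eq_abs, Real.norm_eq_abs, abs_of_nonneg h4, div_mul_eq_mul_div,
    le_div_iff₀ (abs_pos.mpr hd')]
  change |a * y 0 - F y| ≤ |a| / 2 * y 0 at h2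
  have h5 := abs_sub_abs_le_abs_sub (a * y 0) (F y)
  rw [abs_mul, abs_of_nonneg h4] at h5
  linarith

namespace LocalSpacetime

variable {L : LocalData} {q : ℕ} {U : Set (Coord 4)} (h : LocalSpacetime L q U)
variable {z : Coord 3} (hz : incl z ∈ U)
include h hz

omit hz h in
lemma _root_.ConformalInfinity.SmoothFn.IsRep.bev {F : Coord 4 → ℝ} {f : SmoothFn U} (hF : IsRep F f)
    (hz : incl z ∈ U) : F (incl z) = LocalSpacetime.bev hz f := hF ⟨incl z, hz⟩

lemma eventually_Ω_incl : ∀ᶠ x in 𝓝 z, L.Ω (incl x) = 0 :=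
  (h.metric.isRelOpen.eventually_incl hz).mono fun _ hx => h.Ω_incl hx

lemma bev_dΩ_ne_zero : bev hz (h.conformalEinstein.dΩ 0) ≠ 0 := fun h0 => by
  have := h.bev_norm hz
  rw [h0, zero_mul] at this
  linarith [h.lam_pos]

/-- A smooth function which vanishes on the boundary is `O(Ω)`. -/
lemma isBigO_Ω {F : Coord 4 → ℝ} (hF : ContDiffWithinAt ℝ ∞ F halfSpace (incl z))
    (h0 : ∀ᶠ x in 𝓝 z, F (incl x) = 0) : F =O[𝓝[halfSpace] (incl z)] L.Ω :=
  (isBigO_coord_zero h0 (hF.of_le (by simp))).trans <| coord_zero_isBigO h.metric.isRelOpen hz (h.eventually_Ω_incl hz)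
    h.smooth_Ω (by
      rw [(h.isRep_dΩ 0).eq hz]; exact h.bev_dΩ_ne_zero hz)

lemma constraint_incl (a : Fin 4) : L.constraint q (incl z) a = 0 := by
  rw [h.constraint_eq hz, h.Ω_incl hz]; ring

/-- The constraint is -λ^{-1/2} Ω div T, and Ω has normal derivative -√λ on Σ. -/
lemma normalCov1_constraint (a : Fin 4) : L.normalCov1 (L.constraint q) (incl z) a
    - div2 halfSpace L.g L.T (incl z) a = 0 := by
  have h1 := h.conformalEinstein.ev_norm (bev hz) (h.bev_Ω hz)
  have h2 : ∀ c, cov1 halfSpace L.g (L.constraint q) (incl z) c a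
      = -(√L.lam)⁻¹ * bev hz (h.conformalEinstein.dΩ c) * bev hz (h.conformalEinstein.divT a) := by
    intro c
    rw [(h.metric.isRep_cov1 h.isRep_constraint c a).bev hz, MetricRing.cov1_mul, map_add,
      map_mul, map_mul, Derivation.map_smul, map_smul, map_smul, h.bev_Ω hz]
    simp only [smul_eq_mul, mul_zero, zero_mul, add_zero]
    rfl
  have h3 : ∀ c, L.normalUp (incl z) c = (√L.lam)⁻¹ * bev hz (h.conformalEinstein.uΩ c) := by
    intro c
    rw [(h.isRep_normalUp c).bev hz, map_smul, smul_eq_mul]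
  rw [LocalData.normalCov1, (h.isRep_div2_T a).bev hz]
  simp only [h2, h3, Fin.sum_univ_four] at h1 ⊢
  have h4 := h.inv_sqrt_mul_self
  have h5 := inv_mul_cancel₀ h.lam_pos.ne'
  linear_combination -(√L.lam)⁻¹ * (√L.lam)⁻¹ * bev hz (h.conformalEinstein.divT a) * h1
    + L.lam * bev hz (h.conformalEinstein.divT a) * h4 + bev hz (h.conformalEinstein.divT a) * h5

omit hz in
lemma isRep_K (a b : Fin 4) : IsRep (fun y => cov1 halfSpace L.g L.normal y a b)
    ((√L.lam)⁻¹ • h.conformalEinstein.S a b) := by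
  have h1 : (√L.lam)⁻¹ • h.conformalEinstein.S a b
      = h.ring.cov1 (fun a => (√L.lam)⁻¹ • h.conformalEinstein.dΩ a) a b := by
    simp only [MetricRing.cov1, Derivation.map_smul, mul_smul_comm, ← Finset.smul_sum, ← smul_sub]
    rfl
  rw [h1]
  exact h.metric.isRep_cov1 h.isRep_normal a b

/-- The boundary is totally umbilic, because ∇∇Ω = -ρ g there. -/
lemma K_eq (i j : Fin 3) :
    L.K z i j = -(√L.lam)⁻¹ * L.rho (incl z) * L.g (incl z) i.succ j.succ := by
  rw [LocalData.K, pull2, (h.isRep_K i.succ j.succ).eq hz, map_smul, ← bev,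
    h.conformalEinstein.ev_S (bev hz) (h.bev_Ω hz), h.bev_g, h.isRep_ρ.bev hz, smul_eq_mul]
  ring

lemma trace2_bg_g : trace2 L.bg L.bg z = 3 := by
  have h1 : ∀ k : Fin 3, ∑ l, invMetric L.bg z k l * L.bg z k l = 1 := fun k => by
    have h2 := h.sum_tangG_g hz k.succ k
    rw [if_pos rfl] at h2
    rw [← h2]
    refine Finset.sum_congr rfl fun l _ => ?_
    rw [h.invMetric_bg hz, h.ring.g_symm]; rfl
  simp [trace2, h1]

lemma H_eq : L.H z = -3 * (√L.lam)⁻¹ * L.rho (incl z) := by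
  have h1 : trace2 L.bg L.K z = -(√L.lam)⁻¹ * L.rho (incl z) * trace2 L.bg L.bg z := by
    simp only [trace2, Finset.mul_sum, h.K_eq hz]
    refine Finset.sum_congr rfl fun k _ => Finset.sum_congr rfl fun l _ => ?_
    rw [LocalData.bg, pull2]; ring
  rw [LocalData.H, h1, h.trace2_bg_g hz]; ring

omit hz in
lemma normalSq_expansion {y : Coord 4} (hy : y ∈ U) : L.normalSq y
    = -1 - 2 * L.lam⁻¹ * L.Ω y * L.rho y + L.Ω y ^ (q + 2) * (L.lam⁻¹ / 12 * L.trT y) := by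
  have h1 := congrArg (ev ⟨y, hy⟩) h.conformalEinstein.norm'
  simp only [map_mul, map_sum, map_sub, map_pow, AlgHom.commutes, map_ofNat,
    Algebra.algebraMap_self, RingHom.id_apply, ← h.isRep_Ω.eq hy, ← h.isRep_ρ.eq hy,
    ← h.isRep_trT.eq hy] at h1
  rw [h.normalSq_eq hy]
  linear_combination L.lam⁻¹ / 12 * h1 - inv_mul_cancel₀ h.lam_pos.ne'

/-- On Σ the mean curvature is -3ρ/√λ, so the term -2λ⁻¹Ωρ of `normalSq_expansion` matches the
stated one up to Ω times a function vanishing on Σ. This covers every smooth extension; the matter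
term starts at order q+2. -/
lemma normalSq_isBigO {H : Coord 4 → ℝ} (hH : ContDiffWithinAt ℝ ∞ H halfSpace (incl z))
    (hH' : ∀ᶠ x in 𝓝 z, H (incl x) = L.H x) :
    (fun y => L.normalSq y - (-1 + 2 * H y / √(3 * L.Λ) * L.Ω y))
      =O[𝓝[halfSpace] (incl z)] fun y => L.Ω y ^ 2 := by
  have hU := h.metric.isRelOpen
  have hs : √(3 * L.Λ) = 3 * √L.lam := by
    rw [show 3 * L.Λ = 3 ^ 2 * L.lam by rw [LocalData.lam]; ring, Real.sqrt_mul (by norm_num),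
      Real.sqrt_sq (by norm_num)]
  have hρ : ContDiffWithinAt ℝ ∞ L.rho halfSpace (incl z) :=
    h.isRep_ρ.contDiffOn.contDiffWithinAt_halfSpace hU hz
  have ht : ContDiffWithinAt ℝ ∞ L.trT halfSpace (incl z) :=
    h.isRep_trT.contDiffOn.contDiffWithinAt_halfSpace hU hz
  have hΩ : ContDiffWithinAt ℝ ∞ L.Ω halfSpace (incl z) :=
    h.smooth_Ω.contDiffWithinAt_halfSpace hU hz
  have h1 : (fun y => -2 / 3 * (√L.lam)⁻¹ * (H y - -3 * (√L.lam)⁻¹ * L.rho y))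
      =O[𝓝[halfSpace] (incl z)] L.Ω := by
    refine h.isBigO_Ω hz (contDiffWithinAt_const.mul (hH.sub (contDiffWithinAt_const.mul hρ))) ?_
    filter_upwards [hH', hU.eventually_incl hz] with x hx hx'
    rw [hx, h.H_eq hx']; ring
  have h2 : (fun y => L.Ω y ^ q * (L.lam⁻¹ / 12 * L.trT y))
      =O[𝓝[halfSpace] (incl z)] fun _ => (1 : ℝ) :=
    (((hΩ.pow q).mul (contDiffWithinAt_const.mul ht)).continuousWithinAt).isBigO_one ℝ
  have h3 := ((isBigO_refl L.Ω (𝓝[halfSpace] (incl z))).mul h1).add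
    ((((isBigO_refl L.Ω _).pow 2).mul h2).trans (IsBigO.of_bound 1 (Eventually.of_forall fun y => by
      rw [mul_one, one_mul, pow_two])) : _ =O[𝓝[halfSpace] (incl z)] fun y => L.Ω y * L.Ω y)
  refine (h3.congr' ?_ (Eventually.of_forall fun y => (pow_two _).symm))
  filter_upwards [hU.mem_nhdsWithin hz] with y hy
  rw [h.normalSq_expansion hy, hs]
  have h4 := h.inv_sqrt_mul_self
  have h5 : 2 * H y / (3 * √L.lam) = 2 / 3 * H y * (√L.lam)⁻¹ := by
    rw [div_eq_mul_inv, mul_inv]; ring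
  rw [h5]
  linear_combination (-2) * L.rho y * L.Ω y * h4

end LocalSpacetime

lemma LocalSpacetime.T_of_one {L : LocalData} {U : Set (Coord 4)} (h : LocalSpacetime L 1 U)
    {z : Coord 3} (hz : incl z ∈ U) (a b : Fin 4) : L.T (incl z) a b
      = -(L.normal (incl z) a * L.normal (incl z) b * L.trT (incl z)) := by
  have h1 := h.conformalEinstein.ev_T_of_one (bev hz) (h.bev_Ω hz) a b
  rw [(h.isRep_T a b).bev hz, (h.isRep_normal a).bev hz, (h.isRep_normal b).bev hz,
    h.isRep_trT.bev hz]
  simp only [map_smul, smul_eq_mul]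
  have h4 := h.inv_sqrt_mul_self
  have h5 := inv_mul_cancel₀ h.lam_pos.ne'
  linear_combination L.lam⁻¹ * h1 - bev hz (h.conformalEinstein.T a b) * h5
    + bev hz (h.conformalEinstein.t) * bev hz (h.conformalEinstein.dΩ a)
      * bev hz (h.conformalEinstein.dΩ b) * h4

end ConformalInfinity

/-! ### Leading coefficients under the degenerate Laplacian -/

namespace ConformalInfinity

namespace MetricRing

variable {A : Type*} [CommRing A] [Algebra ℝ A] (m : MetricRing A)

/-- `t_{(ab)_0}` -/
def stf (t : Fin 4 → Fin 4 → A) (a b : Fin 4) : A :=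
  (1 / 2 : ℝ) • (t a b + t b a) - (1 / 4 : ℝ) • (m.g a b * m.tr t)

/-- `∇^c ∇_c t_{ab}` -/
def lap (t : Fin 4 → Fin 4 → A) (a b : Fin 4) : A :=
  ∑ c, ∑ d, m.G c d * m.cov3 (m.cov2 t) c d a b

lemma stf_mul (f : A) (t : Fin 4 → Fin 4 → A) (a b : Fin 4) :
    m.stf (fun a b => f * t a b) a b = f * m.stf t a b := by
  have h1 : m.tr (fun a b => f * t a b) = f * m.tr t := by
    simp only [tr, Finset.mul_sum]
    exact Finset.sum_congr rfl fun _ _ => Finset.sum_congr rfl fun _ _ => by ring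
  rw [stf, stf, h1, ← mul_add, mul_sub, mul_smul_comm, mul_smul_comm]
  congr 2; ring

lemma stf_smul (r : ℝ) (t : Fin 4 → Fin 4 → A) (a b : Fin 4) :
    m.stf (fun a b => r • t a b) a b = r • m.stf t a b := by
  simp only [Algebra.smul_def r]
  exact m.stf_mul _ t a b

end MetricRing

namespace ConformalEinstein

variable {A : Type*} [CommRing A] [Algebra ℝ A] {m : MetricRing A} {lam : ℝ} {q : ℕ}
  (c : ConformalEinstein m lam q) (ev : A →ₐ[ℝ] ℝ)

/-- The degenerate Laplacian on tensors of weight `w`. -/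
def degLap (w : ℝ) (t : Fin 4 → Fin 4 → A) (a b : Fin 4) : A :=
  (2 * (w - 1) * √lam) •
      ((√lam)⁻¹ • ∑ i, c.uΩ i * m.cov2 t i a b + ((w - 2) / √lam) • (c.ρ * t a b)
        - (2 * (w - 2) / ((w - 3) * (w + 2)) * (√lam)⁻¹) •
            m.stf (fun i j => c.dΩ i * m.div2 t j) a b
        + (2 / (w - 3) * (√lam)⁻¹) •
          (m.stf (fun i j => ∑ k, c.uΩ k * m.cov2 t i j k) a b
            + m.stf (fun i j => ∑ k, ∑ l, m.G k l * t i k * c.S j l) a b))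
    - (c.Ω * m.lap t a b + (w - 2) • (c.Ω * (m.J * t a b))
        + (8 / ((w - 3) * (w + 2))) • (c.Ω * m.stf (m.cov1 (m.div2 t)) a b)
        - 4 * (c.Ω * m.stf (fun i j => ∑ k, ∑ l, m.G k l * m.P i k * t j l) a b))

/-- `t` vanishes to order `k` on the boundary, and its leading coefficient there has tangential
components `x`, up to a multiple of the metric. -/
def HasLeading (k : ℕ) (t : Fin 4 → Fin 4 → A) (x : Fin 4 → Fin 4 → ℝ) : Prop :=
  ∃ v : Fin 4 → Fin 4 → A, ∃ f : ℝ, (∀ a b, t a b = c.Ω ^ k * v a b) ∧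
    ∀ a b, ev (c.dΩ a) = 0 → ev (c.dΩ b) = 0 → ev (v a b) = x a b + f * ev (m.g a b)

variable {c ev} {k : ℕ} {t t' : Fin 4 → Fin 4 → A} {x x' : Fin 4 → Fin 4 → ℝ}

lemma HasLeading.add (h : c.HasLeading ev k t x) (h' : c.HasLeading ev k t' x') :
    c.HasLeading ev k (fun a b => t a b + t' a b) fun a b => x a b + x' a b := by
  obtain ⟨v, f, h1, h2⟩ := h
  obtain ⟨v', f', h1', h2'⟩ := h'
  refine ⟨fun a b => v a b + v' a b, f + f', fun a b => ?_, fun a b ha hb => ?_⟩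
  · simp only [h1, h1']; ring
  · simp only [map_add, h2 a b ha hb, h2' a b ha hb]; ring

lemma HasLeading.smul (r : ℝ) (h : c.HasLeading ev k t x) :
    c.HasLeading ev k (fun a b => r • t a b) fun a b => r * x a b := by
  obtain ⟨v, f, h1, h2⟩ := h
  refine ⟨fun a b => r • v a b, r * f, fun a b => ?_, fun a b ha hb => ?_⟩
  · simp only [h1, mul_smul_comm]
  · simp only [map_smul, h2 a b ha hb, smul_eq_mul]; ring

lemma HasLeading.sub (h : c.HasLeading ev k t x) (h' : c.HasLeading ev k t' x') :
    c.HasLeading ev k (fun a b => t a b - t' a b) fun a b => x a b - x' a b := by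
  have h1 := h.add (h'.smul (-1))
  simpa only [neg_smul, one_smul, neg_mul, one_mul, ← sub_eq_add_neg] using h1

lemma hasLeading_of_eq (h0 : ev c.Ω = 0) {s r : Fin 4 → Fin 4 → A}
    (h : ∀ a b, t a b = c.Ω ^ k * (s a b + c.Ω * r a b)) :
    c.HasLeading ev k t fun a b => ev (s a b) :=
  ⟨_, 0, h, fun a b _ _ => by simp [h0]⟩

lemma hasLeading_zero (h0 : ev c.Ω = 0) {r : Fin 4 → Fin 4 → A}
    (h : ∀ a b, t a b = c.Ω ^ (k + 1) * r a b) : c.HasLeading ev k t fun _ _ => 0 :=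
  ⟨fun a b => c.Ω * r a b, 0, fun a b => by rw [h]; ring, fun a b _ _ => by simp [h0]⟩

/-- A product with dΩ has no tangential components. Removing the trace adds a multiple of g, which
is why `HasLeading` allows such a term. -/
lemma hasLeading_stf (h0 : ev c.Ω = 0) {s : Fin 4 → A} {r : Fin 4 → Fin 4 → A}
    (h : ∀ a b, t a b = c.Ω ^ k * (c.dΩ a * s b + c.Ω * r a b)) :
    c.HasLeading ev k (m.stf t) fun _ _ => 0 := by
  refine ⟨m.stf fun a b => c.dΩ a * s b + c.Ω * r a b,
    -(1 / 4) * ev (m.tr fun a b => c.dΩ a * s b + c.Ω * r a b), fun a b => ?_, fun a b ha hb => ?_⟩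
  · rw [← m.stf_mul]; congr 1; ext a b; exact h a b
  · rw [MetricRing.stf]
    simp only [map_sub, map_smul, map_add, map_mul, ha, hb, h0, smul_eq_mul]
    ring

lemma HasLeading.congr (h : c.HasLeading ev k t x) (h' : ∀ a b, x a b = x' a b) :
    c.HasLeading ev k t x' := by
  rwa [show x' = x from funext fun a => funext fun b => (h' a b).symm]

lemma HasLeading.Ω_mul_stf (h : c.HasLeading ev k (m.stf fun a b => c.Ω * t a b) x) :
    c.HasLeading ev k (fun a b => c.Ω * m.stf t a b) x := by
  simpa only [← m.stf_mul] using h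

variable (c)

lemma cov2_pow_mul (k : ℕ) (s : Fin 4 → Fin 4 → A) (i a b : Fin 4) :
    m.cov2 (fun a b => c.Ω ^ (k + 1) * s a b) i a b
      = c.Ω ^ k * (((k : ℝ) + 1) • (c.dΩ i * s a b) + c.Ω * m.cov2 s i a b) := by
  rw [m.cov2_mul, D_pow]
  simp only [Algebra.smul_def, map_add, map_natCast, map_one]
  ring

/-- Two terms matter at order k+1: 2(w-1) times the derivative along ∇Ω gives 2(w-1)(k+2)|dΩ|², and
-ΩΔ gives -(k+2)(k+1)|dΩ|², with |dΩ|² = -λ. Every other term is of higher order, or is the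
trace-free symmetrization of a product with dΩ. -/
lemma degLap_hasLeading (hlam : 0 < lam) (h0 : ev c.Ω = 0) (w : ℝ) (k : ℕ)
    (s : Fin 4 → Fin 4 → A) :
    c.HasLeading ev (k + 1) (c.degLap w fun a b => c.Ω ^ (k + 2) * s a b)
      fun a b => -lam * (k + 2) * (2 * (w - 1) - (k + 1)) * ev (s a b) := by
  obtain ⟨t, ht⟩ : ∃ t, t = fun a b => c.Ω ^ (k + 2) * s a b := ⟨_, rfl⟩
  have ht' : ∀ a b, t a b = c.Ω ^ (k + 1 + 1) * s a b := fun a b => by rw [ht]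
  have hcov : ∀ i a b, m.cov2 t i a b
      = c.Ω ^ (k + 1) * (((k : ℝ) + 2) • (c.dΩ i * s a b) + c.Ω * m.cov2 s i a b) := by
    intro i a b
    rw [ht, cov2_pow_mul c (k + 1)]
    push_cast; congr 3; ring
  have hdiv : ∀ a, m.div2 t a
      = c.Ω ^ (k + 1) * (((k : ℝ) + 2) • c.con s a + c.Ω * m.div2 s a) := by
    intro a
    rw [ht, m.div2_mul]
    have : m.up (fun i => m.D i (c.Ω ^ (k + 2))) = fun b => ((k : ℝ) + 2) • (c.Ω ^ (k + 1) * c.uΩ b) := by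
      ext b
      simp only [MetricRing.up, uΩ, dΩ, D_pow c, Finset.mul_sum, Finset.smul_sum]
      refine Finset.sum_congr rfl fun _ _ => ?_
      simp only [Algebra.smul_def, map_add, map_natCast, map_ofNat]
      push_cast; ring
    rw [this, con, mul_add, mul_smul_comm, Finset.mul_sum, Finset.smul_sum]
    congr 1
    · refine Finset.sum_congr rfl fun _ _ => ?_
      rw [mul_smul_comm]; congr 1; ring
    · ring
  have hnorm := c.ev_norm ev h0
  rw [← ht]
  have l1 : c.HasLeading ev (k + 1) (fun a b => ∑ i, c.uΩ i * m.cov2 t i a b)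
      fun a b => -lam * (k + 2) * ev (s a b) := by
    refine (hasLeading_of_eq h0 (s := fun a b => ((k : ℝ) + 2) • ((∑ i, c.dΩ i * c.uΩ i) * s a b))
      (r := fun a b => ∑ i, c.uΩ i * m.cov2 s i a b) fun a b => ?_).congr fun a b => ?_
    · simp only [hcov, Fin.sum_univ_four, Algebra.smul_def]; ring
    · simp only [map_smul, map_mul, map_sum, hnorm, smul_eq_mul]; ring
  have l2 : c.HasLeading ev (k + 1) (fun a b => c.ρ * t a b) fun _ _ => 0 :=
    hasLeading_zero h0 (r := fun a b => c.ρ * s a b) fun a b => by rw [ht']; ring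
  have l3 : c.HasLeading ev (k + 1) (m.stf fun i j => c.dΩ i * m.div2 t j) fun _ _ => 0 :=
    hasLeading_stf h0 (s := fun j => ((k : ℝ) + 2) • c.con s j + c.Ω * m.div2 s j)
      (r := fun _ _ => 0) fun a b => by rw [hdiv]; ring
  have l4 : c.HasLeading ev (k + 1) (m.stf fun i j => ∑ l, c.uΩ l * m.cov2 t i j l)
      fun _ _ => 0 :=
    hasLeading_stf h0 (s := fun j => ((k : ℝ) + 2) • ∑ l, c.uΩ l * s j l)
      (r := fun i j => ∑ l, c.uΩ l * m.cov2 s i j l) fun a b => by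
        simp only [hcov, Fin.sum_univ_four, Algebra.smul_def]; ring
  have l5 : c.HasLeading ev (k + 1)
      (m.stf fun i j => ∑ l, ∑ n, m.G l n * t i l * c.S j n) fun _ _ => 0 :=
    hasLeading_stf h0 (s := 0)
      (r := fun i j => ∑ l, ∑ n, m.G l n * s i l * c.S j n) fun a b => by
        simp only [ht', Finset.mul_sum, Pi.zero_apply, mul_zero, zero_add]
        exact Finset.sum_congr rfl fun _ _ => Finset.sum_congr rfl fun _ _ => by ring
  -- At lowest order each of the two derivatives falls on a power of Ω.
  have l6 : c.HasLeading ev (k + 1) (fun a b => c.Ω * m.lap t a b)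
      fun a b => -lam * (k + 2) * (k + 1) * ev (s a b) := by
    obtain ⟨X, hX⟩ : ∃ X : Fin 4 → Fin 4 → Fin 4 → A, ∀ i a b, X i a b
        = ((k : ℝ) + 2) • (c.dΩ i * s a b) + c.Ω * m.cov2 s i a b := ⟨_, fun _ _ _ => rfl⟩
    have h1 : m.cov2 t = fun i a b => c.Ω ^ (k + 1) * X i a b := by
      ext i a b; rw [hcov, hX]
    have h2 : ∀ e i a b, c.Ω * m.cov3 (m.cov2 t) e i a b
        = c.Ω ^ (k + 1) * (((k : ℝ) + 1) • (c.dΩ e * X i a b) + c.Ω * m.cov3 X e i a b) := by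
      intro e i a b
      rw [h1, m.cov3_mul, D_pow]
      simp only [Algebra.smul_def, map_add, map_natCast, map_one]
      ring
    have h3 : ∀ a b, ∑ i, ∑ j, m.G i j * (((k : ℝ) + 1) • (c.dΩ i * X j a b))
        = ((k : ℝ) + 1) • (((k : ℝ) + 2) • ((∑ i, c.dΩ i * c.uΩ i) * s a b)
          + c.Ω * ∑ i, ∑ j, m.G i j * (c.dΩ i * m.cov2 s j a b)) := by
      intro a b
      simp only [uΩ, MetricRing.up, Finset.mul_sum, Finset.sum_mul, Finset.smul_sum, hX,
        ← Finset.sum_add_distrib, smul_add]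
      refine Finset.sum_congr rfl fun _ _ => Finset.sum_congr rfl fun _ _ => ?_
      simp only [Algebra.smul_def]; ring
    refine (hasLeading_of_eq h0
      (s := fun a b => ((k : ℝ) + 1) • (((k : ℝ) + 2) • ((∑ i, c.dΩ i * c.uΩ i) * s a b)))
      (r := fun a b => ((k : ℝ) + 1) • ∑ i, ∑ j, m.G i j * (c.dΩ i * m.cov2 s j a b)
        + ∑ i, ∑ j, m.G i j * m.cov3 X i j a b) fun a b => ?_).congr fun a b => ?_
    · have h4 : c.Ω * m.lap t a b = c.Ω ^ (k + 1) * (∑ i, ∑ j, m.G i j *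
          (((k : ℝ) + 1) • (c.dΩ i * X j a b)) + c.Ω * ∑ i, ∑ j, m.G i j * m.cov3 X i j a b) := by
        simp only [MetricRing.lap, Finset.mul_sum, ← Finset.sum_add_distrib]
        refine Finset.sum_congr rfl fun i _ => Finset.sum_congr rfl fun j _ => ?_
        rw [mul_left_comm, h2]; ring
      rw [h4, h3]
      simp only [Algebra.smul_def]; ring
    · simp only [map_smul, map_mul, map_sum, hnorm, smul_eq_mul]; ring
  have l7 : c.HasLeading ev (k + 1) (fun a b => c.Ω * (m.J * t a b)) fun _ _ => 0 :=
    hasLeading_zero h0 (r := fun a b => c.Ω * (m.J * s a b)) fun a b => by rw [ht']; ring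
  have l8 : c.HasLeading ev (k + 1) (fun a b => c.Ω * m.stf (m.cov1 (m.div2 t)) a b)
      fun _ _ => 0 := by
    obtain ⟨Y, hY⟩ : ∃ Y : Fin 4 → A, ∀ a, Y a = ((k : ℝ) + 2) • c.con s a + c.Ω * m.div2 s a :=
      ⟨_, fun _ => rfl⟩
    have h1 : m.div2 t = fun a => c.Ω ^ (k + 1) * Y a := by
      ext a; rw [hdiv, hY]
    refine HasLeading.Ω_mul_stf (hasLeading_stf h0 (s := fun a => ((k : ℝ) + 1) • Y a)
      (r := fun e a => m.cov1 Y e a) fun e a => ?_)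
    rw [h1, m.cov1_mul, D_pow]
    simp only [Algebra.smul_def, map_add, map_natCast, map_one]
    ring
  have l9 : c.HasLeading ev (k + 1) (fun a b => c.Ω * m.stf (fun i j => ∑ l, ∑ n,
      m.G l n * m.P i l * t j n) a b) fun _ _ => 0 :=
    HasLeading.Ω_mul_stf (hasLeading_stf h0 (s := 0)
      (r := fun i j => c.Ω * ∑ l, ∑ n, m.G l n * m.P i l * s j n) fun a b => by
        simp only [ht', Finset.mul_sum, Pi.zero_apply, mul_zero, zero_add]
        exact Finset.sum_congr rfl fun _ _ => Finset.sum_congr rfl fun _ _ => by ring)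
  have h4 : ∀ x : A, (4 : ℝ) • x = 4 * x := fun x => by
    rw [Algebra.smul_def, map_ofNat]
  have := ((((l1.smul (√lam)⁻¹).add (l2.smul ((w - 2) / √lam))).sub
    (l3.smul (2 * (w - 2) / ((w - 3) * (w + 2)) * (√lam)⁻¹))).add
    ((l4.add l5).smul (2 / (w - 3) * (√lam)⁻¹))).smul (2 * (w - 1) * √lam) |>.sub
    (((l6.add (l7.smul (w - 2))).add (l8.smul (8 / ((w - 3) * (w + 2))))).sub (l9.smul 4))
  simp only [h4] at this
  refine HasLeading.congr this fun a b => ?_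
  have h5 : √lam * (√lam)⁻¹ = 1 := mul_inv_cancel₀ (Real.sqrt_pos.mpr hlam).ne'
  linear_combination (2 * (w - 1) * (-lam * (k + 2) * ev (s a b))) * h5

end ConformalEinstein
end ConformalInfinity

/-! ### The third and fifth conformal fundamental forms -/

namespace ConformalInfinity

open SmoothFn

lemma SmoothFn.IsRep.congr {U : Set (Coord 4)} {F F' : Coord 4 → ℝ} {f : SmoothFn U}
    (h : IsRep F f) (h' : ∀ y, F' y = F y) : IsRep F' f := fun y => (h' y).trans (h y)

lemma isRep_stf {U : Set (Coord 4)} {g : Tensor2 4} (h : IsSmoothMetric U g) {r : Tensor2 4}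
    {r' : Fin 4 → Fin 4 → SmoothFn U} (hr : ∀ a b, IsRep (fun y => r y a b) (r' a b))
    (a b : Fin 4) : IsRep (fun y => symTraceFree g r y a b) (h.ring.stf r' a b) :=
  ((((hr a b).add (hr b a)).const_mul _).sub
    (((h.isRep_g a b).mul (h.isRep_trace2 hr)).const_mul _)).congr fun y => by
    rw [symTraceFree]; push_cast; ring

lemma isRep_lap {U : Set (Coord 4)} {g : Tensor2 4} (h : IsSmoothMetric U g) {r : Tensor2 4}
    {r' : Fin 4 → Fin 4 → SmoothFn U} (hr : ∀ a b, IsRep (fun y => r y a b) (r' a b))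
    (a b : Fin 4) : IsRep (fun y => laplacian2 halfSpace g r y a b) (h.ring.lap r' a b) :=
  IsRep.sum _ fun c => IsRep.sum _ fun d => (h.isRep_G c d).mul
    (h.isRep_cov3 (h.isRep_cov2 hr) c d a b)

lemma symTraceFree_of_eq {g t r : Tensor2 3} {z : Coord 3} (hg : ∀ i j, g z i j = g z j i)
    (htr : trace2 g g z = 3) (k f : ℝ) (h : ∀ i j, t z i j = k * r z i j + f * g z i j)
    (i j : Fin 3) : symTraceFree g t z i j = k * symTraceFree g r z i j := by
  have h1 : trace2 g t z = k * trace2 g r z + 3 * f := by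
    rw [mul_comm 3, ← htr]
    simp only [trace2, h, Finset.mul_sum, ← Finset.sum_add_distrib]
    exact Finset.sum_congr rfl fun _ _ => Finset.sum_congr rfl fun _ _ => by ring
  rw [symTraceFree, symTraceFree, h1, h, h, hg j i]
  push_cast; ring

namespace LocalSpacetime

variable {L : LocalData} {q : ℕ} {U : Set (Coord 4)} (h : LocalSpacetime L q U)
include h

lemma isRep_S (a b : Fin 4) : IsRep (fun y => L.hessΩ y a b) (h.conformalEinstein.S a b) :=
  h.isRep_hessΩ a b

lemma isRep_E (a b : Fin 4) : IsRep (fun y => L.E y a b) (h.conformalEinstein.E a b) :=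
  (((h.isRep_S a b).add (h.isRep_Ω.mul (h.metric.isRep_schouten a b))).add
    (h.isRep_ρ.mul (h.metric.isRep_g a b))).congr fun y => by
    rw [LocalData.E, LocalData.rho, LocalData.P]; ring

lemma isRep_normalCov2 {r : Tensor2 4} {r' : Fin 4 → Fin 4 → SmoothFn U}
    (hr : ∀ a b, IsRep (fun y => r y a b) (r' a b)) (a b : Fin 4) :
    IsRep (fun y => L.normalCov2 r y a b)
      ((√L.lam)⁻¹ • ∑ i, h.conformalEinstein.uΩ i * h.ring.cov2 r' i a b) := by
  rw [Finset.smul_sum]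
  simp only [← smul_mul_assoc]
  exact IsRep.sum _ fun i => (h.isRep_normalUp i).mul (h.metric.isRep_cov2 hr i a b)

lemma isRep_degLaplacian (w : ℝ) {r : Tensor2 4} {r' : Fin 4 → Fin 4 → SmoothFn U}
    (hr : ∀ a b, IsRep (fun y => r y a b) (r' a b)) (a b : Fin 4) :
    IsRep (fun y => L.degLaplacian w r y a b) (h.conformalEinstein.degLap w r' a b) := by
  have l3 : IsRep (fun y => symTraceFree L.g
      (fun x i j => L.normal x i * div2 halfSpace L.g r x j) y a b)
      ((√L.lam)⁻¹ • h.ring.stf (fun i j => h.conformalEinstein.dΩ i * h.ring.div2 r' j) a b) := by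
    rw [← MetricRing.stf_smul]
    simp only [← smul_mul_assoc]
    exact isRep_stf h.metric (fun i j => (h.isRep_normal i).mul (h.metric.isRep_div2 hr j)) a b
  have l4 : IsRep (fun y => symTraceFree L.g
      (fun x i j => ∑ c, L.normalUp x c * cov2 halfSpace L.g r x i j c) y a b)
      ((√L.lam)⁻¹ • h.ring.stf (fun i j => ∑ k, h.conformalEinstein.uΩ k * h.ring.cov2 r' i j k)
        a b) := by
    rw [← MetricRing.stf_smul]
    simp only [Finset.smul_sum, ← smul_mul_assoc]
    exact isRep_stf h.metric (fun i j => IsRep.sum _ fun c =>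
      (h.isRep_normalUp c).mul (h.metric.isRep_cov2 hr i j c)) a b
  have l5 : IsRep (fun y => symTraceFree L.g
      (fun x i j => ∑ c, ∑ d, invMetric L.g x c d * r x i c *
        cov1 halfSpace L.g L.normal x j d) y a b)
      ((√L.lam)⁻¹ • h.ring.stf (fun i j => ∑ k, ∑ l,
        h.ring.G k l * r' i k * h.conformalEinstein.S j l) a b) := by
    rw [← MetricRing.stf_smul]
    simp only [Finset.smul_sum, ← mul_smul_comm]
    exact isRep_stf h.metric (fun i j => IsRep.sum _ fun c => IsRep.sum _ fun d =>
      ((h.metric.isRep_G c d).mul (hr i c)).mul (h.isRep_K j d)) a b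
  have l9 : IsRep (fun y => symTraceFree L.g
      (fun x i j => ∑ c, ∑ d, invMetric L.g x c d * L.P x i c * r x j d) y a b)
      (h.ring.stf (fun i j => ∑ k, ∑ l, h.ring.G k l * h.ring.P i k * r' j l) a b) :=
    isRep_stf h.metric (fun i j => IsRep.sum _ fun c => IsRep.sum _ fun d =>
      ((h.metric.isRep_G c d).mul (h.metric.isRep_schouten i c)).mul (hr j d)) a b
  have l8 := isRep_stf h.metric (h.metric.isRep_cov1 (h.metric.isRep_div2 hr)) a b
  have l1 := h.isRep_normalCov2 hr a b
  have l6 := isRep_lap h.metric hr a b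
  intro y
  have hρ := h.isRep_ρ y
  have hJ := h.metric.isRep_schoutenTrace y
  have hΩ := h.isRep_Ω y
  have ht := hr a b y
  have h1 := l1 y
  have h3 := l3 y
  have h4 := l4 y
  have h5 := l5 y
  have h6 := l6 y
  have h8 := l8 y
  have h9 := l9 y
  simp only [map_smul, smul_eq_mul] at h1 h3 h4 h5
  simp only [ConformalEinstein.degLap, LocalData.degLaplacian, LocalData.J, map_sub, map_add,
    map_smul, map_mul, smul_eq_mul, map_ofNat, hρ, hJ, hΩ, ht, h1, h3, h4, h5, h6, h8, h9]
  ring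

variable {z : Coord 3} (hz : incl z ∈ U)

lemma normalUp_incl (a : Fin 4) :
    L.normalUp (incl z) a = (√L.lam)⁻¹ * bev hz (h.conformalEinstein.uΩ a) := by
  rw [(h.isRep_normalUp a).bev hz, map_smul, smul_eq_mul]

omit h in
lemma inv_sqrt_mul_lam : (√L.lam)⁻¹ * L.lam = √L.lam := by
  rw [inv_mul_eq_div, Real.div_sqrt]

/-- The conformal Robin operator on a tensor which vanishes on the boundary. -/
lemma robin_of_eq_Ω_mul (w : ℝ) {r : Tensor2 4} {s : Fin 4 → Fin 4 → SmoothFn U}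
    (hr : ∀ a b, IsRep (fun y => r y a b) (h.conformalEinstein.Ω * s a b)) (k f : ℝ)
    (hs : ∀ i j : Fin 3, bev hz (s i.succ j.succ)
      = k * L.T (incl z) i.succ j.succ + f * L.g (incl z) i.succ j.succ) (i j : Fin 3) :
    L.robin w r z i j = -√L.lam * k * L.tfProj L.T z i j := by
  have hr0 : ∀ x, incl x ∈ U → ∀ a b, r (incl x) a b = 0 := fun x hx a b => by
    rw [(hr a b).bev hx, map_mul, h.bev_Ω hx, zero_mul]
  -- The tensor vanishes all along Σ, so the intrinsic derivative and the H term drop out, and the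
  -- weight plays no role.
  have h1 : ∀ i j, cov1 univ L.bg (pull1 fun y a => ∑ c, r y a c * L.normalUp y c) z i j = 0 := by
    intro i j
    have h2 : ∀ j x, incl x ∈ U → pull1 (fun y a => ∑ c, r y a c * L.normalUp y c) x j = 0 := by
      intro j x hx
      simp [pull1, hr0 x hx]
    rw [cov1, pderiv_univ_of_eventually_zero
      ((h.metric.isRelOpen.eventually_incl hz).mono fun x hx => h2 j x hx)]
    simp [h2 _ z hz]
  have h3 : ∀ a b, L.normalCov2 r (incl z) a b = -√L.lam * bev hz (s a b) := by
    intro a b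
    have h4 := h.conformalEinstein.ev_norm (bev hz) (h.bev_Ω hz)
    have h5 : ∀ c, bev hz (h.ring.cov2 (fun a b => h.conformalEinstein.Ω * s a b) c a b)
        = bev hz (h.conformalEinstein.dΩ c) * bev hz (s a b) := by
      intro c
      rw [MetricRing.cov2_mul, map_add, map_mul, map_mul, h.bev_Ω hz, zero_mul, add_zero]
      rfl
    rw [(h.isRep_normalCov2 hr a b).bev hz, map_smul, map_sum, smul_eq_mul]
    simp only [map_mul, h5]
    have h6 := inv_sqrt_mul_lam (L := L)
    simp only [Fin.sum_univ_four] at h4 ⊢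
    linear_combination (√L.lam)⁻¹ * bev hz (s a b) * h4 - bev hz (s a b) * h6
  rw [LocalData.robin, LocalData.tfProj]
  refine symTraceFree_of_eq (fun i j => h.metric.symm _ hz _ _) (h.trace2_bg_g hz) _
    (-√L.lam * f) (fun i j => ?_) i j
  simp only [h1, pull2, h3, hs, hr0 z hz, mul_zero, add_zero, sub_zero]
  simp only [LocalData.bg, pull2]
  ring

lemma bev_σ (a b : Fin 4) : bev hz (h.conformalEinstein.σ a b)
    = 1 / 2 * L.T (incl z) a b + -(1 / 8) * L.trT (incl z) * L.g (incl z) a b := by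
  have h1 := congrArg (bev hz) (h.conformalEinstein.eight_σ a b)
  simp only [map_mul, map_sub, map_ofNat] at h1
  rw [(h.isRep_T a b).bev hz, h.isRep_trT.bev hz, (h.metric.isRep_g a b).bev hz]
  linear_combination h1 / 8

end LocalSpacetime

namespace LocalSpacetime

variable {L : LocalData} {U : Set (Coord 4)} {z : Coord 3} (hz : incl z ∈ U)
include hz

/-- The third conformal fundamental form. -/
lemma fundForm_three (h : LocalSpacetime L 0 U) (i j : Fin 3) :
    L.fundForm 3 z i j = -(1 / 2) * √L.lam * L.tfProj L.T z i j := by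
  have h1 : L.fundForm 3 = L.robin (4 - (3 : ℕ)) L.E := by
    simp [LocalData.fundForm, LocalData.degLaplacianPowE]
  rw [h1, h.robin_of_eq_Ω_mul hz _ (s := h.conformalEinstein.σ) (fun a b => ?_) (1 / 2)
    (-(1 / 8) * L.trT (incl z)) fun i j => h.bev_σ hz _ _]
  · ring
  · have := h.isRep_E a b
    rwa [h.conformalEinstein.E_eq, zero_add, pow_one] at this

/-- The fifth conformal fundamental form. -/
lemma fundForm_five (h : LocalSpacetime L 2 U) (i j : Fin 3) :
    L.fundForm 5 z i j = -18 * (L.lam ^ 2 * √L.lam) * L.tfProj L.T z i j := by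
  have h1 : L.fundForm 5 = L.robin (4 - (5 : ℕ)) (L.degLaplacian 0 (L.degLaplacian 1 L.E)) := by
    simp [LocalData.fundForm, LocalData.degLaplacianPowE]
  have h0 := h.bev_Ω hz
  have hE : h.conformalEinstein.E = fun a b =>
      h.conformalEinstein.Ω ^ (1 + 2) * h.conformalEinstein.σ a b := by
    ext1 a; ext1 b; exact h.conformalEinstein.E_eq a b
  -- At weight 1 and with k = 1 the order drops from 3 to 2, with factor 6λ. At weight 0 and with k
  -- = 0 it drops from 2 to 1, again with factor 6λ.
  obtain ⟨v, f, hv, hv'⟩ := h.conformalEinstein.degLap_hasLeading (ev := bev hz) h.lam_pos h0 1 1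
    h.conformalEinstein.σ
  obtain ⟨s, f', hs, hs'⟩ := h.conformalEinstein.degLap_hasLeading (ev := bev hz) h.lam_pos h0 0 0 v
  have hv2 : h.conformalEinstein.degLap 1 h.conformalEinstein.E = fun a b =>
      h.conformalEinstein.Ω ^ (0 + 2) * v a b := by
    ext1 a; ext1 b; rw [hE]; exact hv a b
  have hr := h.isRep_degLaplacian 0 (h.isRep_degLaplacian 1 h.isRep_E)
  -- As σ is T/2 up to a multiple of g, (6λ)² becomes 18λ². The second constant collects the
  -- multiples of g, which the trace-free projection removes.
  rw [h1, h.robin_of_eq_Ω_mul hz _ (s := s) (fun a b => ?_) (18 * L.lam ^ 2)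
    (36 * L.lam ^ 2 * (-(1 / 8) * L.trT (incl z)) + 6 * L.lam * f + f') fun i j => ?_]
  · ring
  · have := hr a b
    rwa [hv2, hs, zero_add, pow_one] at this
  · have e1 := hv' i.succ j.succ (h.bev_dΩ_succ hz i) (h.bev_dΩ_succ hz j)
    have e2 := hs' i.succ j.succ (h.bev_dΩ_succ hz i) (h.bev_dΩ_succ hz j)
    simp only [e2, e1, h.bev_σ hz, h.bev_g]
    push_cast
    ring

end LocalSpacetime
end ConformalInfinity

/-! ### The fourth conformal fundamental form and its divergence -/

namespace ConformalInfinity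

open SmoothFn

lemma MetricRing.cov2_transpose {A : Type*} [CommRing A] [Algebra ℝ A] (m : MetricRing A)
    (t : Fin 4 → Fin 4 → A) (c a b : Fin 4) :
    m.cov2 (fun a b => t b a) c a b = m.cov2 t c b a := by
  rw [cov2, cov2]; ring

lemma MetricRing.cov2_smul {A : Type*} [CommRing A] [Algebra ℝ A] (m : MetricRing A) (r : ℝ)
    (t : Fin 4 → Fin 4 → A) (c a b : Fin 4) :
    m.cov2 (fun a b => r • t a b) c a b = r • m.cov2 t c a b := by
  simp only [cov2, Derivation.map_smul, mul_smul_comm, ← Finset.smul_sum, ← smul_sub]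

namespace LocalSpacetime

variable {L : LocalData} {U : Set (Coord 4)} {z : Coord 3} {p : ℕ}
  (h : LocalSpacetime L (p + 1) U) (hz : incl z ∈ U)
include h hz

/-- Pair symmetry moves the normal into the third slot, where `ev_V` applies. -/
lemma weylMagnetic_eq_zero (i j k : Fin 3) : L.weylMagnetic z i j k = 0 := by
  have h1 := h.conformalEinstein.ev_V (bev hz) (h.bev_Ω hz) j.succ k.succ i.succ
  have h2 : ∑ d, L.normalUp (incl z) d * weyl halfSpace L.g (incl z) d i.succ j.succ k.succ
      = (√L.lam)⁻¹ * bev hz (h.conformalEinstein.V j.succ k.succ i.succ) := by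
    rw [ConformalEinstein.V, map_sum, Finset.mul_sum]
    refine Finset.sum_congr rfl fun d _ => ?_
    rw [h.normalUp_incl hz, (h.metric.isRep_weyl d i.succ j.succ k.succ).bev hz,
      MetricRing.weyl_symm_pair, map_mul]
    ring
  rw [LocalData.weylMagnetic, pull3, h2, h1, mul_zero]

lemma weylElectric_eq_zero (i j : Fin 3) : L.weylElectric z i j = 0 := by
  have h1 := fun c => h.conformalEinstein.ev_V (bev hz) (h.bev_Ω hz) c i.succ j.succ
  have h2 : ∀ c, ∑ d, L.normalUp (incl z) c * L.normalUp (incl z) d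
      * weyl halfSpace L.g (incl z) c i.succ d j.succ
      = L.normalUp (incl z) c * (√L.lam)⁻¹
        * bev hz (h.conformalEinstein.V c i.succ j.succ) := by
    intro c
    rw [ConformalEinstein.V, map_sum, Finset.mul_sum]
    refine Finset.sum_congr rfl fun d _ => ?_
    rw [h.normalUp_incl hz d, (h.metric.isRep_weyl c i.succ d j.succ).bev hz, map_mul]
    ring
  rw [LocalData.weylElectric, pull2]
  exact Finset.sum_eq_zero fun c _ => by rw [h2, h1, mul_zero]

lemma cottonNormal_eq (i j : Fin 3) : L.cottonNormal z i j
    = (√L.lam)⁻¹ * bev hz (h.conformalEinstein.B i.succ j.succ) := by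
  rw [LocalData.cottonNormal, pull2, ConformalEinstein.B, map_sum, Finset.mul_sum]
  refine Finset.sum_congr rfl fun c _ => ?_
  rw [h.normalUp_incl hz, (h.metric.isRep_cotton i.succ c j.succ).bev hz, map_mul]
  ring

/-- The magnetic part vanishes along Σ, hence so does its intrinsic divergence; the electric part
vanishes as well. -/
lemma fourthForm_eq_cottonNormal (i j : Fin 3) : L.fourthForm z i j
    = -L.lam * ((1 / 2) * (L.cottonNormal z i j + L.cottonNormal z j i)) := by
  have h1 : ∀ᶠ x in 𝓝 z, ∀ i j k, L.weylMagnetic x i j k = 0 :=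
    (h.metric.isRelOpen.eventually_incl hz).mono fun x hx => h.weylMagnetic_eq_zero hx
  have h2 : ∀ l i j k, cov3 univ L.bg L.weylMagnetic z l i j k = 0 := by
    intro l i j k
    rw [cov3, pderiv_univ_of_eventually_zero (h1.mono fun x hx => hx i j k)]
    simp [h.weylMagnetic_eq_zero hz]
  rw [LocalData.fourthForm, h.weylElectric_eq_zero hz]
  simp only [h2]
  simp

/-- The indices of B are exchanged so that `div2`, which contracts the last slot, meets the first
slot of B, the one for which `ev_div_B` holds. -/
lemma fourthForm_eq (hp : p ≤ 1) (i j : Fin 3) : L.fourthForm z i j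
    = -√L.lam * bev hz (h.conformalEinstein.B j.succ i.succ) := by
  rw [h.fourthForm_eq_cottonNormal hz, h.cottonNormal_eq hz, h.cottonNormal_eq hz,
    h.conformalEinstein.ev_B_symm (bev hz) (h.bev_Ω hz) hp i.succ]
  linear_combination (-bev hz (h.conformalEinstein.B j.succ i.succ)) * inv_sqrt_mul_lam (L := L)

/-- B is tangential on Σ, so `cov2_bg` reduces ∇̄B to ∇B. The boundary inverse metric is g^{ab} +
λ⁻¹∇^aΩ∇^bΩ; its first part contributes the ambient divergence, which is zero. -/
lemma div_fourthForm (hp : p ≤ 1) (i : Fin 3) : div2 univ L.bg (L.fundForm 4) z i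
    = -√L.lam * L.lam⁻¹ * ∑ e, ∑ a, bev hz (h.conformalEinstein.uΩ e)
      * bev hz (h.conformalEinstein.uΩ a)
      * bev hz (h.ring.cov2 h.conformalEinstein.B e a i.succ) := by
  have hf : L.fundForm 4 = L.fourthForm := by simp [LocalData.fundForm]
  have hrep : ∀ a b, IsRep (fun y => extendZero
      ((-√L.lam) • h.conformalEinstein.B b a : SmoothFn U).1 y)
      ((-√L.lam) • h.conformalEinstein.B b a) := fun a b => isRep_extendZero _
  obtain ⟨r, hr⟩ : ∃ r : Tensor2 4, ∀ a b, IsRep (fun y => r y a b)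
      ((-√L.lam) • h.conformalEinstein.B b a) := ⟨fun y a b => _, hrep⟩
  have h1 : ∀ᶠ x in 𝓝 z, ∀ i j, L.fourthForm x i j = pull2 r x i j := by
    filter_upwards [h.metric.isRelOpen.eventually_incl hz] with x hx i j
    rw [h.fourthForm_eq hx hp, pull2, (hr _ _).bev hx, map_smul, smul_eq_mul]
  have h2 := fun b => h.conformalEinstein.ev_sum_uΩ_B (bev hz) (h.bev_Ω hz) hp b
  have h3 := fun b => h.conformalEinstein.ev_sum_B_uΩ (bev hz) b
  have h4 : ∀ k l, cov2 univ L.bg (pull2 r) z k i l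
      = -√L.lam * bev hz (h.ring.cov2 h.conformalEinstein.B k.succ l.succ i.succ) := by
    intro k l
    rw [h.cov2_bg hz hr, MetricRing.cov2_smul, MetricRing.cov2_transpose, map_smul, smul_eq_mul]
    · intro b
      simp only [map_smul, smul_eq_mul, mul_left_comm _ (-√L.lam), ← Finset.mul_sum]
      rw [Finset.sum_congr rfl fun a _ => mul_comm _ _, h3, mul_zero]
    · intro b
      simp only [map_smul, smul_eq_mul, mul_left_comm _ (-√L.lam), ← Finset.mul_sum]
      rw [h2, mul_zero]
  rw [hf, div2_univ_congr h1, div2]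
  simp only [h4, h.invMetric_bg hz]
  have h5 := h.sum_tangG hz fun k l => -√L.lam
    * bev hz (h.ring.cov2 h.conformalEinstein.B k l i.succ)
  rw [h5]
  have h6 := h.conformalEinstein.ev_div_B (bev hz) (h.bev_Ω hz) i.succ
  have h7 : ∀ e a, h.tangG hz e a * (-√L.lam * bev hz (h.ring.cov2 h.conformalEinstein.B e a i.succ))
      = -√L.lam * (bev hz (h.ring.G e a) * bev hz (h.ring.cov2 h.conformalEinstein.B e a i.succ))
        + -√L.lam * L.lam⁻¹ * (bev hz (h.conformalEinstein.uΩ e)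
      * bev hz (h.conformalEinstein.uΩ a)
      * bev hz (h.ring.cov2 h.conformalEinstein.B e a i.succ)) := by
    intro e a
    rw [tangG]; ring
  simp only [h7, Finset.sum_add_distrib, ← Finset.mul_sum, h6, mul_zero, zero_add]

end LocalSpacetime

namespace LocalSpacetime

variable {L : LocalData} {U : Set (Coord 4)} {z : Coord 3} (hz : incl z ∈ U)
include hz

lemma div_fourthForm_of_two (h : LocalSpacetime L 2 U) (i : Fin 3) :
    div2 univ L.bg (L.fundForm 4) z i = -L.lam ^ 2 * pull1 L.Tn z i := by
  rw [h.div_fourthForm (p := 1) hz le_rfl, h.conformalEinstein.ev_normal_cov_B_of_two (bev hz)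
    (h.bev_Ω hz) _ (h.bev_dΩ_succ hz i), pull1, (h.isRep_Tn _).bev hz, map_smul, smul_eq_mul]
  have h1 := inv_sqrt_mul_lam (L := L)
  have h2 := inv_mul_cancel₀ h.lam_pos.ne'
  linear_combination L.lam * bev hz (h.conformalEinstein.con h.conformalEinstein.T i.succ) * h1
    - √L.lam * L.lam * bev hz (h.conformalEinstein.con h.conformalEinstein.T i.succ) * h2

lemma div_fourthForm_of_one (h : LocalSpacetime L 1 U) (i : Fin 3) :
    div2 univ L.bg (L.fundForm 4) z i = L.lam * √L.lam
      * ((1 / 3) * pderiv univ (fun x => L.trT (incl x)) z i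
        - div2 halfSpace L.g L.T (incl z) i.succ) := by
  rw [h.div_fourthForm (p := 0) hz zero_le_one, h.conformalEinstein.ev_normal_cov_B_of_one (bev hz)
    (h.bev_Ω hz) _ (h.bev_dΩ_succ hz i), (h.isRep_div2_T _).bev hz,
    h.isRep_trT.pderiv_incl h.metric.isRelOpen hz]
  have h2 := inv_mul_cancel₀ h.lam_pos.ne'
  have h3 : ev ⟨incl z, hz⟩ (partialD h.metric.isRelOpen i.succ h.conformalEinstein.t)
    = bev hz (h.ring.D i.succ h.conformalEinstein.t) := rfl
  rw [h3]
  linear_combination - √L.lam * L.lam * (bev hz (h.conformalEinstein.divT i.succ)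
    - 1 / 3 * bev hz (h.ring.D i.succ h.conformalEinstein.t)) * h2

end LocalSpacetime
end ConformalInfinity

/-! ### The current for decay rate one -/

namespace ConformalInfinity

open SmoothFn

namespace LocalSpacetime

variable {L : LocalData} {U : Set (Coord 4)} {z : Coord 3}

/-- Divide by Ω at interior points and let them tend to the boundary point. This makes the boundary
value of j unique. -/
lemma eq_of_isBigO {q : ℕ} (h : LocalSpacetime L q U) (hz : incl z ∈ U) {f : Coord 4 → ℝ}
    (hf : ContinuousWithinAt f halfSpace (incl z))
    (hO : (fun y => L.Ω y * f y) =O[𝓝[halfSpace] (incl z)] fun y => L.Ω y ^ 2) :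
    f (incl z) = 0 := by
  have hU := h.metric.isRelOpen
  have hsub : interior U ⊆ halfSpace := interior_subset.trans hU.subset
  have hne : (𝓝[interior U] (incl z)).NeBot :=
    mem_closure_iff_nhdsWithin_neBot.mp (hU.mem_closure_interior hz)
  have hle : 𝓝[interior U] (incl z) ≤ 𝓝[halfSpace] (incl z) := nhdsWithin_mono _ hsub
  have hpos : ∀ y ∈ interior U, 0 < L.Ω y := fun y hy => by
    refine h.Ω_pos (interior_subset hy) ?_
    have h1 : y ∈ interior halfSpace := interior_mono hU.subset hy
    rwa [halfSpace, interior_range_modelWithCornersEuclideanHalfSpace] at h1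
  have hΩ : Tendsto L.Ω (𝓝[interior U] (incl z)) (𝓝 0) := by
    have h1 := (h.smooth_Ω.contDiffWithinAt_halfSpace hU hz).continuousWithinAt
    rw [ContinuousWithinAt, h.Ω_incl hz] at h1
    exact h1.mono_left hle
  have h1 : f =O[𝓝[interior U] (incl z)] L.Ω := by
    obtain ⟨C, hC⟩ := (hO.mono hle).bound
    refine IsBigO.of_bound C ?_
    filter_upwards [hC, self_mem_nhdsWithin] with y h2 h3
    have h4 := hpos y h3
    rw [Real.norm_eq_abs, Real.norm_eq_abs, abs_mul, abs_pow, abs_of_pos h4] at h2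
    rw [Real.norm_eq_abs, Real.norm_eq_abs, abs_of_pos h4]
    exact le_of_mul_le_mul_left (by linarith) h4
  exact tendsto_nhds_unique (hf.mono_left hle) (h1.trans_tendsto hΩ)

variable (h : LocalSpacetime L 1 U)
include h

/-- The current `j_a` for `q = 1`. -/
def current (_h : LocalSpacetime L 1 U) : Tensor1 4 := fun y a =>
  (√L.lam)⁻¹ * (div2 halfSpace L.g L.T y a
    - L.normal y a * (∑ b, div2 halfSpace L.g L.T y b * L.normalUp y b) / L.normalSq y)

/-- For q = 1 the conservation law reads n^b T_ab = n_a T + λ^{-1/2} Ω (div T)_a. The projection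
removes the first term, so the expansion has no remainder. -/
lemma TnProj_eq {y : Coord 4} (hy : y ∈ U) (hn : L.normalSq y ≠ 0) (a : Fin 4) :
    L.TnProj y a = L.Ω y * h.current y a := by
  have h1 : ∀ a, L.Tn y a = L.normal y a * L.trT y
      + (√L.lam)⁻¹ * L.Ω y * div2 halfSpace L.g L.T y a := by
    intro a
    have := h.constraint_eq hy a
    rw [LocalData.constraint] at this
    push_cast at this
    linarith
  have h2 : L.Tnn y = L.normalSq y * L.trT y
      + (√L.lam)⁻¹ * L.Ω y * ∑ b, div2 halfSpace L.g L.T y b * L.normalUp y b := by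
    simp only [LocalData.Tnn, LocalData.normalSq, h1, Finset.sum_mul, Finset.mul_sum,
      ← Finset.sum_add_distrib]
    exact Finset.sum_congr rfl fun _ _ => by ring
  rw [LocalData.TnProj, h2, h1, current]
  field_simp
  ring

variable (hz : incl z ∈ U)
include hz

lemma normalSq_incl : L.normalSq (incl z) = -1 := by
  rw [h.normalSq_expansion hz, h.Ω_incl hz]; ring

lemma contDiffWithinAt_normalSq : ContDiffWithinAt ℝ ∞ L.normalSq halfSpace (incl z) :=
  (IsRep.sum (F := fun a y => L.normal y a * L.normalUp y a) Finset.univ fun a =>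
    (h.isRep_normal a).mul (h.isRep_normalUp a)).contDiffOn.contDiffWithinAt_halfSpace
      h.metric.isRelOpen hz

lemma isCurrentAt_current : L.IsCurrentAt z h.current := by
  have hU := h.metric.isRelOpen
  have hn := h.contDiffWithinAt_normalSq hz
  have h0 : L.normalSq (incl z) ≠ 0 := by rw [h.normalSq_incl hz]; norm_num
  refine ⟨fun a => ?_, fun a => ?_⟩
  · have h1 := (h.isRep_div2_T a).contDiffOn.contDiffWithinAt_halfSpace hU hz
    have h2 := ((h.isRep_normal a).mul (IsRep.sum Finset.univ fun b =>
      (h.isRep_div2_T b).mul (h.isRep_normalUp b))).contDiffOn.contDiffWithinAt_halfSpace hU hz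
    exact contDiffWithinAt_const.mul (h1.sub (h2.div hn h0))
  · refine (isBigO_zero _ _).congr' ?_ EventuallyEq.rfl
    filter_upwards [hU.mem_nhdsWithin hz, hn.continuousWithinAt.eventually_ne h0] with y h1 h2
    rw [h.TnProj_eq h1 h2, sub_self]

lemma current_eq {j : Tensor1 4} (hj : L.IsCurrentAt z j) (a : Fin 4) :
    j (incl z) a = h.current (incl z) a := by
  have h0 := h.isCurrentAt_current hz
  refine sub_eq_zero.mp (h.eq_of_isBigO hz (f := fun y => j y a - h.current y a)
    ((hj.1 a).continuousWithinAt.sub (h0.1 a).continuousWithinAt) ?_)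
  refine ((h0.2 a).sub (hj.2 a)).congr_left fun y => by ring

/-- The normal has no tangential components on Σ, so √λ j and div T have the same tangential part
there. -/
lemma div_fourthForm_current {j : Tensor1 4} (hj : L.IsCurrentAt z j) (i : Fin 3) :
    div2 univ L.bg (L.fundForm 4) z i = L.lam * √L.lam
      * ((1 / 3) * pderiv univ (fun x => L.trT (incl x)) z i - √L.lam * pull1 j z i) := by
  have h1 : L.normal (incl z) i.succ = 0 := by
    rw [(h.isRep_normal i.succ).bev hz, map_smul, h.bev_dΩ_succ hz, smul_zero]
  have h2 := mul_inv_cancel₀ (h.sqrt_lam_pos).ne'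
  rw [h.div_fourthForm_of_one hz, pull1, h.current_eq hz hj, current, h1]
  linear_combination L.lam * √L.lam * div2 halfSpace L.g L.T (incl z) i.succ * h2

end LocalSpacetime
end ConformalInfinity

/-! ### From the manifold to its charts -/

namespace ConformalInfinity

/-! ### Locality of the curvature -/

section Congr

variable {U : Set (Coord 4)} (hU : IsRelOpen U)
include hU

lemma IsRelOpen.pderiv_congr {F F' : Coord 4 → ℝ} (h : ∀ x ∈ U, F x = F' x) {y : Coord 4}
    (hy : y ∈ U) (i : Fin 4) : pderiv halfSpace F y i = pderiv halfSpace F' y i := by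
  rw [pderiv, pderiv, Filter.EventuallyEq.fderivWithin_eq
    (Filter.eventually_of_mem (hU.mem_nhdsWithin hy) h) (h y hy)]

variable {g g' : Tensor2 4} (h : ∀ x ∈ U, ∀ a b, g x a b = g' x a b)
include h

omit hU in
lemma invMetric_congr {y : Coord 4} (hy : y ∈ U) (a b : Fin 4) :
    invMetric g y a b = invMetric g' y a b := by
  rw [invMetric, invMetric, show g y = g' y from funext fun a => funext fun b => h y hy a b]

lemma IsRelOpen.christoffel_congr {y : Coord 4} (hy : y ∈ U) (k i j : Fin 4) :
    christoffel halfSpace g y k i j = christoffel halfSpace g' y k i j := by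
  have h1 : ∀ a b c, pderiv halfSpace (fun x => g x a b) y c
      = pderiv halfSpace (fun x => g' x a b) y c :=
    fun a b c => hU.pderiv_congr (fun x hx => h x hx a b) hy c
  simp only [christoffel, h1, invMetric_congr h hy]

lemma IsRelOpen.ricci_congr {y : Coord 4} (hy : y ∈ U) (a b : Fin 4) :
    ricci halfSpace g y a b = ricci halfSpace g' y a b := by
  have h1 : ∀ k i j c, pderiv halfSpace (fun x => christoffel halfSpace g x k i j) y c
      = pderiv halfSpace (fun x => christoffel halfSpace g' x k i j) y c :=
    fun k i j c => hU.pderiv_congr (fun x hx => hU.christoffel_congr h hx k i j) hy c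
  simp only [ricci, riemannUp, h1, hU.christoffel_congr h hy]

lemma IsRelOpen.einsteinEquationAt_congr {y : Coord 4} (hy : y ∈ U) {Λ : ℝ} {T T' : Tensor2 4}
    (hT : ∀ a b, T y a b = T' y a b) (hE : EinsteinEquationAt halfSpace g Λ T y) :
    EinsteinEquationAt halfSpace g' Λ T' y := by
  intro a b
  have h1 := hE a b
  simp only [scalarCurv, trace2, hU.ricci_congr h hy, invMetric_congr h hy, h y hy, hT] at h1 ⊢
  exact h1

end Congr

lemma IsRelOpen.mem_frontier_iff {U : Set (Coord 4)} (hU : IsRelOpen U) {y : Coord 4} (hy : y ∈ U) :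
    y ∈ frontier U ↔ y 0 = 0 := by
  have h0 := mem_halfSpace.mp (hU.subset hy)
  have h1 : y ∈ interior U ↔ 0 < y 0 := by
    obtain ⟨O, hO, rfl⟩ := hU
    rw [interior_inter, halfSpace, interior_range_modelWithCornersEuclideanHalfSpace,
      hO.interior_eq]
    exact ⟨fun h => h.1, fun h => ⟨h, hy.2⟩⟩
  rw [frontier, Set.mem_sdiff, h1]
  exact ⟨fun h => le_antisymm (not_lt.mp h.2) h0, fun h => ⟨subset_closure hy, by rw [h]; exact lt_irrefl _⟩⟩

lemma apply_eq_of_hasFDerivWithinAt_id {A : Coord 4 →L[ℝ] Coord 4} {y : Coord 4}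
    (hy : y ∈ halfSpace) (h : HasFDerivWithinAt (id : Coord 4 → Coord 4) A halfSpace y)
    (v : Coord 4) : A v = v := by
  rw [((𝓡∂ 4).uniqueDiffOn y hy).eq h (hasFDerivWithinAt_id y halfSpace)]; rfl

section Chart

variable {M : Type*} [TopologicalSpace M] [ChartedSpace (EuclideanHalfSpace 4) M]

omit [ChartedSpace (EuclideanHalfSpace 4) M] in
lemma isRelOpen_extend_target (e : OpenPartialHomeomorph M (EuclideanHalfSpace 4)) :
    IsRelOpen (e.extend (𝓡∂ 4)).target :=
  ⟨(𝓡∂ 4).symm ⁻¹' e.target, e.open_target.preimage (𝓡∂ 4).continuous_symm, by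
    rw [e.extend_target, inter_comm]⟩

variable [IsManifold (𝓡∂ 4) ∞ M] {e : OpenPartialHomeomorph M (EuclideanHalfSpace 4)}
  (he : e ∈ atlas (EuclideanHalfSpace 4) M)
include he

lemma mem_boundary_iff {y : Coord 4} (hy : y ∈ (e.extend (𝓡∂ 4)).target) :
    (e.extend (𝓡∂ 4)).symm y ∈ (𝓡∂ 4).boundary M ↔ y 0 = 0 := by
  have h1 : (e.extend (𝓡∂ 4)).symm y ∈ e.source := by
    have := (e.extend (𝓡∂ 4)).map_target hy
    rwa [e.extend_source] at this
  rw [← (isRelOpen_extend_target e).mem_frontier_iff hy]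
  have h2 := (𝓡∂ 4).isBoundaryPoint_iff_of_mem_atlas (n := ∞) (by simp) he h1
  rw [(e.extend (𝓡∂ 4)).right_inv hy] at h2
  exact h2

lemma contMDiffOn_chart_symm :
    ContMDiffOn 𝓘(ℝ, Coord 4) (𝓡∂ 4) ∞ (e.extend (𝓡∂ 4)).symm (e.extend (𝓡∂ 4)).target := by
  have h1 := contMDiffOn_extend_symm (I := 𝓡∂ 4) (n := ∞) (IsManifold.subset_maximalAtlas he)
  rwa [(𝓡∂ 4).image_eq, ← e.extend_target] at h1

/-- The differential of the chart is a left inverse: by unique differentiability, the derivative of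
the identity within the half-space is the identity. -/
lemma coordVec_injective {y : Coord 4} (hy : y ∈ (e.extend (𝓡∂ 4)).target) :
    Function.Injective (mfderivWithin 𝓘(ℝ, Coord 4) (𝓡∂ 4) (e.extend (𝓡∂ 4)).symm halfSpace y) := by
  have hU := isRelOpen_extend_target e
  have hs : (e.extend (𝓡∂ 4)).symm y ∈ e.source := by
    have := (e.extend (𝓡∂ 4)).map_target hy
    rwa [e.extend_source] at this
  have h1 : MDifferentiableWithinAt 𝓘(ℝ, Coord 4) (𝓡∂ 4) (e.extend (𝓡∂ 4)).symm halfSpace y :=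
    ((contMDiffOn_chart_symm he y hy).mdifferentiableWithinAt (by simp)).mono_of_mem_nhdsWithin
      (hU.mem_nhdsWithin hy)
  have h2 : MDifferentiableAt (𝓡∂ 4) 𝓘(ℝ, Coord 4) (e.extend (𝓡∂ 4)) ((e.extend (𝓡∂ 4)).symm y) :=
    (e.contMDiffAt_extend (n := ∞) (IsManifold.subset_maximalAtlas he) hs).mdifferentiableAt
      (by simp)
  have h3 := h2.hasMFDerivAt.comp_hasMFDerivWithinAt y h1.hasMFDerivWithinAt
  have h4 : HasFDerivWithinAt (id : Coord 4 → Coord 4)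
      ((mfderiv (𝓡∂ 4) 𝓘(ℝ, Coord 4) (e.extend (𝓡∂ 4)) ((e.extend (𝓡∂ 4)).symm y)).comp
        (mfderivWithin 𝓘(ℝ, Coord 4) (𝓡∂ 4) (e.extend (𝓡∂ 4)).symm halfSpace y) :
        Coord 4 →L[ℝ] Coord 4) halfSpace y :=
    h3.hasFDerivWithinAt.congr_of_eventuallyEq
      (Filter.eventually_of_mem (hU.mem_nhdsWithin hy) fun x hx =>
        ((e.extend (𝓡∂ 4)).right_inv hx).symm) ((e.extend (𝓡∂ 4)).right_inv hy).symm
  intro v w hvw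
  have h6 := apply_eq_of_hasFDerivWithinAt_id (hU.subset hy) h4
  have h7 := (h6 v).symm.trans ((congrArg (mfderiv (𝓡∂ 4) 𝓘(ℝ, Coord 4) (e.extend (𝓡∂ 4))
    ((e.extend (𝓡∂ 4)).symm y)) hvw).trans (h6 w))
  exact h7

/-- A nonzero vector in the radical would be orthogonal to a timelike vector, hence of positive
norm, yet orthogonal to itself. -/
lemma det_components_ne_zero {t : TensorField M} (ht : ∀ p, IsLorentzian (t p)) {y : Coord 4}
    (hy : y ∈ (e.extend (𝓡∂ 4)).target) : (Matrix.of (components e t y)).det ≠ 0 := by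
  intro h0
  obtain ⟨x, hx, hx0⟩ := Matrix.exists_mulVec_eq_zero_iff.mpr h0
  obtain ⟨D, hD⟩ : ∃ D : Coord 4 →ₗ[ℝ] Coord 4, D = (mfderivWithin 𝓘(ℝ, Coord 4) (𝓡∂ 4)
    (e.extend (𝓡∂ 4)).symm halfSpace y : Coord 4 →L[ℝ] Coord 4).toLinearMap := ⟨_, rfl⟩
  have hinj : Function.Injective D := by
    rw [hD]; exact coordVec_injective he hy
  have hsurj : Function.Surjective D := LinearMap.injective_iff_surjective.mp hinj
  obtain ⟨B, hB⟩ : ∃ B : LinearMap.BilinForm ℝ (Coord 4), B = t ((e.extend (𝓡∂ 4)).symm y) :=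
    ⟨_, rfl⟩
  have hL : IsLorentzian B := by rw [hB]; exact ht _
  have hc : ∀ i j, components e t y i j
      = B (D (EuclideanSpace.single i 1)) (D (EuclideanSpace.single j 1)) := by
    intro i j; rw [hB, hD]; rfl
  obtain ⟨w, hw⟩ : ∃ w : Coord 4, w = WithLp.toLp 2 x := ⟨_, rfl⟩
  have hw' : w = ∑ j, x j • EuclideanSpace.single j (1 : ℝ) := by
    ext i
    rw [hw]
    simp [Finset.sum_apply, Pi.single_apply]
  have h1 : ∀ i, B (D (EuclideanSpace.single i 1)) (D w) = 0 := by
    intro i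
    have h2 := congrFun hx0 i
    simp only [Matrix.mulVec, dotProduct, Matrix.of_apply, hc, Pi.zero_apply] at h2
    rw [hw', map_sum, map_sum, ← h2]
    exact Finset.sum_congr rfl fun j _ => by rw [map_smul, map_smul, smul_eq_mul, mul_comm]
  have h2 : ∀ v, B v (D w) = 0 := by
    intro v
    obtain ⟨u, rfl⟩ := hsurj v
    have h3 : u = ∑ j, u j • EuclideanSpace.single j (1 : ℝ) := by
      ext i; simp [Finset.sum_apply, Pi.single_apply]
    rw [h3, map_sum, map_sum, LinearMap.sum_apply]
    exact Finset.sum_eq_zero fun j _ => by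
      rw [map_smul, map_smul, LinearMap.smul_apply, h1, smul_zero]
  obtain ⟨v, _, hv⟩ := hL.2
  have hw0 : D w ≠ 0 := by
    intro h3
    apply hx
    have h4 : w = 0 := hinj (h3.trans (map_zero D).symm)
    rw [hw] at h4
    ext i
    exact congrArg (fun w : Coord 4 => w i) h4
  exact (hv _ (h2 v) hw0).ne' (h2 _)

/-- The components of an asymptotically de Sitter spacetime in a chart. -/
lemma AsymptoticallyDeSitter.localSpacetime {Λ : ℝ} (hΛ : 0 < Λ) {q : ℕ}
    (S : AsymptoticallyDeSitter M Λ q) :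
    LocalSpacetime (S.inChart e) q (e.extend (𝓡∂ 4)).target where
  Λ_pos := hΛ
  metric :=
    { isRelOpen := isRelOpen_extend_target e
      smooth := S.metric_smooth e he
      symm := fun y _ a b => (S.metric_lorentzian _).1 _ _
      det_ne_zero := fun y hy => det_components_ne_zero he S.metric_lorentzian hy }
  smooth_Ω := contMDiffOn_iff_contDiffOn.mp (S.Ω_smooth.comp_contMDiffOn (contMDiffOn_chart_symm he))
  smooth_T := S.stress_smooth e he
  T_symm y _ a b := S.stress_symm _ _ _
  Ω_nonneg y _ := S.Ω_nonneg _
  Ω_eq_zero_iff y hy := (S.Ω_eq_zero_iff _).trans (mem_boundary_iff he hy)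
  einstein y hy h0 := by
    have hb : ∀ x ∈ (e.extend (𝓡∂ 4)).target ∩ {x : Coord 4 | 0 < x 0},
        (e.extend (𝓡∂ 4)).symm x ∉ (𝓡∂ 4).boundary M := fun x hx h1 =>
      (ne_of_gt hx.2) ((mem_boundary_iff he hx.1).mp h1)
    refine ((isRelOpen_extend_target e).inter isOpen_pos).einsteinEquationAt_congr
      (fun x hx a b => ?_) ⟨hy, h0⟩ (fun a b => ?_) (S.einstein e he y hy (hb y ⟨hy, h0⟩))
    · change S.physMetric _ _ _ = _
      rw [S.physMetric_eq _ (hb x hx)]; rfl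
    · change S.physStress _ _ _ = _
      rw [S.physStress_eq _ (hb y ⟨hy, h0⟩)]; rfl

end Chart
end ConformalInfinity

/-! ### Plane metrics with arbitrary third-order coefficient -/

namespace ConformalInfinity

namespace MetricRing

/-- The metric `-F⁻¹ du² + F dx² + dy² + dz²` with `F` a function of `u`, where `F' = 2 f` and
`F'' = 6 x`. -/
structure IsPlane {A : Type*} [CommRing A] [Algebra ℝ A] (m : MetricRing A) (F w f x : A) :
    Prop where
  g_eq : m.g = fun a b => if a = b then ![-w, F, 1, 1] a else 0
  G_eq : m.G = fun a b => if a = b then ![-F, w, 1, 1] a else 0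
  F_w : F * w = 1
  D_F : ∀ i, m.D i F = if i = 0 then 2 * f else 0
  D_f : ∀ i, m.D i f = if i = 0 then 3 * x else 0

namespace IsPlane

variable {A : Type*} [CommRing A] [Algebra ℝ A] {m : MetricRing A} {F w f x : A}
  (h : m.IsPlane F w f x)
include h

lemma D_w (i : Fin 4) : m.D i w = if i = 0 then -(2 * f * w * w) else 0 := by
  have h1 := congrArg (m.D i) h.F_w
  simp only [Derivation.leibniz, smul_eq_mul, h.D_F, Derivation.map_one_eq_zero] at h1
  have h2 := h.F_w
  split_ifs at h1 ⊢
  · linear_combination w * h1 - m.D i w * h2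
  · linear_combination w * h1 - m.D i w * h2

lemma Γ_eq : m.Γ = ![![![-(f * w), 0, 0, 0], ![0, F * f, 0, 0], 0, 0],
    ![![0, f * w, 0, 0], ![f * w, 0, 0, 0], 0, 0], 0, 0] := by
  ext k i j
  apply natCast_mul_cancel 2
  have h1 := m.koszul k i j
  have h2 := h.F_w
  rw [h.g_eq, h.G_eq] at h1
  push_cast
  rw [h1]
  fin_cases k <;> fin_cases i <;> fin_cases j <;>
    simp [h.D_F, h.D_w] <;>
    first | ring1 | linear_combination 2 * f * w * h2

lemma ric_eq : m.ric = fun a b => if a = b then ![-(3 * x * w), 3 * x * F, 0, 0] a else 0 := by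
  ext a b
  have h2 := h.F_w
  simp only [ric, riemUp, h.Γ_eq]
  fin_cases a <;> fin_cases b <;>
    simp [Fin.sum_univ_four, h.D_F, h.D_w, h.D_f] <;>
    first | ring1 | linear_combination (-2) * f * f * h2

lemma scal_eq_six : m.scal = 6 * x := by
  have h2 := h.F_w
  rw [scal, tr, h.ric_eq, h.G_eq]
  simp [Fin.sum_univ_four]
  linear_combination 6 * x * h2

lemma two_P_eq (a b : Fin 4) :
    2 * m.P a b = if a = b then ![-(2 * x * w), 2 * x * F, -x, -x] a else 0 := by
  apply natCast_mul_cancel 6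
  have h1 := m.twelve_P a b
  rw [h.scal_eq_six, h.ric_eq, h.g_eq] at h1
  push_cast
  rw [show (6 : A) * (2 * m.P a b) = 12 * m.P a b by ring, h1]
  fin_cases a <;> fin_cases b <;> simp <;> ring1

lemma P_one_one : m.P 1 1 = x * F :=
  natCast_mul_cancel 2 (by push_cast; rw [h.two_P_eq]; simp; ring)

lemma P_zero_zero : m.P 0 0 = -(x * w) :=
  natCast_mul_cancel 2 (by push_cast; rw [h.two_P_eq]; simp; ring)

lemma P_of_ne {a b : Fin 4} (hab : a ≠ b) : m.P a b = 0 :=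
  natCast_mul_cancel 2 (by push_cast; rw [h.two_P_eq]; simp [hab])

/-- The derivative of x is a third derivative of F, up to a factor, and so it detects the
coefficient of u³. -/
lemma cotton_eq {k : A} (hk : ∀ i, m.D i x = if i = 0 then k else 0) :
    m.cotton 1 0 1 = k * F := by
  have h2 := h.F_w
  rw [cotton, cov2, cov2]
  simp [Fin.sum_univ_four, h.P_one_one, h.P_of_ne, h.P_zero_zero, h.Γ_eq, hk, h.D_F]
  linear_combination (-2) * x * f * h2

section Einstein

variable {u lam ρ : A} (hu : ∀ i, m.D i u = if i = 0 then 1 else 0) (hf : f = 3 * ρ)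
  (hx : u * x = 2 * ρ) (hF : F = lam + 2 * u * ρ)
include hu hf hx

/-- The tensor E vanishes for Ω = u. The hypotheses on f and x hold for F = λ + μu³ with ρ = μu²/2
and x = μu. -/
lemma hess_eq (a b : Fin 4) : m.cov1 (fun i => m.D i u) a b + u * m.P a b + ρ * m.g a b = 0 := by
  have h1 := h.two_P_eq a b
  apply natCast_mul_cancel 2
  push_cast
  rw [mul_add, mul_add, mul_left_comm, h1, cov1, h.Γ_eq, h.g_eq]
  fin_cases a <;> fin_cases b <;> simp [hu, hf]
  · linear_combination (-2) * w * hx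
  · linear_combination 2 * F * hx
  · linear_combination - hx
  · linear_combination - hx

lemma four_ρ_eq : 4 * ρ = -(m.tr (m.cov1 fun i => m.D i u) + m.J * u) := by
  have h1 : m.cov1 (fun i => m.D i u) = fun a b => -u * m.P a b - ρ * m.g a b := by
    ext a b; linear_combination h.hess_eq hu hf hx a b
  rw [h1, m.tr_sub_mul, J]
  ring

omit hf hx in
include hF in
lemma norm_eq : ∑ a, m.D a u * m.up (fun i => m.D i u) a + lam + 2 * u * ρ = 0 := by
  simp [MetricRing.up, hu, h.G_eq, hF]

end Einstein

end IsPlane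
end MetricRing
end ConformalInfinity

namespace ConformalInfinity
open SmoothFn

/-! ### Spacetimes with the same data at infinity -/

/-- The function `λ + μ u³`. -/
def planeF (lam μ : ℝ) (u : ℝ) : ℝ := lam + μ * u ^ 3

/-- The metric `-F⁻¹ du² + F dx² + dy² + dz²` with `F = λ + μ u³`. -/
def planeMetric (lam μ : ℝ) : Tensor2 4 := fun y a b =>
  if a = b then ![-(planeF lam μ (y 0))⁻¹, planeF lam μ (y 0), 1, 1] a else 0

/-- Taking μ ≥ 0 keeps F positive on the whole half-space, so the metric is Lorentzian globally. -/
lemma planeF_pos {lam μ u : ℝ} (hlam : 0 < lam) (hμ : 0 ≤ μ) (hu : 0 ≤ u) : 0 < planeF lam μ u :=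
  add_pos_of_pos_of_nonneg hlam (mul_nonneg hμ (pow_nonneg hu 3))

lemma contDiff_coord (i : Fin 4) : ContDiff ℝ ∞ fun y : Coord 4 => y i := by fun_prop

lemma contDiff_planeF (lam μ : ℝ) : ContDiff ℝ ∞ fun y : Coord 4 => planeF lam μ (y 0) :=
  contDiff_const.add (contDiff_const.mul ((contDiff_coord 0).pow 3))

lemma contDiffOn_planeMetric {lam μ : ℝ} (hlam : 0 < lam) (hμ : 0 ≤ μ) (a b : Fin 4) :
    ContDiffOn ℝ ∞ (fun y => planeMetric lam μ y a b) halfSpace := by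
  have hF := (contDiff_planeF lam μ).contDiffOn (s := halfSpace)
  have hF' : ContDiffOn ℝ ∞ (fun y : Coord 4 => -(planeF lam μ (y 0))⁻¹) halfSpace :=
    (hF.inv fun y hy => (planeF_pos hlam hμ (mem_halfSpace.mp hy)).ne').neg
  by_cases hab : a = b
  · subst hab
    simp only [planeMetric, if_true]
    fin_cases a
    · exact hF'
    · exact hF
    · exact contDiffOn_const
    · exact contDiffOn_const
  · simp only [planeMetric, if_neg hab]
    exact contDiffOn_const

/-- Any metric which is given by the components `planeMetric` on its domain. -/
lemma isPlane_ring {U : Set (Coord 4)} {g : Tensor2 4} (h : IsSmoothMetric U g) {lam μ : ℝ}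
    (hlam : 0 < lam) (hμ : 0 ≤ μ) (hg : ∀ y ∈ U, ∀ a b, g y a b = planeMetric lam μ y a b) :
    ∃ u F w ρ x : SmoothFn U, IsRep (fun y => y 0) u ∧ IsRep (fun y => planeF lam μ (y 0)) F ∧
      h.ring.IsPlane F w (3 * ρ) x ∧ (∀ i, h.ring.D i u = if i = 0 then 1 else 0) ∧
      (∀ i, h.ring.D i x = if i = 0 then algebraMap ℝ _ μ else 0) ∧
      u * x = 2 * ρ ∧ F = algebraMap ℝ _ lam + 2 * u * ρ := by
  have hs := h.isRelOpen.subset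
  have hF0 : ∀ y ∈ U, planeF lam μ (y 0) ≠ 0 := fun y hy =>
    (planeF_pos hlam hμ (mem_halfSpace.mp (hs hy))).ne'
  obtain ⟨u, hu⟩ : ∃ u : SmoothFn U, IsRep (fun y => y 0) u :=
    ⟨_, isRep_mk _ (contDiff_coord 0).contDiffOn⟩
  obtain ⟨F, hF⟩ : ∃ F : SmoothFn U, IsRep (fun y => planeF lam μ (y 0)) F :=
    ⟨_, isRep_mk _ (contDiff_planeF lam μ).contDiffOn⟩
  obtain ⟨w, hw⟩ : ∃ w : SmoothFn U, IsRep (fun y => (planeF lam μ (y 0))⁻¹) w :=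
    ⟨_, isRep_mk _ ((contDiff_planeF lam μ).contDiffOn.inv hF0)⟩
  have hFw : F * w = 1 := ext_ev fun y => by
    rw [map_mul, map_one, ← hF y, ← hw y, mul_inv_cancel₀ (hF0 y y.2)]
  have hDu : ∀ i, h.ring.D i u = if i = 0 then 1 else 0 := fun i => ext_ev fun y => by
    rw [← h.isRep_pderiv hu i y]
    change fderivWithin ℝ (fun y : Coord 4 => y 0) halfSpace y _ = _
    have h1 : HasFDerivWithinAt (fun y : Coord 4 => y 0)
        (EuclideanSpace.proj (0 : Fin 4) : Coord 4 →L[ℝ] ℝ) halfSpace y :=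
      (EuclideanSpace.proj (0 : Fin 4) : Coord 4 →L[ℝ] ℝ).hasFDerivWithinAt
    rw [h1.fderivWithin ((𝓡∂ 4).uniqueDiffOn _ (hs y.2)), apply_ite (ev y), map_one, map_zero]
    simp [eq_comm]
  have hg' : h.ring.g = fun a b => if a = b then ![-w, F, 1, 1] a else 0 := by
    ext1 a; ext1 b
    refine ext_ev fun y => ?_
    rw [← h.isRep_g a b y]
    refine (hg y y.2 a b).trans ?_
    rw [planeMetric]
    have h1 := hF y
    have h2 := hw y
    fin_cases a <;> fin_cases b <;> simp [← h1, ← h2]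
  have hG' : h.ring.G = fun a b => if a = b then ![-F, w, 1, 1] a else 0 := by
    ext1 a; ext1 b
    have h1 : h.ring.G a b * ![-w, F, 1, 1] b = if a = b then 1 else 0 := by
      have h2 := h.ring.G_g a b
      rw [hg'] at h2
      simpa using h2
    by_cases hab : a = b
    · subst hab
      rw [if_pos rfl] at h1 ⊢
      fin_cases a <;> simp at h1 ⊢
      · linear_combination (-F) * h1 - h.ring.G 0 0 * hFw
      · linear_combination w * h1 - h.ring.G 1 1 * hFw
      · exact h1
      · exact h1
    · rw [if_neg hab] at h1 ⊢
      fin_cases b <;> simp only [Fin.mk_zero, Fin.mk_one, Fin.reduceFinMk,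
        Matrix.cons_val, mul_one] at h1 ⊢
      · linear_combination (-F) * h1 - h.ring.G a 0 * hFw
      · linear_combination w * h1 - h.ring.G a 1 * hFw
      · exact h1
      · exact h1
  have hF' : F = algebraMap ℝ _ lam + algebraMap ℝ _ μ * u ^ 3 := ext_ev fun y => by
    rw [← hF y, map_add, map_mul, map_pow, ← hu y, AlgHom.commutes, AlgHom.commutes]; rfl
  -- With κ = μ/2 no fractions occur: ρ = κu², x = 2κu and F = λ + 2uρ.
  obtain ⟨κ, hκ⟩ : ∃ κ : SmoothFn U, κ = algebraMap ℝ _ (μ / 2) := ⟨_, rfl⟩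
  have hκ' : algebraMap ℝ (SmoothFn U) μ = 2 * κ := by
    rw [hκ, ← map_ofNat (algebraMap ℝ (SmoothFn U)) 2, ← map_mul]; congr 1; ring
  have hDκ : ∀ i, h.ring.D i κ = 0 := fun i => by rw [hκ]; simp
  have h2 : ∀ i, h.ring.D i 2 = 0 := fun i => by exact_mod_cast (h.ring.D i).map_natCast 2
  have h3 : ∀ i, h.ring.D i 3 = 0 := fun i => by exact_mod_cast (h.ring.D i).map_natCast 3
  rw [hκ'] at hF' ⊢
  refine ⟨u, F, w, κ * u ^ 2, 2 * κ * u, hu, hF, ⟨hg', hG', hFw, fun i => ?_, fun i => ?_⟩,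
    hDu, fun i => ?_, by ring, by rw [hF']; ring⟩
  · simp only [hF', map_add, Derivation.map_algebraMap, Derivation.leibniz,
      Derivation.leibniz_pow, hDu, hDκ, h2, smul_eq_mul, nsmul_eq_mul]
    split_ifs
    · push_cast; ring
    · simp
  · simp only [Derivation.leibniz, Derivation.leibniz_pow, hDu, hDκ, h3, smul_eq_mul, nsmul_eq_mul]
    split_ifs
    · push_cast; ring
    · simp
  · simp only [Derivation.leibniz, hDu, hDκ, h2, smul_eq_mul]
    split_ifs <;> simp

end ConformalInfinity

namespace ConformalInfinity
open SmoothFn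

lemma isRelOpen_halfSpace : IsRelOpen halfSpace := ⟨univ, isOpen_univ, (inter_univ _).symm⟩

lemma isSmoothMetric_planeMetric {lam μ : ℝ} (hlam : 0 < lam) (hμ : 0 ≤ μ) :
    IsSmoothMetric halfSpace (planeMetric lam μ) where
  isRelOpen := isRelOpen_halfSpace
  smooth := contDiffOn_planeMetric hlam hμ
  symm y _ a b := by
    by_cases hab : a = b
    · rw [hab]
    · simp only [planeMetric, if_neg hab, if_neg (Ne.symm hab)]
  det_ne_zero y hy := by
    have hF := (planeF_pos hlam hμ (mem_halfSpace.mp hy)).ne'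
    have h1 : Matrix.of (planeMetric lam μ y)
        = Matrix.diagonal ![-(planeF lam μ (y 0))⁻¹, planeF lam μ (y 0), 1, 1] := by
      ext a b; rfl
    rw [h1, Matrix.det_diagonal]
    simp [Fin.prod_univ_four, hF]

/-- `conformal_ric_of_hess` gives Ric = 3λg for the physical metric, so its scalar curvature is 12λ
and the cosmological constant is 3λ. -/
lemma einstein_planeMetric {lam μ : ℝ} (hlam : 0 < lam) (hμ : 0 ≤ μ) {y : Coord 4}
    (hy : 0 < y 0) : EinsteinEquationAt halfSpace
      (fun x a b => (x 0 ^ 2)⁻¹ * planeMetric lam μ x a b) (3 * lam) (fun _ _ _ => 0) y := by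
  have h := isSmoothMetric_inter_pos (isSmoothMetric_planeMetric hlam hμ)
  have h0 : ∀ x ∈ halfSpace ∩ {x : Coord 4 | 0 < x 0}, x 0 ≠ 0 := fun x hx => ne_of_gt hx.2
  have h' := h.conformal (Ω := fun x => x 0) (contDiff_coord 0).contDiffOn h0
  obtain ⟨u, F, w', ρ, x, hu, hF, hp, hDu, -, hx, hF'⟩ :=
    isPlane_ring h hlam hμ fun _ _ _ _ => rfl
  obtain ⟨w, hw⟩ : ∃ w : SmoothFn (halfSpace ∩ {x : Coord 4 | 0 < x 0}),
      IsRep (fun y => (y 0)⁻¹) w := ⟨_, isRep_mk _ ((contDiff_coord 0).contDiffOn.inv h0)⟩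
  have key := MetricRing.conformal_ric_of_hess (m := h.ring) (m' := h'.ring) (Ω := u) (w := w)
    (lam := algebraMap ℝ _ lam) (ρ := ρ) (h'.ring_D.trans h.ring_D.symm)
    (fun a b => ext_ev fun z => by
      rw [← h'.isRep_g a b z, map_mul, map_mul, ← hw z, ← h.isRep_g a b z]
      simp only [pow_two, mul_inv])
    (fun a b => ext_ev fun z => by
      rw [← h'.isRep_G a b z, map_mul, map_mul, ← hu z, ← h.isRep_G a b z, ← pow_two]
      exact invMetric_conformal (Ω := fun x => x 0) (h0 z z.2) (h.det_ne_zero z z.2) a b)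
    (ext_ev fun z => by
      rw [map_mul, ← hw z, ← hu z, map_one]
      exact inv_mul_cancel₀ (h0 z z.2))
    (hp.four_ρ_eq hDu rfl hx) (hp.hess_eq hDu rfl hx) (hp.norm_eq hDu hF')
  have hs : h'.ring.scal = 12 * algebraMap ℝ _ lam := by
    have h1 : h'.ring.ric = fun a b => 3 * algebraMap ℝ _ lam * h'.ring.g a b - 0 * h'.ring.g a b := by
      ext1 a; ext1 b; rw [key, zero_mul, sub_zero]
    rw [MetricRing.scal, h1, h'.ring.tr_sub_mul, h'.ring.tr_g]
    ring
  have hyU : y ∈ halfSpace ∩ {x : Coord 4 | 0 < x 0} := ⟨mem_halfSpace.mpr hy.le, hy⟩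
  intro a b
  have h2 := congrArg (ev ⟨y, hyU⟩) (key a b)
  have h3 := congrArg (ev ⟨y, hyU⟩) hs
  rw [← (h'.isRep_ricci a b).eq hyU, map_mul, map_mul, map_ofNat, AlgHom.commutes,
    ← (h'.isRep_g a b).eq hyU] at h2
  rw [← h'.isRep_scalarCurv.eq hyU, map_mul, map_ofNat, AlgHom.commutes] at h3
  simp only [Algebra.algebraMap_self, RingHom.id_apply] at h2 h3
  rw [h2, h3]
  ring

/-- The diagonal bilinear form. -/
def diagForm (c : Fin 4 → ℝ) : LinearMap.BilinForm ℝ (Coord 4) :=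
  LinearMap.mk₂ ℝ (fun v w => ∑ i, c i * (v i * w i))
    (fun v v' w => by
      rw [← Finset.sum_add_distrib]
      exact Finset.sum_congr rfl fun i _ => by simp only [PiLp.add_apply]; ring)
    (fun r v w => by
      rw [smul_eq_mul, Finset.mul_sum]
      exact Finset.sum_congr rfl fun i _ => by simp only [PiLp.smul_apply, smul_eq_mul]; ring)
    (fun v w w' => by
      rw [← Finset.sum_add_distrib]
      exact Finset.sum_congr rfl fun i _ => by simp only [PiLp.add_apply]; ring)
    (fun r v w => by
      rw [smul_eq_mul, Finset.mul_sum]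
      exact Finset.sum_congr rfl fun i _ => by simp only [PiLp.smul_apply, smul_eq_mul]; ring)

lemma diagForm_apply (c : Fin 4 → ℝ) (v w : Coord 4) :
    diagForm c v w = ∑ i, c i * (v i * w i) := rfl

lemma diagForm_single (c : Fin 4 → ℝ) (i j : Fin 4) :
    diagForm c (EuclideanSpace.single i 1) (EuclideanSpace.single j 1) = if i = j then c i else 0 := by
  rw [diagForm_apply]
  by_cases hij : i = j
  · subst hij
    simp
  · simp only [if_neg hij]
    refine Finset.sum_eq_zero fun k _ => ?_
    by_cases hk : k = i
    · subst hk; simp [hij]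
    · simp [hk]

lemma isLorentzian_diagForm {c : Fin 4 → ℝ} (h0 : c 0 < 0) (h : ∀ i : Fin 3, 0 < c i.succ) :
    IsLorentzian (diagForm c) := by
  refine ⟨fun v w => ?_, EuclideanSpace.single 0 1, ?_, fun w hw hw0 => ?_⟩
  · rw [diagForm_apply, diagForm_apply]
    exact Finset.sum_congr rfl fun i _ => by rw [mul_comm (v i)]
  · rw [diagForm_single, if_pos rfl]; exact h0
  · have h1 : w 0 = 0 := by
      rw [diagForm_apply, Fin.sum_univ_succ] at hw
      simpa [h0.ne] using hw
    rw [diagForm_apply, Fin.sum_univ_succ, h1, mul_zero, mul_zero, zero_add]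
    obtain ⟨i, hi⟩ : ∃ i : Fin 3, w i.succ ≠ 0 := by
      by_contra hn
      push Not at hn
      exact hw0 (by ext k; exact Fin.cases h1 hn k)
    exact Finset.sum_pos' (fun k _ => mul_nonneg (h k).le (mul_self_nonneg _))
      ⟨i, Finset.mem_univ _, mul_pos (h i) (mul_self_pos.mpr hi)⟩

/-! ### The half-space as a manifold -/

section Self

/-- The chart of the half-space. -/
abbrev idChart : OpenPartialHomeomorph (EuclideanHalfSpace 4) (EuclideanHalfSpace 4) :=
  OpenPartialHomeomorph.refl _

lemma idChart_target : (idChart.extend (𝓡∂ 4)).target = halfSpace := by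
  rw [idChart.extend_target]
  exact univ_inter _

lemma idChart_symm_val {y : Coord 4} (hy : y ∈ halfSpace) :
    ((idChart.extend (𝓡∂ 4)).symm y).1 = y := by
  have := (idChart.extend (𝓡∂ 4)).right_inv (by rwa [idChart_target] : y ∈ _)
  exact this

lemma coordVec_idChart {y : Coord 4} (hy : y ∈ halfSpace) (i : Fin 4) :
    coordVec idChart y i = EuclideanSpace.single i (1 : ℝ) := by
  have h1 := mfderivWithin_range_extChartAt_symm (I := 𝓡∂ 4)
    (x := (idChart.extend (𝓡∂ 4)).symm y)
  have h2 : extChartAt (𝓡∂ 4) ((idChart.extend (𝓡∂ 4)).symm y) = idChart.extend (𝓡∂ 4) := rfl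
  have h3 : idChart.extend (𝓡∂ 4) ((idChart.extend (𝓡∂ 4)).symm y) = y := idChart_symm_val hy
  rw [h2, h3] at h1
  exact DFunLike.congr_fun h1 _

lemma components_idChart {t : TensorField (EuclideanHalfSpace 4)} {c : Coord 4 → Fin 4 → ℝ}
    (ht : ∀ p, t p = diagForm (c p.1)) {y : Coord 4} (hy : y ∈ halfSpace) (i j : Fin 4) :
    components idChart t y i j = if i = j then c y i else 0 := by
  rw [components, coordVec_idChart hy, coordVec_idChart hy, ht, idChart_symm_val hy]
  exact diagForm_single _ _ _

lemma contMDiff_coord_zero :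
    ContMDiff (𝓡∂ 4) 𝓘(ℝ, ℝ) ∞ fun p : EuclideanHalfSpace 4 => p.1 0 :=
  (contDiff_coord 0).contMDiff.comp (𝓡∂ 4).contMDiff

lemma mem_atlas_iff {e : OpenPartialHomeomorph (EuclideanHalfSpace 4) (EuclideanHalfSpace 4)} :
    e ∈ atlas (EuclideanHalfSpace 4) (EuclideanHalfSpace 4) ↔ e = idChart := chartedSpaceSelf_atlas

lemma mem_boundary_self_iff (p : EuclideanHalfSpace 4) :
    p ∈ (𝓡∂ 4).boundary (EuclideanHalfSpace 4) ↔ p.1 0 = 0 := by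
  have hp : p.1 ∈ halfSpace := mem_range_self (f := 𝓡∂ 4) p
  have h1 := mem_boundary_iff (mem_atlas_iff.mpr rfl) (by rwa [idChart_target] : p.1 ∈ _)
  rwa [show (idChart.extend (𝓡∂ 4)).symm p.1 = p from Subtype.ext (idChart_symm_val hp)] at h1

lemma mfderiv_coord_zero_ne_zero (p : EuclideanHalfSpace 4) :
    mfderiv (𝓡∂ 4) 𝓘(ℝ, ℝ) (fun p : EuclideanHalfSpace 4 => p.1 0) p ≠ 0 := by
  intro h0
  have hp : p.1 ∈ halfSpace := mem_range_self (f := 𝓡∂ 4) p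
  have hpU : p.1 ∈ (idChart.extend (𝓡∂ 4)).target := by rwa [idChart_target]
  have hs : (idChart.extend (𝓡∂ 4)).symm p.1 = p := Subtype.ext (idChart_symm_val hp)
  have h1 : MDifferentiableWithinAt 𝓘(ℝ, Coord 4) (𝓡∂ 4) (idChart.extend (𝓡∂ 4)).symm halfSpace
      p.1 := by
    have := (contMDiffOn_chart_symm (mem_atlas_iff.mpr rfl) p.1 hpU).mdifferentiableWithinAt
      (by simp)
    rwa [idChart_target] at this
  have h2 := (contMDiff_coord_zero.mdifferentiable (by simp)
    ((idChart.extend (𝓡∂ 4)).symm p.1)).hasMFDerivAt.comp_hasMFDerivWithinAt p.1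
      h1.hasMFDerivWithinAt
  rw [hs, h0] at h2
  have h3 : HasFDerivWithinAt (fun y : Coord 4 => y 0) (0 : Coord 4 →L[ℝ] ℝ) halfSpace p.1 :=
    h2.hasFDerivWithinAt.congr_of_eventuallyEq (eventually_of_mem self_mem_nhdsWithin
      fun y hy => by
        change _ = ((idChart.extend (𝓡∂ 4)).symm y).1 0
        rw [idChart_symm_val hy]) (by
        change _ = ((idChart.extend (𝓡∂ 4)).symm p.1).1 0
        rw [idChart_symm_val hp])
  have h4 : HasFDerivWithinAt (fun y : Coord 4 => y 0)
      (EuclideanSpace.proj (0 : Fin 4) : Coord 4 →L[ℝ] ℝ) halfSpace p.1 :=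
    (EuclideanSpace.proj (0 : Fin 4) : Coord 4 →L[ℝ] ℝ).hasFDerivWithinAt
  have h5 := congrArg (fun A : Coord 4 →L[ℝ] ℝ => A (EuclideanSpace.single 0 1))
    (((𝓡∂ 4).uniqueDiffOn _ hp).eq h3 h4)
  simp at h5

end Self

end ConformalInfinity

namespace ConformalInfinity
open SmoothFn

/-- The diagonal entries of `planeMetric`. -/
def planeDiag (lam μ : ℝ) (y : Coord 4) : Fin 4 → ℝ :=
  ![-(planeF lam μ (y 0))⁻¹, planeF lam μ (y 0), 1, 1]

lemma coe_halfSpace_nonneg (p : EuclideanHalfSpace 4) : 0 ≤ p.1 0 := p.2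

/-- The vacuum spacetime with conformal metric `-F⁻¹ du² + F dx² + dy² + dz²`, where
`F = λ + μ u³`, and `Ω = u`. -/
def planeSpacetime {Λ : ℝ} (hΛ : 0 < Λ) (q : ℕ) {μ : ℝ} (hμ : 0 ≤ μ) :
    AsymptoticallyDeSitter (EuclideanHalfSpace 4) Λ q where
  physMetric p := (p.1 0 ^ 2)⁻¹ • diagForm (planeDiag (Λ / 3) μ p.1)
  physStress _ := 0
  metric p := diagForm (planeDiag (Λ / 3) μ p.1)
  stress _ := 0
  Ω p := p.1 0
  metric_lorentzian p := by
    have hF := planeF_pos (lam := Λ / 3) (by positivity) hμ (coe_halfSpace_nonneg p)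
    refine isLorentzian_diagForm (neg_neg_of_pos (inv_pos.mpr hF)) fun i => ?_
    fin_cases i
    · exact hF
    · exact one_pos
    · exact one_pos
  metric_smooth e he i j := by
    rw [mem_atlas_iff.mp he, idChart_target]
    exact (contDiffOn_planeMetric (lam := Λ / 3) (by positivity) hμ i j).congr fun y hy =>
      components_idChart (c := planeDiag (Λ / 3) μ) (fun _ => rfl) hy i j
  stress_symm _ _ _ := rfl
  stress_smooth e he i j := contDiffOn_const (c := 0)
  Ω_smooth := contMDiff_coord_zero
  Ω_nonneg := coe_halfSpace_nonneg
  Ω_eq_zero_iff p := (mem_boundary_self_iff p).symm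
  mfderiv_Ω_ne_zero p _ := mfderiv_coord_zero_ne_zero p
  physMetric_eq _ _ := rfl
  physStress_eq _ _ := (smul_zero _).symm
  einstein e he y hy hb := by
    obtain rfl := mem_atlas_iff.mp he
    rw [idChart_target] at hy
    have h0 : 0 < y 0 := by
      rw [mem_boundary_self_iff, idChart_symm_val hy] at hb
      exact lt_of_le_of_ne (mem_halfSpace.mp hy) (Ne.symm hb)
    have h1 := einstein_planeMetric (lam := Λ / 3) (by positivity) hμ h0
    rw [mul_div_cancel₀ Λ three_ne_zero] at h1
    refine isRelOpen_halfSpace.einsteinEquationAt_congr (fun x hx a b => ?_) hy (fun a b => rfl) h1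
    rw [planeMetric, ← planeDiag, ← components_idChart (c := planeDiag (Λ / 3) μ)
      (t := fun p => diagForm (planeDiag (Λ / 3) μ p.1)) (fun _ => rfl) hx a b]
    have h2 : x 0 = ((idChart.extend (𝓡∂ 4)).symm x).1 0 := by rw [idChart_symm_val hx]
    rw [h2]
    rfl

lemma planeSpacetime_g {Λ : ℝ} (hΛ : 0 < Λ) (q : ℕ) {μ : ℝ} (hμ : 0 ≤ μ) {y : Coord 4}
    (hy : y ∈ halfSpace) (a b : Fin 4) :
    ((planeSpacetime hΛ q hμ).inChart idChart).g y a b = planeMetric (Λ / 3) μ y a b :=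
  components_idChart (c := planeDiag (Λ / 3) μ) (fun _ => rfl) hy a b

lemma planeSpacetime_Ω {Λ : ℝ} (hΛ : 0 < Λ) (q : ℕ) {μ : ℝ} (hμ : 0 ≤ μ) {y : Coord 4}
    (hy : y ∈ halfSpace) : ((planeSpacetime hΛ q hμ).inChart idChart).Ω y = y 0 := by
  change ((idChart.extend (𝓡∂ 4)).symm y).1 0 = y 0
  rw [idChart_symm_val hy]

lemma ConformalEinstein.B_one_one_of_isPlane {A : Type*} [CommRing A] [Algebra ℝ A]
    {m : MetricRing A} {lam : ℝ} {q : ℕ} (c : ConformalEinstein m lam q) {F w f x k : A}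
    (h : m.IsPlane F w f x) (hΩ : ∀ i, m.D i c.Ω = if i = 0 then 1 else 0)
    (hx : ∀ i, m.D i x = if i = 0 then k else 0) : c.B 1 1 = -(k * F ^ 2) := by
  have huΩ : ∀ a, c.uΩ a = if a = 0 then -F else 0 := fun a => by
    rw [uΩ, MetricRing.up]
    simp only [dΩ, hΩ, h.G_eq, mul_ite, mul_one, mul_zero, Finset.sum_ite_eq', Finset.mem_univ,
      if_true]
    by_cases ha : a = 0
    · subst ha; simp
    · simp [ha]
  rw [B]
  simp only [huΩ, mul_ite, mul_zero, Finset.sum_ite_eq', Finset.mem_univ, if_true]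
  rw [h.cotton_eq hx]; ring

lemma LocalSpacetime.fourthForm_diag {L : LocalData} {U : Set (Coord 4)} {p : ℕ}
    (h : LocalSpacetime L (p + 1) U) (hp : p ≤ 1) {z : Coord 3} (hz : incl z ∈ U) {i : Fin 3}
    {a : Fin 4} (ha : i.succ = a) :
    L.fourthForm z i i = -√L.lam * bev hz (h.conformalEinstein.B a a) := by
  subst ha
  exact h.fourthForm_eq hz hp i i

/-- On Σ one has F = λ and B₁₁ = -μλ², which the factor -√λ turns into a positive multiple of μ. -/
lemma LocalSpacetime.fourthForm_of_planeMetric {L : LocalData} {U : Set (Coord 4)} {p : ℕ}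
    (h : LocalSpacetime L (p + 1) U) (hp : p ≤ 1) {μ : ℝ} (hμ : 0 ≤ μ)
    (hg : ∀ y ∈ U, ∀ a b, L.g y a b = planeMetric L.lam μ y a b) (hΩ : ∀ y ∈ U, L.Ω y = y 0)
    {z : Coord 3} (hz : incl z ∈ U) : L.fundForm 4 z 0 0 = √L.lam * L.lam ^ 2 * μ := by
  obtain ⟨u, F, w, ρ, x, hu, hF, hpl, hDu, hDx, -, -⟩ := isPlane_ring h.metric h.lam_pos hμ hg
  have hΩ' : h.conformalEinstein.Ω = u :=
    h.isRep_Ω.unique fun y => (hΩ y y.2).trans (hu y)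
  rw [← hΩ'] at hDu
  have hF0 : bev hz F = L.lam := by
    rw [← hF.bev hz, incl_zero, planeF]; ring
  have h1 : L.fundForm 4 = L.fourthForm := by simp [LocalData.fundForm]
  have h2 := h.fourthForm_diag hp hz (i := 0) (a := 1) rfl
  rw [h.conformalEinstein.B_one_one_of_isPlane hpl hDu hDx, map_neg, map_mul, map_pow, hF0,
    AlgHom.commutes] at h2
  rw [h1, h2]
  simp only [Algebra.algebraMap_self, RingHom.id_apply]
  ring

lemma planeSpacetime_fourthForm {Λ : ℝ} (hΛ : 0 < Λ) {p : ℕ} (hp : p ≤ 1) {μ : ℝ} (hμ : 0 ≤ μ) :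
    ((planeSpacetime hΛ (p + 1) hμ).inChart idChart).fundForm 4 0 0 0
      = √(Λ / 3) * (Λ / 3) ^ 2 * μ := by
  have h := (planeSpacetime hΛ (p + 1) hμ).localSpacetime (mem_atlas_iff.mpr rfl) hΛ
  rw [idChart_target] at h
  exact h.fourthForm_of_planeMetric hp hμ (fun y hy => planeSpacetime_g hΛ (p + 1) hμ hy)
    (fun y hy => planeSpacetime_Ω hΛ (p + 1) hμ hy) (incl_mem_halfSpace 0)

lemma planeMetric_sub_isBigO {lam μ : ℝ} (hlam : 0 < lam) (hμ : 0 ≤ μ) (l : Filter (Coord 4))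
    (hl : ∀ᶠ y in l, y ∈ halfSpace) (a b : Fin 4) :
    (fun y => planeMetric lam 0 y a b - planeMetric lam μ y a b) =O[l] fun y => y 0 ^ 3 := by
  -- The first summand bounds the difference in F. The second bounds the difference in F⁻¹, as F ≥
  -- λ.
  refine IsBigO.of_bound (μ + lam⁻¹ * lam⁻¹ * μ) (hl.mono fun y hy => ?_)
  have hu := mem_halfSpace.mp hy
  have hF := planeF_pos hlam hμ hu
  have hF' : lam ≤ planeF lam μ (y 0) := le_add_of_nonneg_right (by positivity)
  have h3 : 0 ≤ μ * y 0 ^ 3 := by positivity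
  have hl' : 0 < lam⁻¹ := inv_pos.mpr hlam
  rw [Real.norm_eq_abs, Real.norm_eq_abs, abs_of_nonneg (by positivity : 0 ≤ y 0 ^ 3)]
  have hpos : 0 ≤ (μ + lam⁻¹ * lam⁻¹ * μ) * y 0 ^ 3 := by positivity
  by_cases hab : a = b
  · subst hab
    simp only [planeMetric, if_true]
    have h0 : planeF lam 0 (y 0) = lam := by simp [planeF]
    fin_cases a
    · change |-(planeF lam 0 (y 0))⁻¹ - -(planeF lam μ (y 0))⁻¹| ≤ _
      rw [h0, show -lam⁻¹ - -(planeF lam μ (y 0))⁻¹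
        = -(lam⁻¹ * (planeF lam μ (y 0))⁻¹ * (μ * y 0 ^ 3)) by
          have : planeF lam μ (y 0) - lam = μ * y 0 ^ 3 := by rw [planeF]; ring
          rw [← this]; field_simp; ring, abs_neg, abs_of_nonneg (by positivity)]
      have h5 : (planeF lam μ (y 0))⁻¹ ≤ lam⁻¹ := inv_anti₀ hlam hF'
      have h6 := mul_le_mul_of_nonneg_right (mul_le_mul_of_nonneg_left h5 hl'.le) h3
      linarith
    · change |planeF lam 0 (y 0) - planeF lam μ (y 0)| ≤ _
      rw [h0, planeF, show lam - (lam + μ * y 0 ^ 3) = -(μ * y 0 ^ 3) by ring, abs_neg,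
        abs_of_nonneg h3]
      have : 0 ≤ lam⁻¹ * lam⁻¹ * (μ * y 0 ^ 3) := by positivity
      linarith
    · simpa using hpos
    · simpa using hpos
  · simpa [planeMetric, hab] using hpos

end ConformalInfinity

/-! ### Half-integral powers and assembly -/

namespace ConformalInfinity

lemma rpow_three_halves {x : ℝ} (hx : 0 < x) : x ^ (3 / 2 : ℝ) = x * √x := by
  rw [show (3 / 2 : ℝ) = 1 + 1 / 2 by norm_num, Real.rpow_add hx, Real.rpow_one,
    Real.sqrt_eq_rpow]

lemma rpow_five_halves {x : ℝ} (hx : 0 < x) : x ^ (5 / 2 : ℝ) = x ^ 2 * √x := by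
  rw [show (5 / 2 : ℝ) = (2 : ℕ) + 1 / 2 by norm_num, Real.rpow_add hx, Real.rpow_natCast,
    Real.sqrt_eq_rpow]

end ConformalInfinity

end

theorem theorem1 (Λ : ℝ) (hΛ : 0 < Λ) (q : ℕ) (hq : q ≤ 2) :
    (∀ (M : Type*) [TopologicalSpace M] [ChartedSpace (EuclideanHalfSpace 4) M]
      [IsManifold (𝓡∂ 4) ∞ M] (S : AsymptoticallyDeSitter M Λ q),
      ∀ e ∈ atlas (EuclideanHalfSpace 4) M, ∀ z : Coord 3,
        incl z ∈ (e.extend (𝓡∂ 4)).target →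
        -- the constraint and its normal derivative
        (∀ a, (S.inChart e).constraint q (incl z) a = 0) ∧
        (∀ a, (S.inChart e).normalCov1 ((S.inChart e).constraint q) (incl z) a
          - div2 halfSpace (S.inChart e).g (S.inChart e).T (incl z) a = 0) ∧
        -- the norm of the normal, for every smooth extension of the mean curvature
        (∀ h : Coord 4 → ℝ, ContDiffWithinAt ℝ ∞ h halfSpace (incl z) →
          (∀ᶠ x in 𝓝 z, h (incl x) = (S.inChart e).H x) →
          (fun y => (S.inChart e).normalSq y
              - (-1 + 2 * h y / √(3 * Λ) * (S.inChart e).Ω y))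
            =O[𝓝[halfSpace] (incl z)] fun y => (S.inChart e).Ω y ^ 2) ∧
        -- the conformal fundamental form of order `q + 3`
        (q = 0 ∨ q = 2 → ∀ i j, (S.inChart e).fundForm (q + 3) z i j
          = fundFormConst q Λ * (S.inChart e).tfProj (S.inChart e).T z i j) ∧
        -- the divergence of the fourth conformal fundamental form
        (q = 1 → (∃ j, (S.inChart e).IsCurrentAt z j) ∧
          ∀ j, (S.inChart e).IsCurrentAt z j → ∀ i,
            div2 univ (S.inChart e).bg ((S.inChart e).fundForm 4) z i
              = (Λ / 3) ^ (3 / 2 : ℝ) *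
                ((1 / 3) * pderiv univ (fun x => (S.inChart e).trT (incl x)) z i
                  - √(Λ / 3) * pull1 j z i)) ∧
        (q = 2 → ∀ i, div2 univ (S.inChart e).bg ((S.inChart e).fundForm 4) z i
          = -(Λ ^ 2 / 9) * pull1 (S.inChart e).Tn z i) ∧
        (q = 1 → ∀ a b, (S.inChart e).T (incl z) a b
          = -((S.inChart e).normal (incl z) a * (S.inChart e).normal (incl z) b
              * (S.inChart e).trT (incl z)))) ∧
    -- the fourth conformal fundamental form is not determined by local data on the boundary
    (1 ≤ q → ∃ S₁ S₂ : AsymptoticallyDeSitter (EuclideanHalfSpace 4) Λ q,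
      S₁.Ω = S₂.Ω ∧ S₁.stress = S₂.stress ∧
      (∀ e ∈ atlas (EuclideanHalfSpace 4) (EuclideanHalfSpace 4), ∀ z : Coord 3,
        incl z ∈ (e.extend (𝓡∂ 4)).target → ∀ a b,
          (fun y => (S₁.inChart e).g y a b - (S₂.inChart e).g y a b)
            =O[𝓝[halfSpace] (incl z)] fun y => (S₁.inChart e).Ω y ^ 3) ∧
      ∃ e ∈ atlas (EuclideanHalfSpace 4) (EuclideanHalfSpace 4), ∃ z : Coord 3,
        incl z ∈ (e.extend (𝓡∂ 4)).target ∧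
        (S₁.inChart e).fundForm 4 z ≠ (S₂.inChart e).fundForm 4 z) := by
  refine ⟨fun M _ _ _ S e he z hz => ?_, fun hq1 => ?_⟩
  · have h := S.localSpacetime he hΛ
    refine ⟨fun a => h.constraint_incl hz a, fun a => h.normalCov1_constraint hz a,
      fun H hH hH' => h.normalSq_isBigO hz hH hH', ?_, ?_, ?_, ?_⟩
    · rintro (rfl | rfl) i j
      · rw [fundFormConst, if_pos rfl]
        exact LocalSpacetime.fundForm_three hz h i j
      · rw [fundFormConst, if_neg two_ne_zero, rpow_five_halves (by positivity)]
        exact LocalSpacetime.fundForm_five hz h i j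
    · rintro rfl
      refine ⟨⟨h.current, h.isCurrentAt_current hz⟩, fun j hj i => ?_⟩
      rw [rpow_three_halves (by positivity)]
      exact h.div_fourthForm_current hz hj i
    · rintro rfl i
      rw [show Λ ^ 2 / 9 = (Λ / 3) ^ 2 by ring]
      exact LocalSpacetime.div_fourthForm_of_two hz h i
    · rintro rfl a b
      exact h.T_of_one hz a b
  · obtain ⟨p, rfl⟩ : ∃ p, q = p + 1 := ⟨q - 1, by omega⟩
    have hp : p ≤ 1 := by omega
    -- The two inequality proofs fix the parameters implicitly: μ = 0 and μ = 1. Both spacetimes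
    -- have T = 0, which is admissible for either decay rate.
    refine ⟨planeSpacetime hΛ (p + 1) le_rfl, planeSpacetime hΛ (p + 1) zero_le_one, rfl, rfl,
      fun e he z hz a b => ?_, idChart, mem_atlas_iff.mpr rfl, 0, ?_, fun h => ?_⟩
    · obtain rfl := mem_atlas_iff.mp he
      refine (planeMetric_sub_isBigO (lam := Λ / 3) (by positivity) zero_le_one
        (𝓝[halfSpace] (incl z)) self_mem_nhdsWithin a b).congr' ?_ ?_
      · filter_upwards [self_mem_nhdsWithin] with y hy
        rw [planeSpacetime_g hΛ _ _ hy, planeSpacetime_g hΛ _ _ hy]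
      · filter_upwards [self_mem_nhdsWithin] with y hy
        rw [planeSpacetime_Ω hΛ _ _ hy]
    · rw [idChart_target]; exact incl_mem_halfSpace 0
    · have h1 := congrFun (congrFun h 0) 0
      rw [planeSpacetime_fourthForm hΛ hp, planeSpacetime_fourthForm hΛ hp] at h1
      have h2 : 0 < √(Λ / 3) * (Λ / 3) ^ 2 := by positivity
      linarith
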